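/- For $n\ge 1$ let $F_n(x)=\sum_{k=1}^n p_k(n)x^k$ be the $n$-th partition polynomial, where $p_k(n)$ is the number of partitions of $n$ with exactly $k$ parts, and let $\mathcal Z(F_n)\subset\mathbb C$ be its finite set of zeros. Let $\mathbb D=\{x\in\mathbb C:|x|<1\}$ and $\mathrm{Li}_2(x)=\sum_{m\ge1}x^m/m^2$, and for $k=1,2,3$ put $$f_k(x)=\tfrac1k\,\Re\sqrt{\mathrm{Li}_2(x^k)}\quad(x\in\mathbb D),$$ with the principal branch of the square root. Let $$\mathcal R(k)=\{x\in\mathbb D: f_k(x)\ge f_j(x)\ \text{for } j=1,2,3\},\qquad C_{k\ell}=\{x\in\mathbb D: f_k(x)=f_\ell(x)\}.$$ Then the zero attractor of $(F_n)$, that is, the limit as $n\to\infty$ of $\mathcal Z(F_n)$ in the Hausdorff metric on the nonempty compact subsets of $\mathbb C$, exists and equals $$\{x:|x|=1\}\ \cup\ \bigl((\partial\mathcal R(1)\cup\partial\mathcal R(2)\cup\partial\mathcal R(3))\cap\mathbb D\bigr).$$ Moreover, inside the unit disk the boundaries of the regions are the following portions of the curves $C_{12}$, $C_{13}$, $C_{23}$: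 $$\partial\mathcal R(1)\cap\mathbb D=\mathcal R(1)\cap(C_{12}\cup C_{13}),\quad \partial\mathcal R(2)\cap\mathbb D=\mathcal R(2)\cap(C_{12}\cup C_{23}),\quad \partial\mathcal R(3)\cap\mathbb D=\mathcal R(3)\cap(C_{13}\cup C_{23}).$$ -/

import Mathlib

open Filter Topology Metric Polynomial

noncomputable section

namespace PartitionZeros

/-- `p_k(n)`: the number of partitions of `n` with exactly `k` parts. -/
def numPartitions (k n : ℕ) : ℕ :=
  (Finset.univ.filter fun p : n.Partition => p.parts.card = k).card

/-- The partition polynomial `F_n(x) = ∑_{k=1}^n p_k(n) x^k`. -/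
def partitionPoly (n : ℕ) : ℂ[X] :=
  ∑ k ∈ Finset.Icc 1 n, C (numPartitions k n : ℂ) * X ^ k

/-- The set of complex zeros of a polynomial. -/
def zeroSet (p : ℂ[X]) : Set ℂ := {z | p.IsRoot z}

/-- `A` is the zero attractor of the polynomial sequence `F`: a nonempty compact set that is the
limit of the zero sets of the `F n` with respect to the Hausdorff distance. -/
def IsZeroAttractor (F : ℕ → ℂ[X]) (A : Set ℂ) : Prop :=
  IsCompact A ∧ A.Nonempty ∧
    Tendsto (fun n => hausdorffEDist (zeroSet (F n)) A) atTop (𝓝 0)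

/-- The dilogarithm `Li₂(z) = ∑_{n ≥ 1} z^n / n²`; only used for `|z| < 1`. -/
def dilog (z : ℂ) : ℂ := ∑' n : ℕ, z ^ (n + 1) / ((n : ℂ) + 1) ^ 2

/-- `f_k(x) = (1/k) Re √(Li₂(x^k))`, with the principal square root. -/
def f (k : ℕ) (x : ℂ) : ℝ := (1 / (k : ℝ)) * ((dilog (x ^ k)) ^ (1 / 2 : ℂ)).re

/-- The region `R(k)` of the open unit disk where `f_k` is the largest of `f_1, f_2, f_3`. -/
def region (k : ℕ) : Set ℂ :=
  {x | x ∈ ball (0 : ℂ) 1 ∧ f 1 x ≤ f k x ∧ f 2 x ≤ f k x ∧ f 3 x ≤ f k x}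

/-- The `√Li₂`-curve `C_{kℓ}` inside the unit disk where `f_k = f_ℓ`. -/
def sqrtLiCurve (k l : ℕ) : Set ℂ := {x | x ∈ ball (0 : ℂ) 1 ∧ f k x = f l x}

end PartitionZeros

end

noncomputable section

namespace PartitionZeros

/-! Inside the disk, `F_n(x)` is the `n`-th coefficient of `∏ (1 - x u^m)⁻¹`. With `u = e^{-w}`, the
logarithm of this product is the Lambert sum `∑ x^j / (j (e^{jw} - 1))`. Near `w = iθ`, where
`e^{iθ}` is a primitive `l`-th root of unity, it behaves like `h_l² / (w - iθ)` with `h_l =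
√(Li₂(x^l)) / l` (`lambertSum_eq`, `polarCoeff_eq`). Such a point yields a saddle of size `exp(2 √n
h_l)`, so the order `l` with the largest `f_l = Re h_l` wins.

Orders `l ≥ 4` never win: `f_lt_max` shows `f_l < max(f_1, f_2)` off the origin, by means of the
lower bound `dilog_lower_bound`. Hence, where one `f_k` with `k ≤ 3` is strictly largest
(`Dominates`), the saddle point method on the circle `Re w = f_k / √n` gives the exact order of
`F_n`, uniformly near the point. For `k = 3` the primitive cube roots give two saddles of equal
size; `exists_le_norm_sum_angles` shows that they never cancel. It follows that `F_n` has no zeros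
near such a point and that `log |F_n| / √n → 2 f_k`. Outside the closed disk, `|F_n(x)| ≥ c |x|^n`
because `x^{-n} F_n(x)` tends to a nonvanishing infinite product. So zeros accumulate only on the
claimed set.

Conversely, suppose that for infinitely many `n` there are no zeros near a point `a`. Then `log
|F_n|`, divided by `√n` inside the disk or by `n` on the circle, is harmonic near `a` and bounded
above. By Harnack it converges everywhere near `a` once it converges on a dense set, and the limit
has the mean value property (`circleAverage_eq_of_tendsto`). Inside the disk the limit is `2 max
f_k`, which can be harmonic near `a ≠ 0` only if one `f_k` is largest on a whole neighbourhood. On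
the unit circle the limit is `log⁺ |x|`, which is harmonic near no point there. The origin is a zero
of every `F_n`.

The description of the boundaries amounts to the statement that the interior of `region k` is the
set of strict dominance. A tie in the interior would be a zero minimum of the harmonic function `f_k
- f_j`, so `f_j = f_k` nearby, which `not_eventually_f_eq` excludes by analytic continuation. -/

/-! ### Generating functions of weighted partitions -/

/-- The sum over the partitions of `n` of the product of the weights of the parts. -/
def partWeight (a : ℕ → ℂ) (n : ℕ) : ℂ := ∑ p : n.Partition, (p.parts.map a).prod

/-- The geometric series `∑ a^j X^{m j}`. -/
def geomSeries (a : ℂ) (m : ℕ) : PowerSeries ℂ :=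
  PowerSeries.mk fun n => if m ∣ n then a ^ (n / m) else 0

/-- The product of the geometric series of the parts `1, …, N`. -/
def geomProd (a : ℕ → ℂ) (N : ℕ) : PowerSeries ℂ :=
  ∏ i ∈ Finset.range N, geomSeries (a (i + 1)) (i + 1)

-- Identifies the factors in the product formula for `Nat.Partition.genFun` when a part of
-- multiplicity `c` is weighted by `a ^ c`.
open scoped PowerSeries.WithPiTopology in
lemma geomSeries_eq_tsum (a : ℂ) (i : ℕ) :
    1 + ∑' j : ℕ, a ^ (j + 1) • (PowerSeries.X : PowerSeries ℂ) ^ ((i + 1) * (j + 1)) =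
      geomSeries a (i + 1) := by
  have hs := Nat.Partition.summable_genFun_term (fun _ c => a ^ c) i
  ext n
  have h1 := (hs.hasSum.map (PowerSeries.coeff (R := ℂ) n)
    (PowerSeries.WithPiTopology.continuous_coeff ℂ n)).tsum_eq
  rw [map_add, ← h1]
  simp only [Function.comp_def, geomSeries, PowerSeries.coeff_mk, PowerSeries.coeff_one,
    PowerSeries.coeff_smul, PowerSeries.coeff_X_pow, smul_eq_mul, mul_ite, mul_one, mul_zero]
  rcases Nat.eq_zero_or_pos n with rfl | hn
  · simp
  · rw [if_neg hn.ne', zero_add]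
    split_ifs with hd
    · obtain ⟨k, rfl⟩ := hd
      have hk : 0 < k := Nat.pos_of_mul_pos_left hn
      obtain ⟨k, rfl⟩ := Nat.exists_eq_succ_of_ne_zero hk.ne'
      rw [tsum_eq_single k]
      · simp
      · intro b hb
        rw [if_neg]
        intro h
        exact hb (by simpa using (Nat.eq_of_mul_eq_mul_left (Nat.succ_pos i) h).symm)
    · convert tsum_zero with j
      rw [if_neg]
      rintro rfl
      exact hd (dvd_mul_right _ _)

lemma coeff_genFun_eq_partWeight (a : ℕ → ℂ) (n : ℕ) :
    (Nat.Partition.genFun (fun i c => a i ^ c)).coeff n = partWeight a n := by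
  rw [Nat.Partition.coeff_genFun]
  refine Finset.sum_congr rfl fun p _ => ?_
  rw [Finset.prod_multiset_map_count]
  simp [Finsupp.prod]

open scoped PowerSeries.WithPiTopology in
lemma hasProd_geomSeries (a : ℕ → ℂ) :
    HasProd (fun i => geomSeries (a (i + 1)) (i + 1))
      (Nat.Partition.genFun (fun i c => a i ^ c)) := by
  have h := Nat.Partition.hasProd_genFun (fun i c => a i ^ c)
  simpa only [geomSeries_eq_tsum] using h

open scoped PowerSeries.WithPiTopology in
lemma tendsto_coeff_geomProd (a : ℕ → ℂ) (n : ℕ) :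
    Tendsto (fun N => (geomProd a N).coeff n) atTop (𝓝 (partWeight a n)) := by
  have h := (hasProd_geomSeries a).tendsto_prod_nat
  rw [PowerSeries.WithPiTopology.tendsto_iff_coeff_tendsto] at h
  have h2 := h n
  rwa [coeff_genFun_eq_partWeight] at h2

-- Truncating the product gives parts larger than `N` the weight zero, so any majorant of the
-- weights also controls all truncations uniformly in `N`.
open scoped PowerSeries.WithPiTopology in
lemma coeff_geomProd (a : ℕ → ℂ) (N n : ℕ) :
    (geomProd a N).coeff n = partWeight (fun i => if i ≤ N then a i else 0) n := by
  have h := hasProd_geomSeries (fun i => if i ≤ N then a i else 0)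
  have h2 : HasProd (fun i => geomSeries ((fun i => if i ≤ N then a i else 0) (i + 1)) (i + 1))
      (geomProd a N) := by
    have : geomProd a N = ∏ i ∈ Finset.range N,
        geomSeries ((fun i => if i ≤ N then a i else 0) (i + 1)) (i + 1) := by
      refine Finset.prod_congr rfl fun i hi => ?_
      rw [Finset.mem_range] at hi
      simp [Nat.succ_le_of_lt hi]
    rw [this]
    apply hasProd_prod_of_ne_finset_one
    intro i hi
    rw [Finset.mem_range] at hi
    simp only [Nat.not_le.2 (Nat.lt_succ_of_le (Nat.not_lt.1 hi)), if_false]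
    rw [← geomSeries_eq_tsum]
    simp
  rw [h2.unique h, coeff_genFun_eq_partWeight]

lemma norm_partWeight_le {a : ℕ → ℂ} {b : ℕ → ℝ} (h : ∀ i, ‖a i‖ ≤ b i) (n : ℕ) :
    ‖partWeight a n‖ ≤ (partWeight (fun i => (b i : ℂ)) n).re := by
  have hb : ∀ s : Multiset ℕ, ‖(s.map a).prod‖ ≤ (s.map b).prod := by
    intro s
    induction s using Multiset.induction_on with
    | empty => simp
    | cons i s ih =>
      simp only [Multiset.map_cons, Multiset.prod_cons, norm_mul]
      exact mul_le_mul (h i) ih (norm_nonneg _) ((norm_nonneg _).trans (h i))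
  have hc : ∀ s : Multiset ℕ, (s.map fun i => (b i : ℂ)).prod = ((s.map b).prod : ℝ) := by
    intro s
    induction s using Multiset.induction_on with
    | empty => simp
    | cons i s ih => simp [ih]
  simp only [partWeight, hc, ← Complex.ofReal_sum, Complex.ofReal_re]
  exact (norm_sum_le _ _).trans (Finset.sum_le_sum fun p _ => hb _)

/-- Evaluation of a power series at a point of absolute convergence. -/
def EvalsTo (A : PowerSeries ℂ) (u v : ℂ) : Prop :=
  Summable (fun n => ‖A.coeff n * u ^ n‖) ∧ ∑' n, A.coeff n * u ^ n = v

lemma EvalsTo.mul {A B : PowerSeries ℂ} {u v w : ℂ} (hA : EvalsTo A u v) (hB : EvalsTo B u w) :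
    EvalsTo (A * B) u (v * w) := by
  have key : ∀ n, ∑ kl ∈ Finset.HasAntidiagonal.antidiagonal n,
      (A.coeff kl.1 * u ^ kl.1) * (B.coeff kl.2 * u ^ kl.2) = (A * B).coeff n * u ^ n := by
    intro n
    rw [PowerSeries.coeff_mul, Finset.sum_mul]
    refine Finset.sum_congr rfl fun kl hkl => ?_
    rw [← Finset.HasAntidiagonal.mem_antidiagonal.1 hkl, pow_add]
    ring
  constructor
  · have := summable_norm_sum_mul_antidiagonal_of_summable_norm hA.1 hB.1
    simpa only [key] using this
  · rw [← hA.2, ← hB.2, tsum_mul_tsum_eq_tsum_sum_antidiagonal_of_summable_norm hA.1 hB.1]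
    simp only [key]

lemma evalsTo_one (u : ℂ) : EvalsTo 1 u 1 := by
  have h : ∀ n, n ≠ 0 → (1 : PowerSeries ℂ).coeff n * u ^ n = 0 := by
    intro n hn
    simp [PowerSeries.coeff_one, hn]
  constructor
  · apply summable_of_ne_finset_zero (s := {0})
    intro n hn
    rw [h n (by simpa using hn), norm_zero]
  · rw [tsum_eq_single 0 h]
    simp

lemma evalsTo_geomSeries {a u : ℂ} {m : ℕ} (hm : 0 < m) (h : ‖a * u ^ m‖ < 1) :
    EvalsTo (geomSeries a m) u (1 - a * u ^ m)⁻¹ := by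
  have hinj : Function.Injective (fun j : ℕ => m * j) :=
    fun i j hij => Nat.eq_of_mul_eq_mul_left hm hij
  have hcomp : ∀ j : ℕ, (geomSeries a m).coeff (m * j) * u ^ (m * j) = (a * u ^ m) ^ j := by
    intro j
    simp [geomSeries, PowerSeries.coeff_mk, Nat.mul_div_cancel_left _ hm, mul_pow, pow_mul]
  have hzero : ∀ n, n ∉ Set.range (fun j : ℕ => m * j) →
      (geomSeries a m).coeff n * u ^ n = 0 := by
    intro n hn
    have : ¬ m ∣ n := fun ⟨k, hk⟩ => hn ⟨k, hk.symm⟩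
    simp [geomSeries, PowerSeries.coeff_mk, this]
  constructor
  · rw [← hinj.summable_iff (fun n hn => by rw [hzero n hn, norm_zero])]
    simp only [Function.comp_def, hcomp, norm_pow]
    exact summable_geometric_of_lt_one (norm_nonneg _) h
  · have : HasSum (fun n => (geomSeries a m).coeff n * u ^ n) (1 - a * u ^ m)⁻¹ := by
      rw [← hinj.hasSum_iff hzero]
      simp only [Function.comp_def, hcomp]
      exact hasSum_geometric_of_norm_lt_one h
    exact this.tsum_eq

lemma evalsTo_geomProd {a : ℕ → ℂ} {u : ℂ} (N : ℕ)
    (h : ∀ i < N, ‖a (i + 1) * u ^ (i + 1)‖ < 1) :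
    EvalsTo (geomProd a N) u (∏ i ∈ Finset.range N, (1 - a (i + 1) * u ^ (i + 1))⁻¹) := by
  induction N with
  | zero => simpa [geomProd] using evalsTo_one u
  | succ N ih =>
    rw [geomProd, Finset.prod_range_succ, Finset.prod_range_succ]
    exact (ih fun i hi => h i (hi.trans (Nat.lt_succ_self N))).mul
      (evalsTo_geomSeries (Nat.succ_pos _) (h N (Nat.lt_succ_self N)))

lemma partWeight_const (x : ℂ) {n : ℕ} (hn : 1 ≤ n) :
    partWeight (fun _ => x) n = (partitionPoly n).eval x := by
  have hcard : ∀ p : n.Partition, p.parts.card ∈ Finset.Icc 1 n := by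
    intro p
    rw [Finset.mem_Icc]
    constructor
    · rw [Nat.one_le_iff_ne_zero, Ne, Multiset.card_eq_zero]
      intro h
      have := p.parts_sum
      rw [h, Multiset.sum_zero] at this
      omega
    · have h1 : p.parts.card • 1 ≤ p.parts.sum :=
        Multiset.card_nsmul_le_sum fun i hi => p.parts_pos hi
      simpa [p.parts_sum] using h1
  simp only [partWeight, partitionPoly, Multiset.map_const', Multiset.prod_replicate,
    eval_finsetSum, eval_mul, eval_C, eval_pow, eval_X, numPartitions]
  rw [← Finset.sum_fiberwise_of_maps_to (s := Finset.univ) (t := Finset.Icc 1 n)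
    (g := fun p : n.Partition => p.parts.card) (fun p _ => hcard p)]
  refine Finset.sum_congr rfl fun k _ => ?_
  rw [Finset.sum_congr rfl (g := fun _ => x ^ k)]
  · simp
  · intro p hp
    rw [(Finset.mem_filter.1 hp).2]

/-! ### The Cauchy integral for the partition polynomials -/

/-- `∑_{j ≥ 1} x^j / j / (e^{j w} - 1)`, the logarithm of `∏_{m ≥ 1} (1 - x e^{-m w})⁻¹`. -/
def lambertSum (x w : ℂ) : ℂ :=
  ∑' j : ℕ, x ^ (j + 1) / ((j : ℂ) + 1) * (Complex.exp (((j : ℂ) + 1) * w) - 1)⁻¹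

lemma norm_natCast_add_one (j : ℕ) : ‖(j : ℂ) + 1‖ = (j : ℝ) + 1 := by
  have : ((j : ℂ) + 1) = ((j + 1 : ℕ) : ℂ) := by push_cast; rfl
  rw [this, Complex.norm_natCast]
  push_cast
  rfl

lemma integral_exp_int_mul (a : ℝ) (k : ℤ) :
    ∫ φ in a..a + 2 * Real.pi, Complex.exp (k * (Complex.I * φ)) =
      if k = 0 then (2 * Real.pi : ℂ) else 0 := by
  split_ifs with hk
  · simp [hk]
  · have hne : (k : ℂ) * Complex.I ≠ 0 := mul_ne_zero (by exact_mod_cast hk) Complex.I_ne_zero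
    have h := integral_exp_mul_complex (a := a) (b := a + 2 * Real.pi) hne
    simp only [mul_assoc] at h
    rw [h]
    have : (k : ℂ) * (Complex.I * ((a + 2 * Real.pi : ℝ) : ℂ)) =
        k * (Complex.I * a) + k * (2 * Real.pi * Complex.I) := by
      push_cast; ring
    rw [this, Complex.exp_add, Complex.exp_int_mul_two_pi_mul_I]
    simp

/-- Cauchy's coefficient formula on the circle `|u| = e^{-σ}`, with `u = exp(-(σ + iφ))`:
orthogonality of the exponentials isolates the term `m = n`. -/
lemma integral_mul_exp_of_evalsTo {A : PowerSeries ℂ} {σ : ℝ} {v : ℝ → ℂ} (a : ℝ)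
    (h : ∀ φ : ℝ, EvalsTo A (Complex.exp (-(σ + Complex.I * φ))) (v φ)) (n : ℕ) :
    ∫ φ in a..a + 2 * Real.pi, v φ * Complex.exp (n * (σ + Complex.I * φ)) =
      2 * Real.pi * A.coeff n := by
  set F : ℕ → ℝ → ℂ := fun m φ => A.coeff m * Complex.exp (-(σ + Complex.I * φ)) ^ m *
    Complex.exp (n * (σ + Complex.I * φ)) with hF
  have hsum : ∀ φ, HasSum (fun m => F m φ) (v φ * Complex.exp (n * (σ + Complex.I * φ))) := by
    intro φ
    have h1 : HasSum (fun m => A.coeff m * Complex.exp (-(σ + Complex.I * φ)) ^ m) (v φ) := by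
      rw [← (h φ).2]
      exact (h φ).1.of_norm.hasSum
    exact h1.mul_right _
  have hFm : ∀ m φ, F m φ = A.coeff m * Complex.exp (((n : ℤ) - m : ℤ) * σ) *
      Complex.exp (((n : ℤ) - m : ℤ) * (Complex.I * φ)) := by
    intro m φ
    simp only [hF, ← Complex.exp_nat_mul, mul_assoc, ← Complex.exp_add]
    congr 2
    push_cast
    ring
  have hnorm : ∀ m φ, ‖F m φ‖ = ‖F m 0‖ := by
    intro m φ
    rw [hFm, hFm, norm_mul, norm_mul _ (Complex.exp (_ * (Complex.I * _)))]
    congr 1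
    have : ∀ ψ : ℝ, ‖Complex.exp (((n : ℤ) - m : ℤ) * (Complex.I * ψ))‖ = 1 := by
      intro ψ
      rw [show (((n : ℤ) - m : ℤ) * (Complex.I * ψ) : ℂ) =
        ((((n : ℤ) - m : ℤ) * ψ : ℝ) : ℂ) * Complex.I by push_cast; ring]
      exact Complex.norm_exp_ofReal_mul_I _
    rw [this, this]
  have key : HasSum (fun m => ∫ φ in a..a + 2 * Real.pi, F m φ)
      (∫ φ in a..a + 2 * Real.pi, v φ * Complex.exp (n * (σ + Complex.I * φ))) := by
    apply intervalIntegral.hasSum_integral_of_dominated_convergence (fun m _ => ‖F m 0‖)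
    · intro m
      apply Continuous.aestronglyMeasurable
      fun_prop
    · intro m
      exact Eventually.of_forall fun φ _ => (hnorm m φ).le
    · refine Eventually.of_forall fun φ _ => ?_
      simp only [hF, norm_mul]
      exact (by simpa only [norm_mul] using (h 0).1 :
        Summable fun m => ‖A.coeff m‖ * ‖Complex.exp (-(σ + Complex.I * (0 : ℝ))) ^ m‖).mul_right _
    · simp
    · exact Eventually.of_forall fun φ _ => hsum φ
  rw [← key.tsum_eq, tsum_eq_single n]
  · simp only [hFm]
    rw [intervalIntegral.integral_const_mul, integral_exp_int_mul]
    simp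
    ring
  · intro m hm
    simp only [hFm]
    rw [intervalIntegral.integral_const_mul, integral_exp_int_mul, if_neg, mul_zero]
    omega

section

variable {x w : ℂ}

lemma norm_exp_neg_lt_one (hw : 0 < w.re) : ‖Complex.exp (-w)‖ < 1 := by
  rw [Complex.norm_exp]
  simpa using hw

lemma summable_lambert_double (hx : ‖x‖ < 1) (hw : 0 < w.re) :
    Summable fun q : ℕ × ℕ =>
      (x * Complex.exp (-w) ^ (q.1 + 1)) ^ (q.2 + 1) / ((q.2 : ℂ) + 1) := by
  have hu := norm_exp_neg_lt_one hw
  have h1 : Summable fun m : ℕ => ‖Complex.exp (-w)‖ ^ (m + 1) :=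
    (summable_nat_add_iff 1).2 (summable_geometric_of_lt_one (norm_nonneg _) hu)
  have h2 : Summable fun m : ℕ => ‖x‖ ^ (m + 1) :=
    (summable_nat_add_iff 1).2 (summable_geometric_of_lt_one (norm_nonneg _) hx)
  refine Summable.of_norm_bounded
    (h1.mul_of_nonneg h2 (fun _ => by positivity) (fun _ => by positivity)) ?_
  rintro ⟨m, j⟩
  simp only [norm_div, norm_pow, norm_mul, norm_natCast_add_one, mul_pow]
  rw [mul_comm (‖Complex.exp (-w)‖ ^ (m + 1)), mul_div_assoc]
  gcongr
  rw [← pow_mul]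
  calc ‖Complex.exp (-w)‖ ^ ((m + 1) * (j + 1)) / ((j : ℝ) + 1)
      ≤ ‖Complex.exp (-w)‖ ^ ((m + 1) * (j + 1)) / 1 := by gcongr; linarith [j.cast_nonneg (α := ℝ)]
    _ ≤ ‖Complex.exp (-w)‖ ^ (m + 1) := by
        rw [div_one]
        exact pow_le_pow_of_le_one (norm_nonneg _) hu.le (Nat.le_mul_of_pos_right _ (Nat.succ_pos j))

lemma hasSum_neg_log (hx : ‖x‖ < 1) (hw : 0 < w.re) (m : ℕ) :
    HasSum (fun j : ℕ => (x * Complex.exp (-w) ^ (m + 1)) ^ (j + 1) / ((j : ℂ) + 1))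
      (-Complex.log (1 - x * Complex.exp (-w) ^ (m + 1))) := by
  have hn : ‖x * Complex.exp (-w) ^ (m + 1)‖ < 1 := by
    rw [norm_mul, norm_pow]
    have := pow_le_one₀ (n := m + 1) (norm_nonneg _) (norm_exp_neg_lt_one hw).le
    calc _ ≤ ‖x‖ * 1 := by gcongr
      _ < 1 := by simpa using hx
  have h := Complex.hasSum_taylorSeries_neg_log hn
  rw [← hasSum_nat_add_iff' 1] at h
  simpa using h

lemma hasSum_lambert_row (hw : 0 < w.re) (j : ℕ) :
    HasSum (fun m : ℕ => (x * Complex.exp (-w) ^ (m + 1)) ^ (j + 1) / ((j : ℂ) + 1))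
      (x ^ (j + 1) / ((j : ℂ) + 1) * (Complex.exp (((j : ℂ) + 1) * w) - 1)⁻¹) := by
  have hu := norm_exp_neg_lt_one hw
  set u := Complex.exp (-w) with hudef
  have hu' : ‖u ^ (j + 1)‖ < 1 := by
    rw [norm_pow]
    exact pow_lt_one₀ (norm_nonneg _) hu (Nat.succ_ne_zero j)
  have h := ((hasSum_geometric_of_norm_lt_one hu').mul_left (u ^ (j + 1))).mul_left
    (x ^ (j + 1) / ((j : ℂ) + 1))
  have hE : Complex.exp (((j : ℂ) + 1) * w) = (u ^ (j + 1))⁻¹ := by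
    rw [hudef, ← Complex.exp_nat_mul, ← Complex.exp_neg]
    congr 1
    push_cast
    ring
  have hne : u ^ (j + 1) ≠ 0 := pow_ne_zero _ (Complex.exp_ne_zero _)
  have hne2 : 1 - u ^ (j + 1) ≠ 0 := by
    intro h0
    rw [← sub_eq_zero.1 h0] at hu'
    simp at hu'
  have e1 : (fun m : ℕ => (x * u ^ (m + 1)) ^ (j + 1) / ((j : ℂ) + 1)) =
      fun m => x ^ (j + 1) / ((j : ℂ) + 1) * (u ^ (j + 1) * (u ^ (j + 1)) ^ m) := by
    funext m
    rw [mul_pow, ← pow_mul, ← pow_mul]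
    ring
  have e2 : ((u ^ (j + 1))⁻¹ - 1)⁻¹ = u ^ (j + 1) * (1 - u ^ (j + 1))⁻¹ := by
    field_simp
  rw [e1, hE, e2]
  exact h

/-- Expand every logarithm and exchange the sums: for fixed exponent, the sum over part sizes is
geometric and produces `(e^{jw} - 1)⁻¹`. -/
lemma hasSum_neg_log_lambertSum (hx : ‖x‖ < 1) (hw : 0 < w.re) :
    HasSum (fun m : ℕ => -Complex.log (1 - x * Complex.exp (-w) ^ (m + 1))) (lambertSum x w) := by
  have hs := summable_lambert_double hx hw
  have h1 := hs.hasSum.prod_fiberwise fun m => hasSum_neg_log hx hw m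
  have h2 := ((Equiv.prodComm ℕ ℕ).hasSum_iff.2 hs.hasSum).prod_fiberwise
    fun j => hasSum_lambert_row hw j
  rw [lambertSum, h2.tsum_eq]
  exact h1

lemma norm_neg_log_le (hx : ‖x‖ < 1) (hw : 0 < w.re) (m : ℕ) :
    ‖-Complex.log (1 - x * Complex.exp (-w) ^ (m + 1))‖ ≤
      (1 - ‖x‖)⁻¹ * ‖Complex.exp (-w)‖ ^ m := by
  have hu := norm_exp_neg_lt_one hw
  set u := Complex.exp (-w)
  have hg : HasSum (fun j : ℕ => ‖u‖ ^ m * ‖x‖ ^ j) ((1 - ‖x‖)⁻¹ * ‖u‖ ^ m) := by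
    rw [mul_comm]
    exact (hasSum_geometric_of_lt_one (norm_nonneg _) hx).mul_left _
  rw [← (hasSum_neg_log hx hw m).tsum_eq]
  refine tsum_of_norm_bounded hg fun j => ?_
  rw [norm_div, norm_natCast_add_one, norm_pow, norm_mul, norm_pow, mul_pow, ← pow_mul]
  calc ‖x‖ ^ (j + 1) * ‖u‖ ^ ((m + 1) * (j + 1)) / ((j : ℝ) + 1)
      ≤ ‖x‖ ^ (j + 1) * ‖u‖ ^ ((m + 1) * (j + 1)) / 1 := by
        gcongr; linarith [j.cast_nonneg (α := ℝ)]
    _ ≤ ‖x‖ ^ j * ‖u‖ ^ m := by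
        rw [div_one]
        gcongr ?_ * ?_
        · exact pow_le_pow_of_le_one (norm_nonneg _) hx.le (Nat.le_succ j)
        · refine pow_le_pow_of_le_one (norm_nonneg _) hu.le ?_
          nlinarith
    _ = _ := mul_comm _ _

lemma prod_inv_eq_exp (hx : ‖x‖ < 1) (hw : 0 < w.re) (N : ℕ) :
    ∏ i ∈ Finset.range N, (1 - x * Complex.exp (-w) ^ (i + 1))⁻¹ =
      Complex.exp (∑ i ∈ Finset.range N, -Complex.log (1 - x * Complex.exp (-w) ^ (i + 1))) := by
  rw [Complex.exp_sum]
  refine Finset.prod_congr rfl fun i _ => ?_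
  rw [Complex.exp_neg (Complex.log _), Complex.exp_log]
  intro h0
  have hu := norm_exp_neg_lt_one hw
  have h1 : ‖x * Complex.exp (-w) ^ (i + 1)‖ < 1 := by
    rw [norm_mul, norm_pow]
    have := pow_le_one₀ (n := i + 1) (norm_nonneg _) hu.le
    calc _ ≤ ‖x‖ * 1 := by gcongr
      _ < 1 := by simpa using hx
  rw [← sub_eq_zero.1 h0] at h1
  simp at h1

end

/-- The coefficient formula is used for finite products only, and `N → ∞` is taken under the
integral by dominated convergence. The start `a` of the period stays free so that the saddle angles
can be kept away from the endpoints. -/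
lemma partitionPoly_eval_eq_integral {x : ℂ} (hx : ‖x‖ < 1) {n : ℕ} (hn : 1 ≤ n) {σ : ℝ}
    (hσ : 0 < σ) (a : ℝ) :
    2 * Real.pi * (partitionPoly n).eval x = ∫ φ in a..a + 2 * Real.pi,
      Complex.exp (lambertSum x (σ + Complex.I * φ) + n * (σ + Complex.I * φ)) := by
  have hre : ∀ φ : ℝ, 0 < ((σ : ℂ) + Complex.I * φ).re := by intro φ; simpa using hσ
  have hnorm : ∀ φ : ℝ, ‖Complex.exp (-((σ : ℂ) + Complex.I * φ))‖ = Real.exp (-σ) := by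
    intro φ
    rw [Complex.norm_exp]
    simp
  set Q : ℕ → ℝ → ℂ := fun N φ =>
    ∏ i ∈ Finset.range N, (1 - x * Complex.exp (-((σ : ℂ) + Complex.I * φ)) ^ (i + 1))⁻¹ with hQ
  have hfin : ∀ N, ∫ φ in a..a + 2 * Real.pi, Q N φ * Complex.exp (n * (σ + Complex.I * φ)) =
      2 * Real.pi * (geomProd (fun _ => x) N).coeff n := by
    intro N
    refine integral_mul_exp_of_evalsTo a (fun φ => ?_) n
    refine evalsTo_geomProd (a := fun _ => x) N fun i _ => ?_
    rw [norm_mul, norm_pow, hnorm]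
    have h1 : Real.exp (-σ) ≤ 1 := by simpa using hσ.le
    have := pow_le_one₀ (n := i + 1) (Real.exp_pos _).le h1
    calc _ ≤ ‖x‖ * 1 := by gcongr
      _ < 1 := by simpa using hx
  have hL := (tendsto_coeff_geomProd (fun _ => x) n).const_mul (2 * Real.pi : ℂ)
  rw [partWeight_const x hn] at hL
  refine tendsto_nhds_unique hL ?_
  simp only [← hfin]
  have hB : ∀ φ : ℝ, Summable fun m : ℕ => (1 - ‖x‖)⁻¹ * Real.exp (-σ) ^ m := fun φ =>
    (summable_geometric_of_lt_one (Real.exp_pos _).le (by simpa using hσ)).mul_left _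
  apply intervalIntegral.tendsto_integral_filter_of_dominated_convergence
    (fun _ => Real.exp (∑' m : ℕ, (1 - ‖x‖)⁻¹ * Real.exp (-σ) ^ m) * Real.exp (n * σ))
  · refine Eventually.of_forall fun N => Measurable.aestronglyMeasurable ?_
    simp only [hQ]
    fun_prop
  · refine Eventually.of_forall fun N => Eventually.of_forall fun φ _ => ?_
    simp only [hQ]
    rw [prod_inv_eq_exp hx (hre φ), norm_mul, Complex.norm_exp, Complex.norm_exp]
    have : ((n : ℂ) * ((σ : ℂ) + Complex.I * φ)).re = n * σ := by simp
    rw [this]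
    gcongr
    refine (Complex.re_le_norm _).trans ((norm_sum_le _ _).trans ?_)
    refine le_trans (Finset.sum_le_sum fun i _ => norm_neg_log_le hx (hre φ) i) ?_
    simp only [hnorm]
    exact (hB φ).sum_le_tsum _ fun i _ => by
      have : 0 < 1 - ‖x‖ := by linarith
      positivity
  · simp
  · refine Eventually.of_forall fun φ _ => ?_
    rw [Complex.exp_add]
    refine Tendsto.mul_const _ ?_
    simp only [hQ, prod_inv_eq_exp hx (hre φ)]
    exact (Complex.continuous_exp.tendsto _).comp
      (hasSum_neg_log_lambertSum hx (hre φ)).tendsto_sum_nat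

/-- Follows from `|q e^z| = e^{Re z} ≥ 1 + Re z`. Uniformity in `q` lets it serve at every root of
unity. -/
lemma le_norm_mul_exp_sub_one {q z : ℂ} (hq : ‖q‖ = 1) : z.re ≤ ‖q * Complex.exp z - 1‖ := by
  have h1 : Real.exp z.re - 1 ≤ ‖q * Complex.exp z - 1‖ := by
    have := norm_sub_norm_le (q * Complex.exp z) 1
    rwa [norm_mul, hq, one_mul, Complex.norm_exp, norm_one] at this
  linarith [Real.add_one_le_exp z.re]

lemma norm_inv_mul_exp_sub_one_le {q z : ℂ} (hq : ‖q‖ = 1) (hz : 0 < z.re) :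
    ‖(q * Complex.exp z - 1)⁻¹‖ ≤ z.re⁻¹ := by
  rw [norm_inv]
  exact inv_anti₀ hz (le_norm_mul_exp_sub_one hq)

lemma norm_lambertSum_le {x w : ℂ} (hx : ‖x‖ ≤ 1) (hw : 0 < w.re) :
    ‖lambertSum x w‖ ≤ 2 / w.re := by
  have hz : HasSum (fun j : ℕ => 1 / ((j : ℝ) + 1) ^ 2) (Real.pi ^ 2 / 6) := by
    have h := (hasSum_nat_add_iff' 1).2 hasSum_zeta_two
    simpa using h
  have hpi : Real.pi ^ 2 / 6 ≤ 2 := by nlinarith [Real.pi_lt_d2, Real.pi_pos]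
  refine (tsum_of_norm_bounded (hz.mul_right w.re⁻¹) fun j => ?_).trans ?_
  · have hj : (((j : ℂ) + 1) * w).re = ((j : ℝ) + 1) * w.re := by simp
    have h0 : 0 < (((j : ℂ) + 1) * w).re := by rw [hj]; positivity
    have h1 := norm_inv_mul_exp_sub_one_le (q := 1) norm_one h0
    rw [one_mul, hj] at h1
    rw [norm_mul, norm_div, norm_natCast_add_one, norm_pow]
    calc ‖x‖ ^ (j + 1) / ((j : ℝ) + 1) * ‖(Complex.exp (((j : ℂ) + 1) * w) - 1)⁻¹‖
        ≤ 1 / ((j : ℝ) + 1) * (((j : ℝ) + 1) * w.re)⁻¹ := by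
          gcongr
          exact pow_le_one₀ (norm_nonneg _) hx
      _ = _ := by field_simp
  · rw [div_eq_mul_inv]
    exact mul_le_mul_of_nonneg_right hpi (inv_nonneg.2 hw.le)

lemma norm_partitionPoly_eval_le_of_lt {x : ℂ} (hx : ‖x‖ < 1) {n : ℕ} (hn : 1 ≤ n) :
    ‖(partitionPoly n).eval x‖ ≤ Real.exp (3 * √n) := by
  have hs : 0 < √(n : ℝ) := Real.sqrt_pos.2 (by exact_mod_cast hn)
  -- The radius `σ = 1 / √n` balances the bound `2 / σ` for the Lambert sum against `n σ`; together
  -- they give `3 √n`.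
  have hσ : 0 < (√(n : ℝ))⁻¹ := inv_pos.2 hs
  have h := partitionPoly_eval_eq_integral hx hn hσ 0
  have hb : ∀ φ ∈ Set.uIoc 0 (0 + 2 * Real.pi),
      ‖Complex.exp (lambertSum x (((√(n : ℝ))⁻¹ : ℝ) + Complex.I * φ) +
        n * (((√(n : ℝ))⁻¹ : ℝ) + Complex.I * φ))‖ ≤ Real.exp (3 * √n) := by
    intro φ _
    have hre : ((((√(n : ℝ))⁻¹ : ℝ) : ℂ) + Complex.I * φ).re = (√(n : ℝ))⁻¹ := by
      rw [Complex.add_re, Complex.ofReal_re, mul_comm, Complex.re_ofReal_mul, Complex.I_re,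
        mul_zero, add_zero]
    rw [Complex.norm_exp, Complex.add_re]
    have h1 := (Complex.re_le_norm _).trans
      (norm_lambertSum_le hx.le (w := (((√(n : ℝ))⁻¹ : ℝ) : ℂ) + Complex.I * φ) (by rwa [hre]))
    rw [hre, div_inv_eq_mul] at h1
    have h2 : ((n : ℂ) * ((((√(n : ℝ))⁻¹ : ℝ) : ℂ) + Complex.I * φ)).re = √n := by
      rw [← Complex.ofReal_natCast, Complex.re_ofReal_mul, hre, ← div_eq_mul_inv, Real.div_sqrt]
    rw [h2]
    gcongr
    linarith
  have h3 := intervalIntegral.norm_integral_le_of_norm_le_const hb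
  rw [← h, norm_mul] at h3
  have h4 : ‖(2 * Real.pi : ℂ)‖ = 2 * Real.pi := by
    simp [abs_of_pos Real.pi_pos]
  rw [h4, zero_add, sub_zero, abs_of_pos (by positivity), mul_comm] at h3
  exact le_of_mul_le_mul_right h3 (by positivity)

/-- The sum is the value of the polynomial at `1`, a boundary point of the disk, reached as the
limit `t → 1⁻`. -/
lemma sum_numPartitions_le {n : ℕ} (hn : 1 ≤ n) :
    ∑ k ∈ Finset.Icc 1 n, (numPartitions k n : ℝ) ≤ Real.exp (3 * √n) := by
  have h1 : Tendsto (fun t : ℝ => ‖(partitionPoly n).eval (t : ℂ)‖) (𝓝[<] 1)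
      (𝓝 ‖(partitionPoly n).eval ((1 : ℝ) : ℂ)‖) := by
    have : Continuous fun t : ℝ => ‖(partitionPoly n).eval (t : ℂ)‖ := by fun_prop
    exact this.continuousAt.tendsto.mono_left nhdsWithin_le_nhds
  have h2 : ‖(partitionPoly n).eval ((1 : ℝ) : ℂ)‖ ≤ Real.exp (3 * √n) := by
    refine le_of_tendsto h1 ?_
    have : Set.Ioo (0 : ℝ) 1 ∈ 𝓝[<] (1 : ℝ) := Ioo_mem_nhdsLT one_pos
    filter_upwards [this] with t ht
    refine norm_partitionPoly_eval_le_of_lt ?_ hn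
    rw [Complex.norm_real, Real.norm_eq_abs, abs_of_pos ht.1]
    exact ht.2
  refine le_trans (le_of_eq ?_) h2
  have h3 : (partitionPoly n).eval ((1 : ℝ) : ℂ) =
      ((∑ k ∈ Finset.Icc 1 n, (numPartitions k n : ℝ) : ℝ) : ℂ) := by
    simp [partitionPoly, eval_finsetSum]
  rw [h3, Complex.norm_real, Real.norm_eq_abs, abs_of_nonneg]
  positivity

lemma norm_partitionPoly_eval_le (x : ℂ) {n : ℕ} (hn : 1 ≤ n) :
    ‖(partitionPoly n).eval x‖ ≤ Real.exp (3 * √n) * max 1 ‖x‖ ^ n := by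
  refine le_trans ?_ (mul_le_mul_of_nonneg_right (sum_numPartitions_le hn) (by positivity))
  rw [partitionPoly, eval_finsetSum, Finset.sum_mul]
  refine (norm_sum_le _ _).trans (Finset.sum_le_sum fun k hk => ?_)
  simp only [eval_mul, eval_C, eval_pow, eval_X, norm_mul, norm_pow, Complex.norm_natCast]
  gcongr
  calc ‖x‖ ^ k ≤ max 1 ‖x‖ ^ k := by gcongr; exact le_max_right _ _
    _ ≤ max 1 ‖x‖ ^ n := pow_le_pow_right₀ (le_max_left _ _) (Finset.mem_Icc.1 hk).2

/-! ### The partition polynomials outside the unit disk -/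

lemma partWeight_pow_mul (y : ℂ) (a : ℕ → ℂ) (n : ℕ) :
    partWeight (fun i => y ^ i * a i) n = y ^ n * partWeight a n := by
  rw [partWeight, partWeight, Finset.mul_sum]
  refine Finset.sum_congr rfl fun p _ => ?_
  rw [Multiset.prod_map_mul]
  congr 1
  have : ∀ s : Multiset ℕ, (s.map fun i => y ^ i).prod = y ^ s.sum := by
    intro s
    induction s using Multiset.induction_on with
    | empty => simp
    | cons i s ih => simp [ih, pow_add]
  rw [this, p.parts_sum]

/-- The weights obtained from `a` by forbidding parts of size at most one. -/
def dropOnes {R : Type*} [Zero R] (a : ℕ → R) (i : ℕ) : R := if i ≤ 1 then 0 else a i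

lemma geomSeries_zero_one : geomSeries 0 1 = 1 := by
  ext n
  simp only [geomSeries, PowerSeries.coeff_mk, PowerSeries.coeff_one, Nat.div_one, one_dvd,
    if_true]
  rcases Nat.eq_zero_or_pos n with rfl | hn
  · simp
  · simp [hn.ne']

lemma geomProd_eq_mul_dropOnes {a : ℕ → ℂ} (N : ℕ) :
    geomProd a (N + 1) = geomSeries (a 1) 1 * geomProd (dropOnes a) (N + 1) := by
  rw [geomProd, geomProd, Finset.prod_range_succ', Finset.prod_range_succ']
  simp only [dropOnes, zero_add, le_refl, if_true, geomSeries_zero_one, mul_one]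
  rw [mul_comm]
  congr 1

/-- Parts of size one with weight `1` contribute the factor `1 / (1 - u)`, and multiplication by it
forms partial sums of coefficients. -/
lemma partWeight_eq_sum_dropOnes {a : ℕ → ℂ} (ha : a 1 = 1) (n : ℕ) :
    partWeight a n = ∑ i ∈ Finset.range (n + 1), partWeight (dropOnes a) i := by
  have h1 := (tendsto_coeff_geomProd a n).comp (tendsto_add_atTop_nat 1)
  have h2 : Tendsto (fun N => ∑ i ∈ Finset.range (n + 1),
      (geomProd (dropOnes a) (N + 1)).coeff i) atTop
      (𝓝 (∑ i ∈ Finset.range (n + 1), partWeight (dropOnes a) i)) :=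
    tendsto_finsetSum _ fun i _ =>
      (tendsto_coeff_geomProd (dropOnes a) i).comp (tendsto_add_atTop_nat 1)
  refine tendsto_nhds_unique h1 (h2.congr fun N => ?_)
  simp only [Function.comp_def]
  rw [geomProd_eq_mul_dropOnes (a := a), mul_comm, PowerSeries.coeff_mul,
    Finset.Nat.sum_antidiagonal_eq_sum_range_succ_mk]
  refine Finset.sum_congr rfl fun i _ => ?_
  simp [geomSeries, ha]

/-- The weights `ρ^(i-1)` of the parts `i ≥ 2`. -/
def shiftWeight (ρ : ℝ) : ℕ → ℝ := dropOnes fun i => ρ ^ (i - 1)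

lemma sum_shiftWeight_le {ρ : ℝ} (h0 : 0 ≤ ρ) (h1 : ρ < 1) (N : ℕ) :
    ∑ i ∈ Finset.range N, shiftWeight ρ (i + 1) ≤ (1 - ρ)⁻¹ := by
  rw [← tsum_geometric_of_lt_one h0 h1]
  refine le_trans (Finset.sum_le_sum fun i _ => ?_)
    ((summable_geometric_of_lt_one h0 h1).sum_le_tsum (Finset.range N) fun i _ => by positivity)
  rw [shiftWeight, dropOnes]
  split_ifs
  · positivity
  · simp

lemma shiftWeight_nonneg {ρ : ℝ} (h0 : 0 ≤ ρ) (i : ℕ) : 0 ≤ shiftWeight ρ i := by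
  rw [shiftWeight, dropOnes]
  split_ifs
  · exact le_rfl
  · positivity

lemma shiftWeight_le {ρ : ℝ} (h0 : 0 ≤ ρ) (h1 : ρ < 1) (i : ℕ) : shiftWeight ρ i ≤ ρ := by
  rw [shiftWeight, dropOnes]
  split_ifs
  · exact h0
  · exact pow_le_of_le_one h0 h1.le (by omega)

/-- The coefficients are nonnegative, so it suffices to bound the finite products at `u = 1`. Each
factor satisfies `(1 - b)⁻¹ ≤ 1 + b / (1 - ρ) ≤ exp(b / (1 - ρ))`, and the weights `b` add up to at
most `(1 - ρ)⁻¹`. -/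
lemma summable_partWeight_shiftWeight {ρ : ℝ} (h0 : 0 ≤ ρ) (h1 : ρ < 1) :
    Summable fun i => (partWeight (fun i => (shiftWeight ρ i : ℂ)) i).re := by
  have hρ : 0 < 1 - ρ := by linarith
  refine summable_of_sum_range_le (c := Real.exp ((1 - ρ)⁻¹ * (1 - ρ)⁻¹)) (fun i => ?_) fun M => ?_
  · refine (norm_nonneg _).trans (norm_partWeight_le (a := fun i => (shiftWeight ρ i : ℂ))
      (fun i => ?_) i)
    rw [Complex.norm_real, Real.norm_eq_abs, abs_of_nonneg (shiftWeight_nonneg h0 i)]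
  have hlim : Tendsto (fun N => ∑ i ∈ Finset.range M,
      ((geomProd (fun i => (shiftWeight ρ i : ℂ)) N).coeff i).re) atTop
      (𝓝 (∑ i ∈ Finset.range M, (partWeight (fun i => (shiftWeight ρ i : ℂ)) i).re)) :=
    tendsto_finsetSum _ fun i _ => (Complex.continuous_re.tendsto _).comp
      (tendsto_coeff_geomProd (fun i => (shiftWeight ρ i : ℂ)) i)
  refine le_of_tendsto hlim (Eventually.of_forall fun N => ?_)
  have hev : EvalsTo (geomProd (fun i => (shiftWeight ρ i : ℂ)) N) 1
      (∏ i ∈ Finset.range N, (1 - (shiftWeight ρ (i + 1) : ℂ) * 1 ^ (i + 1))⁻¹) := by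
    refine evalsTo_geomProd (a := fun i => (shiftWeight ρ i : ℂ)) N fun i _ => ?_
    rw [one_pow, mul_one, Complex.norm_real, Real.norm_eq_abs,
      abs_of_nonneg (shiftWeight_nonneg h0 _)]
    exact (shiftWeight_le h0 h1 _).trans_lt h1
  simp only [EvalsTo, one_pow, mul_one] at hev
  have hs : Summable fun n => ((geomProd (fun i => (shiftWeight ρ i : ℂ)) N).coeff n).re :=
    (Complex.hasSum_re hev.1.of_norm.hasSum).summable
  have hnn : ∀ n, 0 ≤ ((geomProd (fun i => (shiftWeight ρ i : ℂ)) N).coeff n).re := by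
    intro n
    rw [coeff_geomProd]
    have h := norm_partWeight_le (a := fun i => if i ≤ N then (shiftWeight ρ i : ℂ) else 0)
      (b := fun i => if i ≤ N then shiftWeight ρ i else 0) (fun i => by
        split_ifs
        · rw [Complex.norm_real, Real.norm_eq_abs, abs_of_nonneg (shiftWeight_nonneg h0 _)]
        · simp) n
    refine (norm_nonneg _).trans (h.trans (le_of_eq ?_))
    congr 2
    funext i
    split_ifs <;> simp
  refine (hs.sum_le_tsum _ fun i _ => hnn i).trans ?_
  rw [← (Complex.hasSum_re hev.1.of_norm.hasSum).tsum_eq.symm, hev.2]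
  refine (Complex.re_le_norm _).trans ?_
  rw [norm_prod]
  calc ∏ i ∈ Finset.range N, ‖(1 - (shiftWeight ρ (i + 1) : ℂ))⁻¹‖
      ≤ ∏ i ∈ Finset.range N, Real.exp (shiftWeight ρ (i + 1) * (1 - ρ)⁻¹) := by
        refine Finset.prod_le_prod (fun _ _ => norm_nonneg _) fun i _ => ?_
        have hb := shiftWeight_le h0 h1 (i + 1)
        have hb0 := shiftWeight_nonneg h0 (i + 1)
        set b := shiftWeight ρ (i + 1)
        have : (1 - (b : ℂ)) = ((1 - b : ℝ) : ℂ) := by push_cast; rfl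
        rw [norm_inv, this, Complex.norm_real, Real.norm_eq_abs, abs_of_pos (by linarith)]
        refine le_trans ?_ (Real.add_one_le_exp _)
        have h2 : 0 < 1 - b := by linarith
        rw [inv_le_iff_one_le_mul₀ h2]
        have h3 : 1 ≤ (1 - ρ)⁻¹ * (1 - b) := by
          rw [← div_eq_inv_mul, le_div_iff₀ hρ]; linarith
        nlinarith
    _ = Real.exp ((∑ i ∈ Finset.range N, shiftWeight ρ (i + 1)) * (1 - ρ)⁻¹) := by
        rw [← Real.exp_sum, Finset.sum_mul]
    _ ≤ _ := by
        gcongr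
        exact sum_shiftWeight_le h0 h1 N

/-- The sum is the limit of the finite products at `u = 1`, where every factor has modulus at least
`(1 + b)⁻¹ ≥ e^{-b}`. -/
lemma le_norm_tsum_partWeight {ρ : ℝ} (h0 : 0 ≤ ρ) (h1 : ρ < 1) {a : ℕ → ℂ}
    (ha : ∀ i, ‖a i‖ ≤ shiftWeight ρ i) :
    Real.exp (-(1 - ρ)⁻¹) ≤ ‖∑' i, partWeight a i‖ := by
  have hlim : Tendsto (fun N => ∑' i, (geomProd a N).coeff i) atTop (𝓝 (∑' i, partWeight a i)) := by
    refine tendsto_tsum_of_dominated_convergence (summable_partWeight_shiftWeight h0 h1)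
      (fun i => tendsto_coeff_geomProd a i) (Eventually.of_forall fun N i => ?_)
    rw [coeff_geomProd]
    refine norm_partWeight_le (fun i => ?_) _
    split_ifs
    · exact ha i
    · simpa using shiftWeight_nonneg h0 i
  refine ge_of_tendsto hlim.norm (Eventually.of_forall fun N => ?_)
  have hlt : ∀ i, ‖a (i + 1)‖ < 1 := fun i => ((ha _).trans (shiftWeight_le h0 h1 _)).trans_lt h1
  have hev := evalsTo_geomProd (a := a) (u := 1) N (fun i _ => by simpa using hlt i)
  simp only [EvalsTo, one_pow, mul_one] at hev
  rw [hev.2, norm_prod]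
  calc Real.exp (-(1 - ρ)⁻¹)
      ≤ Real.exp (∑ i ∈ Finset.range N, -shiftWeight ρ (i + 1)) := by
        gcongr
        rw [Finset.sum_neg_distrib]
        exact neg_le_neg (sum_shiftWeight_le h0 h1 N)
    _ = ∏ i ∈ Finset.range N, Real.exp (-shiftWeight ρ (i + 1)) := Real.exp_sum _ _
    _ ≤ _ := by
        refine Finset.prod_le_prod (fun _ _ => (Real.exp_pos _).le) fun i _ => ?_
        rw [Real.exp_neg, norm_inv]
        have hpos : 0 < ‖1 - a (i + 1)‖ := by
          have := norm_sub_norm_le 1 (a (i + 1))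
          rw [norm_one] at this
          linarith [hlt i]
        refine inv_anti₀ hpos ?_
        have := norm_sub_le 1 (a (i + 1))
        rw [norm_one] at this
        linarith [ha (i + 1), Real.add_one_le_exp (shiftWeight ρ (i + 1))]

/-- Outside a disk of radius larger than one the polynomials grow like `‖x‖ ^ n`. -/
theorem exists_le_norm_partitionPoly_eval {ρ : ℝ} (h0 : 0 < ρ) (h1 : ρ < 1) :
    ∃ c > 0, ∀ᶠ n in atTop, ∀ x : ℂ, ρ⁻¹ ≤ ‖x‖ →
      c * ‖x‖ ^ n ≤ ‖(partitionPoly n).eval x‖ := by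
  set c := Real.exp (-(1 - ρ)⁻¹) with hc
  have hcpos : 0 < c := Real.exp_pos _
  refine ⟨c / 2, by positivity, ?_⟩
  have hsum := summable_partWeight_shiftWeight h0.le h1
  set s := fun i => (partWeight (fun i => (shiftWeight ρ i : ℂ)) i).re with hs
  have htail : Tendsto (fun n => ∑' i, s (i + (n + 1))) atTop (𝓝 0) :=
    (tendsto_sum_nat_add s).comp (tendsto_add_atTop_nat 1)
  filter_upwards [htail.eventually_lt_const (half_pos hcpos), eventually_ge_atTop 1] with n hn hn1 x hx
  have hxpos : 0 < ‖x‖ := (inv_pos.2 h0).trans_le hx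
  have hx0 : x ≠ 0 := norm_pos_iff.1 hxpos
  -- Dividing `F_n(x)` by `x^n` gives the part `i` the weight `x^{1-i}`: it is `1` for `i = 1` and
  -- decays geometrically afterwards. Thus `x^{-n} F_n(x)` is a partial sum of an absolutely
  -- convergent series with sum bounded away from zero.
  set a : ℕ → ℂ := fun i => x⁻¹ ^ i * x with ha
  have hadrop : ∀ i, ‖dropOnes a i‖ ≤ shiftWeight ρ i := by
    intro i
    rw [shiftWeight, dropOnes, dropOnes]
    split_ifs with hi
    · simp
    · obtain ⟨k, rfl⟩ : ∃ k, i = k + 1 := ⟨i - 1, by omega⟩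
      simp only [ha, pow_succ, Nat.add_sub_cancel]
      rw [mul_assoc, inv_mul_cancel₀ hx0, mul_one, norm_pow, norm_inv]
      gcongr
      exact inv_le_of_inv_le₀ h0 hx
  have hle : ∀ i, ‖partWeight (dropOnes a) i‖ ≤ s i := fun i => norm_partWeight_le hadrop i
  have hS : Summable fun i => partWeight (dropOnes a) i := Summable.of_norm_bounded hsum hle
  have hR : partWeight a n = x⁻¹ ^ n * (partitionPoly n).eval x := by
    rw [← partWeight_const x hn1, ← partWeight_pow_mul]
  have hR2 := partWeight_eq_sum_dropOnes (a := a) (by simp [ha, hx0]) n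
  have hsplit := hS.sum_add_tsum_nat_add (n + 1)
  rw [← hR2] at hsplit
  have htl : ‖∑' i, partWeight (dropOnes a) (i + (n + 1))‖ ≤ ∑' i, s (i + (n + 1)) :=
    tsum_of_norm_bounded ((summable_nat_add_iff (n + 1)).2 hsum).hasSum fun i => hle _
  have hlow := le_norm_tsum_partWeight h0.le h1 hadrop
  rw [← hsplit] at hlow
  have h5 := hlow.trans (norm_add_le _ _)
  have h6 : c / 2 ≤ ‖partWeight a n‖ := by linarith
  rw [hR, norm_mul, norm_pow, norm_inv, inv_pow, ← div_eq_inv_mul, le_div_iff₀ (by positivity)] at h6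
  exact h6

/-! ### The dilogarithm -/

lemma hasSum_one_div_succ_sq : HasSum (fun j : ℕ => 1 / ((j : ℝ) + 1) ^ 2) (Real.pi ^ 2 / 6) := by
  have h := (hasSum_nat_add_iff' 1).2 hasSum_zeta_two
  simpa using h

lemma norm_dilog_term_le {z : ℂ} (hz : ‖z‖ ≤ 1) (n : ℕ) :
    ‖z ^ (n + 1) / ((n : ℂ) + 1) ^ 2‖ ≤ ‖z‖ * (1 / ((n : ℝ) + 1) ^ 2) := by
  rw [norm_div, norm_pow, norm_pow, norm_natCast_add_one, pow_succ', mul_div_assoc]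
  gcongr
  exact pow_le_one₀ (norm_nonneg _) hz

lemma hasSum_dilog {z : ℂ} (hz : ‖z‖ ≤ 1) :
    HasSum (fun n : ℕ => z ^ (n + 1) / ((n : ℂ) + 1) ^ 2) (dilog z) :=
  (Summable.of_norm_bounded (hasSum_one_div_succ_sq.summable.mul_left ‖z‖)
    (norm_dilog_term_le hz)).hasSum

lemma norm_dilog_le {z : ℂ} (hz : ‖z‖ ≤ 1) : ‖dilog z‖ ≤ ‖z‖ * (Real.pi ^ 2 / 6) :=
  tsum_of_norm_bounded (hasSum_one_div_succ_sq.mul_left ‖z‖) (norm_dilog_term_le hz)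

lemma dilog_zero : dilog 0 = 0 := by
  simp [dilog]

lemma differentiableOn_dilog : DifferentiableOn ℂ dilog (ball 0 1) := by
  refine Complex.differentiableOn_tsum_of_summable_norm hasSum_one_div_succ_sq.summable (fun n => ?_)
    isOpen_ball fun n z hz => ?_
  · fun_prop
  · have hz' : ‖z‖ ≤ 1 := (mem_ball_zero_iff.1 hz).le
    refine (norm_dilog_term_le hz' n).trans ?_
    exact mul_le_of_le_one_left (by positivity) hz'

/-! ### The half-plane integral of the dilogarithm -/

lemma intervalIntegrable_neg_log_mul {g : ℝ → ℝ} (hg : ContinuousOn g (Set.uIcc 0 1)) :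
    IntervalIntegrable (fun t => -Real.log t * g t) MeasureTheory.volume 0 1 :=
  (intervalIntegral.intervalIntegrable_log'.neg).mul_continuousOn hg

lemma integral_neg_log_mul_pow (n : ℕ) :
    ∫ t in (0 : ℝ)..1, -Real.log t * t ^ n = 1 / ((n : ℝ) + 1) ^ 2 := by
  -- The antiderivative is grouped around `t log t` because this function is continuous at `0`.
  set F : ℝ → ℝ := fun t => t ^ (n + 1) / ((n : ℝ) + 1) ^ 2 - t ^ n * (t * Real.log t) / ((n : ℝ) + 1)
    with hF
  have hn : (n : ℝ) + 1 ≠ 0 := by positivity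
  have hcont : ContinuousOn F (Set.Icc 0 1) := by
    have := Real.continuous_mul_log
    apply Continuous.continuousOn
    fun_prop
  have hderiv : ∀ t ∈ Set.Ioo (0 : ℝ) 1, HasDerivAt F (-Real.log t * t ^ n) t := by
    intro t ht
    have ht0 : t ≠ 0 := ht.1.ne'
    have h1 := ((hasDerivAt_pow (n + 1) t).div_const (((n : ℝ) + 1) ^ 2)).sub
      (((hasDerivAt_pow (n + 1) t).mul (Real.hasDerivAt_log ht0)).div_const ((n : ℝ) + 1))
    refine (h1.congr_of_eventuallyEq ?_).congr_deriv ?_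
    · refine Eventually.of_forall fun s => ?_
      simp only [hF, Pi.sub_apply, Pi.mul_apply]
      ring
    · rw [Nat.add_sub_cancel]
      push_cast
      field_simp
      ring
  rw [intervalIntegral.integral_eq_sub_of_hasDerivAt_of_le zero_le_one hcont hderiv
    (intervalIntegrable_neg_log_mul (by fun_prop))]
  simp [hF]

lemma integral_neg_log_mul_sum (N : ℕ) (a : ℕ → ℝ) :
    ∫ t in (0 : ℝ)..1, -Real.log t * ∑ k ∈ Finset.range N, a k * t ^ k =
      ∑ k ∈ Finset.range N, a k / ((k : ℝ) + 1) ^ 2 := by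
  simp only [Finset.mul_sum]
  rw [intervalIntegral.integral_finsetSum]
  · refine Finset.sum_congr rfl fun k _ => ?_
    have : (fun t => -Real.log t * (a k * t ^ k)) = fun t => a k * (-Real.log t * t ^ k) := by
      funext t; ring
    rw [this, intervalIntegral.integral_const_mul, integral_neg_log_mul_pow]
    ring
  · intro k _
    exact intervalIntegrable_neg_log_mul (by fun_prop)

lemma integral_neg_log_mul_mono {g₁ g₂ : ℝ → ℝ} (h₁ : ContinuousOn g₁ (Set.uIcc 0 1))
    (h₂ : ContinuousOn g₂ (Set.uIcc 0 1)) (h : ∀ t ∈ Set.Icc (0 : ℝ) 1, g₁ t ≤ g₂ t) :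
    ∫ t in (0 : ℝ)..1, -Real.log t * g₁ t ≤ ∫ t in (0 : ℝ)..1, -Real.log t * g₂ t := by
  refine intervalIntegral.integral_mono_on zero_le_one (intervalIntegrable_neg_log_mul h₁)
    (intervalIntegrable_neg_log_mul h₂) fun t ht => ?_
  exact mul_le_mul_of_nonneg_left (h t ht) (neg_nonneg.2 (Real.log_nonpos ht.1 ht.2))

lemma one_sub_mul_ne_zero {x : ℂ} (hx : ‖x‖ < 1) {t : ℝ} (ht : t ∈ Set.Icc (0 : ℝ) 1) :
    1 - x * t ≠ 0 := by
  intro h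
  have h1 : ‖x * t‖ < 1 := by
    rw [norm_mul, Complex.norm_real, Real.norm_eq_abs, abs_of_nonneg ht.1]
    calc ‖x‖ * t ≤ ‖x‖ * 1 := by gcongr; exact ht.2
      _ < 1 := by simpa using hx
  rw [← sub_eq_zero.1 h] at h1
  simp at h1

/-- Expand `x / (1 - x t)` geometrically; the moments of `-log t` are the numbers `1 / (n + 1)²`. -/
lemma dilog_eq_integral {x : ℂ} (hx : ‖x‖ < 1) :
    dilog x = ∫ t in (0 : ℝ)..1, ((-Real.log t : ℝ) : ℂ) * (x / (1 - x * t)) := by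
  have key : HasSum (fun n : ℕ => ∫ t in (0 : ℝ)..1, ((-Real.log t : ℝ) : ℂ) * (x * (x * t) ^ n))
      (∫ t in (0 : ℝ)..1, ((-Real.log t : ℝ) : ℂ) * (x / (1 - x * t))) := by
    apply intervalIntegral.hasSum_integral_of_dominated_convergence
      (fun n t => |Real.log t| * (‖x‖ * ‖x‖ ^ n))
    · intro n
      apply Measurable.aestronglyMeasurable
      fun_prop
    · intro n
      refine Eventually.of_forall fun t ht => ?_
      rw [Set.uIoc_of_le zero_le_one] at ht
      rw [norm_mul, Complex.norm_real, Real.norm_eq_abs, abs_neg, norm_mul, norm_pow, norm_mul,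
        Complex.norm_real, Real.norm_eq_abs, abs_of_nonneg ht.1.le]
      have h1 : ‖x‖ * t ≤ ‖x‖ := mul_le_of_le_one_right (norm_nonneg x) ht.2
      have h2 : 0 ≤ ‖x‖ * t := mul_nonneg (norm_nonneg x) ht.1.le
      gcongr
    · exact Eventually.of_forall fun t _ =>
        ((summable_geometric_of_lt_one (norm_nonneg x) hx).mul_left _).mul_left _
    · simp only [tsum_mul_left]
      exact (intervalIntegral.intervalIntegrable_log'.abs).mul_const _
    · refine Eventually.of_forall fun t ht => ?_
      rw [Set.uIoc_of_le zero_le_one] at ht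
      refine HasSum.mul_left _ ?_
      rw [div_eq_mul_inv]
      refine HasSum.mul_left _ (hasSum_geometric_of_norm_lt_one ?_)
      rw [norm_mul, Complex.norm_real, Real.norm_eq_abs, abs_of_nonneg ht.1.le]
      exact (mul_le_of_le_one_right (norm_nonneg _) ht.2).trans_lt hx
  refine (hasSum_dilog hx.le).unique ?_
  convert key using 2 with n
  have : (fun t : ℝ => ((-Real.log t : ℝ) : ℂ) * (x * (x * t) ^ n)) =
      fun t : ℝ => x ^ (n + 1) * ((-Real.log t * t ^ n : ℝ) : ℂ) := by
    funext t; push_cast; ring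
  rw [this, intervalIntegral.integral_const_mul, intervalIntegral.integral_ofReal,
    integral_neg_log_mul_pow]
  push_cast
  ring

/-- `‖1 - x t‖²` in terms of `r = ‖x‖` and `p = Re x`. -/
def quadDenom (r p t : ℝ) : ℝ := 1 - 2 * p * t + r ^ 2 * t ^ 2

lemma normSq_one_sub_mul (x : ℂ) (t : ℝ) :
    Complex.normSq (1 - x * t) = quadDenom ‖x‖ x.re t := by
  rw [quadDenom, Complex.sq_norm, Complex.normSq_apply, Complex.normSq_apply]
  simp
  ring

lemma quadDenom_pos {x : ℂ} (hx : ‖x‖ < 1) {t : ℝ} (ht : t ∈ Set.Icc (0 : ℝ) 1) :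
    0 < quadDenom ‖x‖ x.re t := by
  rw [← normSq_one_sub_mul]
  exact Complex.normSq_pos.2 (one_sub_mul_ne_zero hx ht)

lemma intervalIntegrable_dilog_kernel {x : ℂ} (hx : ‖x‖ < 1) :
    IntervalIntegrable (fun t : ℝ => ((-Real.log t : ℝ) : ℂ) * (x / (1 - x * t)))
      MeasureTheory.volume 0 1 := by
  refine IntervalIntegrable.mul_continuousOn
    (f := fun t : ℝ => ((-Real.log t : ℝ) : ℂ)) ?_ ?_
  · have h := (intervalIntegral.intervalIntegrable_log' (a := 0) (b := 1)).neg
    exact ⟨h.1.ofReal, h.2.ofReal⟩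
  · refine ContinuousOn.div (by fun_prop) (by fun_prop) fun t ht => ?_
    rw [Set.uIcc_of_le zero_le_one] at ht
    exact one_sub_mul_ne_zero hx ht

lemma dilog_re_eq_integral {x : ℂ} (hx : ‖x‖ < 1) :
    (dilog x).re = ∫ t in (0 : ℝ)..1,
      -Real.log t * ((x.re - t * ‖x‖ ^ 2) / quadDenom ‖x‖ x.re t) := by
  have h := Complex.reCLM.intervalIntegral_comp_comm (intervalIntegrable_dilog_kernel hx)
  rw [← dilog_eq_integral hx] at h
  rw [← Complex.reCLM_apply, ← h]
  refine intervalIntegral.integral_congr fun t _ => ?_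
  simp only [Complex.reCLM_apply, Complex.re_ofReal_mul]
  congr 1
  rw [Complex.div_re, normSq_one_sub_mul, Complex.sq_norm, Complex.normSq_apply]
  simp
  ring

lemma dilog_im_eq_integral {x : ℂ} (hx : ‖x‖ < 1) :
    (dilog x).im = x.im * ∫ t in (0 : ℝ)..1, -Real.log t * (1 / quadDenom ‖x‖ x.re t) := by
  have h := Complex.imCLM.intervalIntegral_comp_comm (intervalIntegrable_dilog_kernel hx)
  rw [← dilog_eq_integral hx] at h
  rw [← Complex.imCLM_apply (dilog x), ← h, ← intervalIntegral.integral_const_mul]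
  refine intervalIntegral.integral_congr fun t _ => ?_
  simp only [Complex.imCLM_apply, Complex.im_ofReal_mul]
  rw [Complex.div_im, normSq_one_sub_mul]
  simp
  ring

lemma dilog_re_nonpos {x : ℂ} (hx : ‖x‖ < 1) (h : x.re ≤ 0) : (dilog x).re ≤ 0 := by
  rw [dilog_re_eq_integral hx]
  have hc : ContinuousOn (fun t : ℝ => (x.re - t * ‖x‖ ^ 2) / quadDenom ‖x‖ x.re t)
      (Set.uIcc 0 1) := by
    unfold quadDenom
    refine ContinuousOn.div (by fun_prop) (by fun_prop) fun t ht => ?_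
    rw [Set.uIcc_of_le zero_le_one] at ht
    exact (quadDenom_pos hx ht).ne'
  refine (integral_neg_log_mul_mono hc (continuousOn_const (c := 0)) fun t ht => ?_).trans
    (by simp)
  refine div_nonpos_of_nonpos_of_nonneg ?_ (quadDenom_pos hx ht).le
  have : 0 ≤ t * ‖x‖ ^ 2 := mul_nonneg ht.1 (by positivity)
  linarith

/-- A polynomial minorant of the integrand: `16 / (1 + u) ≥ 15 - 11 u + 5 u² - u³`. -/
lemma minorant_le {r c s t : ℝ} (hr0 : 0 < r) (hr1 : r ≤ 1) (hc1 : c ≤ 1) (hs : 0 ≤ s)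
    (hcs : -c ≤ s) (ht : t ∈ Set.Icc (0 : ℝ) 1)
    (hD : 0 < quadDenom r (r * c) t) :
    r * ((7 / 5 - 3 / 10 * c - 11 / 10 * t) *
      ((15 - 11 * (2 * s * t + t ^ 2) + 5 * (2 * s * t + t ^ 2) ^ 2 -
        (2 * s * t + t ^ 2) ^ 3) / 16)) ≤
      (7 / 5 * (r - r * c) + 11 / 10 * (r * c - t * r ^ 2)) / quadDenom r (r * c) t := by
  obtain ⟨ht0, ht1⟩ := ht
  set u := 2 * s * t + t ^ 2 with hu
  have hu0 : 0 ≤ u := by positivity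
  -- Equality holds at `c = t = 1`.
  have hN : 0 ≤ 7 / 5 - 3 / 10 * c - 11 / 10 * t := by linarith
  have hDle : quadDenom r (r * c) t ≤ 1 + u := by
    rw [quadDenom, hu]
    have h1 : -(r * c) * t ≤ s * t := by
      refine mul_le_mul_of_nonneg_right ?_ ht0
      nlinarith
    have h2 : r ^ 2 * t ^ 2 ≤ 1 * t ^ 2 := by
      gcongr
      nlinarith
    linarith
  have hpoly : (15 - 11 * u + 5 * u ^ 2 - u ^ 3) / 16 ≤ 1 / quadDenom r (r * c) t := by
    refine le_trans ?_ (one_div_le_one_div_of_le hD hDle)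
    rw [div_le_div_iff₀ (by norm_num) (by linarith)]
    -- After clearing denominators the difference of the two sides is `(1 - u)^4`: the cubic is the
    -- Taylor polynomial of `16 / (1 + u)` at `u = 1`.
    nlinarith [sq_nonneg ((1 - u) ^ 2)]
  have hNr : r * (7 / 5 - 3 / 10 * c - 11 / 10 * t) ≤
      7 / 5 * (r - r * c) + 11 / 10 * (r * c - t * r ^ 2) := by
    have : t * r ^ 2 ≤ t * r := by
      refine mul_le_mul_of_nonneg_left ?_ ht0
      nlinarith
    linarith
  rw [div_eq_mul_one_div (7 / 5 * (r - r * c) + _), ← mul_assoc]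
  calc _ ≤ r * (7 / 5 - 3 / 10 * c - 11 / 10 * t) * (1 / quadDenom r (r * c) t) := by
        gcongr
    _ ≤ _ := by gcongr

/-- The coefficients of the polynomial minorant. -/
def minorantCoeff (A s : ℝ) (k : ℕ) : ℝ :=
  [15 * A, -22 * s * A - 33 / 2, (-11 + 20 * s ^ 2) * A + 121 / 5 * s,
    (20 * s - 8 * s ^ 3) * A - 11 / 10 * (-11 + 20 * s ^ 2),
    (5 - 12 * s ^ 2) * A - 11 / 10 * (20 * s - 8 * s ^ 3),
    -6 * s * A - 11 / 10 * (5 - 12 * s ^ 2), -A + 33 / 5 * s, 11 / 10].getD k 0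

lemma sum_minorantCoeff (A s t : ℝ) :
    ∑ k ∈ Finset.range 8, minorantCoeff A s k * t ^ k =
      (A - 11 / 10 * t) * (15 - 11 * (2 * s * t + t ^ 2) + 5 * (2 * s * t + t ^ 2) ^ 2 -
        (2 * s * t + t ^ 2) ^ 3) := by
  simp [Finset.sum_range_succ, minorantCoeff]
  ring

/-- The minorant integrated against `-log t`, which replaces `t^k` by `1 / (k + 1)²`. Here `s =
max(0, -c)`, so the claim is a polynomial inequality in `c` on each half of `[-1, 1]`. -/
lemma le_sum_minorantCoeff {c s : ℝ} (hc1 : c ≤ 1) (hc0 : -1 ≤ c) (hs : 0 ≤ s)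
    (h : s = 0 ∧ 0 ≤ c ∨ s = -c) :
    16 * (49 / 100 * (1 - c) + 121 / 400 * (1 + c)) ≤
      ∑ k ∈ Finset.range 8, minorantCoeff (7 / 5 - 3 / 10 * c) s k / ((k : ℝ) + 1) ^ 2 := by
  simp [Finset.sum_range_succ, minorantCoeff]
  rcases h with ⟨rfl, hc⟩ | rfl
  · norm_num
    linarith
  · have h1 : 0 ≤ 1 + c := by linarith
    have h2 : 0 ≤ (-c) * (1 + c) := mul_nonneg hs h1
    have h3 : 0 ≤ (-c) * ((-c) * (1 + c)) := mul_nonneg hs h2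
    have h4 : 0 ≤ (-c) * ((-c) * ((-c) * (1 + c))) := mul_nonneg hs h3
    nlinarith

/-- Put `D = r + Re x`, `E = r - Re x`, `R = Re Li₂(x)` and `Im Li₂(x) = q Im x`, so that `(Im x)² =
D E`. Squaring `11/20 D - R ≤ |Li₂(x)|` and cancelling `D` leaves `11/10 R + E q² - 121/400 D ≥ 0`.
After `q²` is replaced by a tangent line, the left side is one integral that is linear in the kernel
and can be bounded by a polynomial minorant. -/
theorem dilog_lower_bound {x : ℂ} (hx : ‖x‖ < 1) :
    11 / 20 * (‖x‖ + x.re) ≤ ‖dilog x‖ + (dilog x).re := by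
  rcases eq_or_ne x 0 with rfl | hx0
  · simp [dilog_zero]
  have hr0 : 0 < ‖x‖ := norm_pos_iff.2 hx0
  set r := ‖x‖ with hr
  set c := x.re / r with hc
  have hp : x.re = r * c := by rw [hc]; field_simp
  have hre := Complex.abs_re_le_norm x
  rw [← hr] at hre
  have hc1 : c ≤ 1 := by
    rw [hc, div_le_one hr0]; exact (le_abs_self _).trans hre
  have hc0 : -1 ≤ c := by
    rw [hc, le_div_iff₀ hr0]; linarith [neg_abs_le x.re]
  obtain ⟨s, hs, hcase⟩ : ∃ s : ℝ, 0 ≤ s ∧ (s = 0 ∧ 0 ≤ c ∨ s = -c) := by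
    rcases le_total 0 c with h | h
    · exact ⟨0, le_rfl, Or.inl ⟨rfl, h⟩⟩
    · exact ⟨-c, by linarith, Or.inr rfl⟩
  have hsc : -c ≤ s := by
    rcases hcase with ⟨rfl, h⟩ | rfl
    · linarith
    · exact le_rfl
  have hDc : ContinuousOn (fun t : ℝ => quadDenom r x.re t) (Set.uIcc 0 1) := by
    unfold quadDenom; fun_prop
  have hDne : ∀ t ∈ Set.uIcc (0 : ℝ) 1, quadDenom r x.re t ≠ 0 := by
    intro t ht
    rw [Set.uIcc_of_le zero_le_one] at ht
    exact (quadDenom_pos hx ht).ne'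
  set q := ∫ t in (0 : ℝ)..1, -Real.log t * (1 / quadDenom r x.re t) with hq
  have him : (dilog x).im = x.im * q := dilog_im_eq_integral hx
  have hreq := dilog_re_eq_integral hx
  have hlin : 7 / 5 * (r - x.re) * q + 11 / 10 * (dilog x).re =
      ∫ t in (0 : ℝ)..1, -Real.log t *
        ((7 / 5 * (r - x.re) + 11 / 10 * (x.re - t * r ^ 2)) / quadDenom r x.re t) := by
    rw [hreq, hq, ← intervalIntegral.integral_const_mul, ← intervalIntegral.integral_const_mul,
      ← intervalIntegral.integral_add]
    · refine intervalIntegral.integral_congr fun t _ => ?_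
      ring
    · exact (intervalIntegrable_neg_log_mul (ContinuousOn.div (by fun_prop) hDc hDne)).const_mul _
    · exact (intervalIntegrable_neg_log_mul (ContinuousOn.div (by fun_prop) hDc hDne)).const_mul _
  have hlow : r * (49 / 100 * (1 - c) + 121 / 400 * (1 + c)) ≤
      7 / 5 * (r - x.re) * q + 11 / 10 * (dilog x).re := by
    rw [hlin]
    refine le_trans ?_ (integral_neg_log_mul_mono
      (g₁ := fun t => ∑ k ∈ Finset.range 8,
        (r / 16 * minorantCoeff (7 / 5 - 3 / 10 * c) s k) * t ^ k)
      (by fun_prop) (ContinuousOn.div (by fun_prop) hDc hDne) fun t ht => ?_)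
    · rw [integral_neg_log_mul_sum]
      have := le_sum_minorantCoeff hc1 hc0 hs hcase
      calc r * (49 / 100 * (1 - c) + 121 / 400 * (1 + c))
          = r / 16 * (16 * (49 / 100 * (1 - c) + 121 / 400 * (1 + c))) := by ring
        _ ≤ r / 16 * ∑ k ∈ Finset.range 8,
            minorantCoeff (7 / 5 - 3 / 10 * c) s k / ((k : ℝ) + 1) ^ 2 := by gcongr
        _ = _ := by
          rw [Finset.mul_sum]
          exact Finset.sum_congr rfl fun k _ => by ring
    · have hm := minorant_le hr0 hx.le hc1 hs hsc ht
        (by rw [← hp]; exact quadDenom_pos hx ht)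
      rw [← hp] at hm
      refine le_trans (le_of_eq ?_) hm
      simp only [mul_assoc]
      rw [← Finset.mul_sum, sum_minorantCoeff]
      ring
  have himsq : x.im ^ 2 = (r + x.re) * (r - x.re) := by
    have : r ^ 2 = x.re ^ 2 + x.im ^ 2 := by
      rw [hr, Complex.sq_norm, Complex.normSq_apply]; ring
    linarith
  have hD0 : 0 ≤ r + x.re := by linarith [neg_abs_le x.re]
  have hE0 : 0 ≤ r - x.re := by linarith [le_abs_self x.re]
  -- Linearization of `q²` at `7/10`, that is `q² ≥ 7/5 q - 49/100`.
  have hbr : 0 ≤ 11 / 10 * (dilog x).re + (r - x.re) * q ^ 2 - 121 / 400 * (r + x.re) := by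
    have h1 : 0 ≤ (r - x.re) * (q - 7 / 10) ^ 2 := by positivity
    have h2 : r * (49 / 100 * (1 - c) + 121 / 400 * (1 + c)) =
        49 / 100 * (r - x.re) + 121 / 400 * (r + x.re) := by rw [hp]; ring
    rw [h2] at hlow
    nlinarith
  have hquad : (11 / 20 * (r + x.re) - (dilog x).re) ^ 2 ≤ ‖dilog x‖ ^ 2 := by
    have h1 : ‖dilog x‖ ^ 2 = (dilog x).re ^ 2 + (x.im * q) ^ 2 := by
      rw [Complex.sq_norm, Complex.normSq_apply, him]; ring
    rw [h1, mul_pow, himsq]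
    nlinarith [mul_nonneg hD0 hbr]
  linarith [(abs_le.1 (abs_le_of_sq_le_sq hquad (norm_nonneg _))).2]

/-! ### The functions `f k` -/

lemma cpow_half_sq (w : ℂ) : (w ^ (1 / 2 : ℂ)) ^ 2 = w := by
  rw [← Complex.cpow_mul_nat]
  norm_num

lemma cpow_half_re_nonneg (w : ℂ) : 0 ≤ (w ^ (1 / 2 : ℂ)).re := by
  rcases eq_or_ne w 0 with rfl | hw
  · simp
  rw [Complex.cpow_def_of_ne_zero hw, Complex.exp_re]
  refine mul_nonneg (Real.exp_pos _).le (Real.cos_nonneg_of_neg_pi_div_two_le_of_le ?_ ?_) <;>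
  · have h1 := Complex.neg_pi_lt_arg w
    have h2 := Complex.arg_le_pi w
    have : (Complex.log w * (1 / 2)).im = Complex.arg w / 2 := by
      rw [show (1 / 2 : ℂ) = ((1 / 2 : ℝ) : ℂ) by norm_num, Complex.im_mul_ofReal, Complex.log_im]
      ring
    rw [this]
    linarith

/-- `√(Li₂(x^k)) / k`. -/
def rootLi (k : ℕ) (x : ℂ) : ℂ := dilog (x ^ k) ^ (1 / 2 : ℂ) / k

lemma f_eq_re (k : ℕ) (x : ℂ) : f k x = (rootLi k x).re := by
  rw [f, rootLi, Complex.div_natCast_re]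
  ring

lemma rootLi_sq (k : ℕ) (x : ℂ) : rootLi k x ^ 2 = dilog (x ^ k) / (k : ℂ) ^ 2 := by
  rw [rootLi, div_pow, cpow_half_sq]

lemma f_nonneg (k : ℕ) (x : ℂ) : 0 ≤ f k x :=
  mul_nonneg (by positivity) (cpow_half_re_nonneg _)

lemma two_mul_re_sq (z : ℂ) : 2 * z.re ^ 2 = ‖z ^ 2‖ + (z ^ 2).re := by
  rw [norm_pow, Complex.sq_norm, Complex.normSq_apply, pow_two z, Complex.mul_re]
  ring

lemma f_sq (k : ℕ) (x : ℂ) :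
    f k x ^ 2 = (‖dilog (x ^ k)‖ + (dilog (x ^ k)).re) / (2 * (k : ℝ) ^ 2) := by
  have h := two_mul_re_sq (dilog (x ^ k) ^ (1 / 2 : ℂ))
  rw [cpow_half_sq] at h
  rw [← h, f]
  ring

lemma f_eq_sqrt (k : ℕ) (x : ℂ) :
    f k x = √((‖dilog (x ^ k)‖ + (dilog (x ^ k)).re) / (2 * (k : ℝ) ^ 2)) := by
  rw [← f_sq, Real.sqrt_sq (f_nonneg k x)]

lemma f_mul (k l : ℕ) (x : ℂ) : f (k * l) x = f k (x ^ l) / l := by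
  rw [f, f, ← pow_mul, mul_comm l k]
  push_cast
  ring

lemma norm_pow_le_one {x : ℂ} (hx : ‖x‖ < 1) (k : ℕ) : ‖x ^ k‖ ≤ 1 := by
  rw [norm_pow]
  exact pow_le_one₀ (norm_nonneg _) hx.le

lemma norm_pow_lt_one {x : ℂ} (hx : ‖x‖ < 1) {k : ℕ} (hk : k ≠ 0) : ‖x ^ k‖ < 1 := by
  rw [norm_pow]
  exact pow_lt_one₀ (norm_nonneg _) hx hk

lemma zeta_two_lt : Real.pi ^ 2 / 6 < 1645 / 1000 := by
  nlinarith [Real.pi_lt_d4, Real.pi_pos]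

lemma f_sq_le {x : ℂ} (hx : ‖x‖ < 1) (k : ℕ) (hk : k ≠ 0) :
    f k x ^ 2 ≤ 1645 / 1000 * ‖x‖ ^ k / (k : ℝ) ^ 2 := by
  rw [f_sq]
  have h1 := norm_dilog_le (norm_pow_le_one hx k)
  have h2 := Complex.re_le_norm (dilog (x ^ k))
  have h3 : ‖x ^ k‖ * (Real.pi ^ 2 / 6) ≤ 1645 / 1000 * ‖x‖ ^ k := by
    rw [norm_pow, mul_comm]
    exact mul_le_mul_of_nonneg_right zeta_two_lt.le (by positivity)
  have hk' : (0 : ℝ) < k := by exact_mod_cast Nat.pos_of_ne_zero hk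
  rw [div_le_div_iff₀ (by positivity) (by positivity)]
  nlinarith [sq_nonneg (k : ℝ)]

lemma f_sq_le_of_re_nonpos {x : ℂ} (hx : ‖x‖ < 1) (k : ℕ) (hk : k ≠ 0) (h : (x ^ k).re ≤ 0) :
    f k x ^ 2 ≤ 1645 / 1000 * ‖x‖ ^ k / (2 * (k : ℝ) ^ 2) := by
  rw [f_sq]
  have h1 := norm_dilog_le (norm_pow_le_one hx k)
  have h2 := dilog_re_nonpos (norm_pow_lt_one hx hk) h
  have h3 : ‖x ^ k‖ * (Real.pi ^ 2 / 6) ≤ 1645 / 1000 * ‖x‖ ^ k := by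
    rw [norm_pow, mul_comm]
    exact mul_le_mul_of_nonneg_right zeta_two_lt.le (by positivity)
  gcongr
  linarith

lemma le_f_one_sq {x : ℂ} (hx : ‖x‖ < 1) : 11 / 40 * (‖x‖ + x.re) ≤ f 1 x ^ 2 := by
  have := dilog_lower_bound hx
  rw [f_sq, pow_one]
  norm_num
  linarith

lemma re_sq (x : ℂ) : (x ^ 2).re = 2 * x.re ^ 2 - ‖x‖ ^ 2 := by
  have := two_mul_re_sq x
  rw [norm_pow] at this
  linarith

lemma f_lt_of_sq_lt {k l : ℕ} {x : ℂ} (h : f k x ^ 2 < f l x ^ 2) : f k x < f l x :=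
  lt_of_pow_lt_pow_left₀ 2 (f_nonneg l x) h

lemma f_two_lt_f_one {y : ℂ} (hy : ‖y‖ < 1) (hy0 : y ≠ 0) (hre : 0 ≤ y.re) : f 2 y < f 1 y := by
  have hr : 0 < ‖y‖ := norm_pos_iff.2 hy0
  have hlow := le_f_one_sq hy
  refine f_lt_of_sq_lt ?_
  have hrr : ‖y‖ ^ 2 ≤ ‖y‖ := pow_le_of_le_one hr.le hy.le two_ne_zero
  rcases le_or_gt (y ^ 2).re 0 with h | h
  · have := f_sq_le_of_re_nonpos hy 2 two_ne_zero h
    norm_num at this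
    linarith
  · have := f_sq_le hy 2 two_ne_zero
    norm_num at this
    rw [re_sq] at h
    -- `Re y² > 0` means `Re y > ‖y‖ / √2`. Then `11/40 · 17/10` exceeds `1645/4000`.
    have h2 : 7 / 10 * ‖y‖ ≤ y.re := by
      nlinarith
    linarith

/-- Since `f_l² ≤ ζ(2) r^l / l²`, large `l` lose against `f_1` unless `x` is close to the negative
axis, where the lower bound for `f_1` degenerates; there `x²` is in the right half-plane and `f_2(x)
= f_1(x²) / 2` takes over. Only `l = 4` needs a finer division into sectors. -/
theorem f_lt_max {x : ℂ} (hx : ‖x‖ < 1) (hx0 : x ≠ 0) {l : ℕ} (hl : 4 ≤ l) :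
    f l x < max (f 1 x) (f 2 x) := by
  have hr : 0 < ‖x‖ := norm_pos_iff.2 hx0
  have hlow := le_f_one_sq hx
  have habs := Complex.abs_re_le_norm x
  have hpw : ∀ k, k ≠ 0 → ‖x‖ ^ k ≤ ‖x‖ := fun k hk => pow_le_of_le_one hr.le hx.le hk
  have hy : ‖x ^ 2‖ < 1 := norm_pow_lt_one hx two_ne_zero
  have hy0 : x ^ 2 ≠ 0 := pow_ne_zero _ hx0
  rw [lt_max_iff]
  rcases eq_or_lt_of_le hl with rfl | hl5
  · rcases le_or_gt (-(1 / 2) * ‖x‖) x.re with hA | hA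
    · left
      refine f_lt_of_sq_lt ?_
      have := f_sq_le hx 4 (by norm_num)
      norm_num at this
      linarith [hpw 4 (by norm_num)]
    rcases le_or_gt (-(5 / 7) * ‖x‖) x.re with hB | hB
    · left
      refine f_lt_of_sq_lt ?_
      -- With `θ = arg x`, here `cos 2θ` lies in `[-1/2, 1/49]`, so `cos 4θ = 2 cos² 2θ - 1` is
      -- negative. This halves the upper bound for `f_4²`.
      have h4 : (x ^ 4).re ≤ 0 := by
        rw [show x ^ 4 = (x ^ 2) ^ 2 by ring, re_sq, norm_pow]
        have h1 : (x ^ 2).re ≤ 1 / 49 * ‖x‖ ^ 2 := by rw [re_sq]; nlinarith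
        have h2 : -(1 / 2) * ‖x‖ ^ 2 ≤ (x ^ 2).re := by rw [re_sq]; nlinarith
        have h3 : 0 < ‖x‖ ^ 2 := by positivity
        have h5 : (x ^ 2).re ^ 2 ≤ (1 / 2 * ‖x‖ ^ 2) ^ 2 := by
          apply sq_le_sq'
          · linarith
          · linarith
        nlinarith
      have := f_sq_le_of_re_nonpos hx 4 (by norm_num) h4
      norm_num at this
      linarith [hpw 4 (by norm_num)]
    · right
      -- The threshold `5/7` works because `2 (5/7)² = 50/49 > 1`. Passing to `x²` reduces `f_4 <
      -- f_2` to `f_2 < f_1`.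
      have hre : 0 ≤ (x ^ 2).re := by rw [re_sq]; nlinarith
      have h := f_two_lt_f_one hy hy0 hre
      have e1 : f 4 x = f 2 (x ^ 2) / 2 := by exact_mod_cast f_mul 2 2 x
      have e2 : f 2 x = f 1 (x ^ 2) / 2 := by exact_mod_cast f_mul 1 2 x
      rw [e1, e2]
      linarith
  · have hl0 : l ≠ 0 := by omega
    have hb : f l x ^ 2 ≤ 1645 / 25000 * ‖x‖ ^ 2 := by
      refine (f_sq_le hx l hl0).trans ?_
      have h5 : (5 : ℝ) ≤ l := by exact_mod_cast hl5
      have h6 : ‖x‖ ^ l ≤ ‖x‖ ^ 2 := pow_le_pow_of_le_one hr.le hx.le (by omega)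
      rw [div_le_iff₀ (by positivity)]
      have h7 : (25 : ℝ) ≤ (l : ℝ) ^ 2 := by nlinarith
      calc 1645 / 1000 * ‖x‖ ^ l ≤ 1645 / 1000 * ‖x‖ ^ 2 := by gcongr
        _ = 1645 / 25000 * ‖x‖ ^ 2 * 25 := by ring
        _ ≤ 1645 / 25000 * ‖x‖ ^ 2 * (l : ℝ) ^ 2 := by gcongr
    rcases le_or_gt (-(5 / 7) * ‖x‖) x.re with hB | hB
    · left
      refine f_lt_of_sq_lt ?_
      linarith [hpw 2 (by norm_num)]
    · right
      refine f_lt_of_sq_lt ?_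
      have hre : 0 ≤ (x ^ 2).re := by rw [re_sq]; nlinarith
      have h := le_f_one_sq hy
      have e2 : f 2 x = f 1 (x ^ 2) / 2 := by exact_mod_cast f_mul 1 2 x
      rw [norm_pow] at h
      rw [e2, div_pow]
      have : 0 < ‖x‖ ^ 2 := by positivity
      linarith

lemma max_f_pos {x : ℂ} (hx : ‖x‖ < 1) (hx0 : x ≠ 0) : 0 < max (f 1 x) (f 2 x) :=
  (f_nonneg 4 x).trans_lt (f_lt_max hx hx0 le_rfl)

lemma continuousOn_dilog_pow {k : ℕ} (hk : k ≠ 0) :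
    ContinuousOn (fun x => dilog (x ^ k)) (ball (0 : ℂ) 1) :=
  differentiableOn_dilog.continuousOn.comp (by fun_prop) fun x hx => by
    rw [mem_ball_zero_iff] at hx ⊢
    exact norm_pow_lt_one hx hk

lemma continuousOn_f {k : ℕ} (hk : k ≠ 0) : ContinuousOn (f k) (ball (0 : ℂ) 1) := by
  have h := continuousOn_dilog_pow hk
  have h2 : ContinuousOn (fun x =>
      √((‖dilog (x ^ k)‖ + (dilog (x ^ k)).re) / (2 * (k : ℝ) ^ 2))) (ball (0 : ℂ) 1) :=
    (((h.norm.add (Complex.continuous_re.comp_continuousOn h)).div_const _)).sqrt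
  exact h2.congr fun x _ => f_eq_sqrt k x

/-- On the branch cut `|w| + Re w = 0`, so `f_k` vanishes there. Positivity of `f_k` is thus the
condition under which the square root is holomorphic. -/
lemma mem_slitPlane_of_f_pos {k : ℕ} {x : ℂ} (h : 0 < f k x) :
    dilog (x ^ k) ∈ Complex.slitPlane := by
  rw [Complex.mem_slitPlane_iff_not_le_zero]
  intro hle
  have h0 : f k x ^ 2 = 0 := by
    rw [f_sq]
    have hre : (dilog (x ^ k)).re ≤ 0 := by simpa using (Complex.le_def.1 hle).1
    have him : (dilog (x ^ k)).im = 0 := by simpa using (Complex.le_def.1 hle).2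
    have hn : ‖dilog (x ^ k)‖ = |(dilog (x ^ k)).re| := by
      rw [← Complex.abs_re_eq_norm.2 him]
    rw [hn, abs_of_nonpos hre]
    simp
  have := pow_pos h 2
  linarith

lemma differentiableAt_rootLi {k : ℕ} (hk : k ≠ 0) {x : ℂ} (hx : ‖x‖ < 1) (h : 0 < f k x) :
    DifferentiableAt ℂ (rootLi k) x := by
  have h1 : DifferentiableAt ℂ dilog (x ^ k) :=
    differentiableOn_dilog.differentiableAt (isOpen_ball.mem_nhds
      (mem_ball_zero_iff.2 (norm_pow_lt_one hx hk)))
  have hp : DifferentiableAt ℂ (fun x : ℂ => x ^ k) x := by fun_prop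
  have h2 : DifferentiableAt ℂ (fun x => dilog (x ^ k)) x :=
    DifferentiableAt.comp (g := dilog) (f := fun x : ℂ => x ^ k) x h1 hp
  exact (h2.cpow_const (mem_slitPlane_of_f_pos h)).div_const _

/-! ### The singular behaviour of the Lambert sum at roots of unity -/

open Classical in
/-- `(q e^z - 1)⁻¹` with its pole at the origin removed when `q = 1`. -/
def regKernel (q z : ℂ) : ℂ :=
  if q = 1 then (Complex.exp z - 1)⁻¹ - z⁻¹ else (q * Complex.exp z - 1)⁻¹

open Classical in
/-- The limit of `regKernel q` at the origin. -/
def regKernelLim (q : ℂ) : ℂ := if q = 1 then -1 / 2 else (q - 1)⁻¹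

open Classical in
/-- The coefficient of `w⁻¹` in the expansion of the Lambert sum at the root of unity `ζ`. -/
def polarCoeff (ζ x : ℂ) : ℂ :=
  ∑' j : ℕ, if ζ ^ (j + 1) = 1 then x ^ (j + 1) / ((j : ℂ) + 1) ^ 2 else 0

/-- The regular part of the Lambert sum at `ζ`. -/
def regSum (ζ x w : ℂ) : ℂ :=
  ∑' j : ℕ, x ^ (j + 1) / ((j : ℂ) + 1) * regKernel (ζ ^ (j + 1)) (((j : ℂ) + 1) * w)

/-- The limit of `regSum ζ x` at the origin. -/
def regConst (ζ x : ℂ) : ℂ :=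
  ∑' j : ℕ, x ^ (j + 1) / ((j : ℂ) + 1) * regKernelLim (ζ ^ (j + 1))

lemma tendsto_inv_exp_sub_one_sub_inv :
    Tendsto (fun z : ℂ => (Complex.exp z - 1)⁻¹ - z⁻¹) (𝓝[≠] 0) (𝓝 (-1 / 2)) := by
  have h1 : Tendsto (fun z : ℂ => (Complex.exp z - 1) / z) (𝓝[≠] 0) (𝓝 1) := by
    have := (hasDerivAt_iff_tendsto_slope.1 (Complex.hasDerivAt_exp 0))
    simpa [slope_fun_def, div_eq_inv_mul] using this
  have h2 : Tendsto (fun z : ℂ => (Complex.exp z - 1 - z) / z ^ 2) (𝓝[≠] 0) (𝓝 (1 / 2)) := by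
    rw [tendsto_iff_norm_sub_tendsto_zero]
    have hlim : Tendsto (fun z : ℂ => ‖z‖) (𝓝[≠] 0) (𝓝 0) := by
      have : Tendsto (fun z : ℂ => ‖z‖) (𝓝 0) (𝓝 ‖(0 : ℂ)‖) := continuous_norm.tendsto 0
      rw [norm_zero] at this
      exact this.mono_left nhdsWithin_le_nhds
    refine tendsto_of_tendsto_of_tendsto_of_le_of_le' tendsto_const_nhds hlim
      (Eventually.of_forall fun _ => norm_nonneg _) ?_
    have hball : ball (0 : ℂ) 1 ∈ 𝓝[≠] (0 : ℂ) := nhdsWithin_le_nhds (ball_mem_nhds 0 one_pos)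
    filter_upwards [hball, self_mem_nhdsWithin] with z hz hz0
    have hz0' : z ≠ 0 := hz0
    have hb := Complex.exp_bound (mem_ball_zero_iff.1 hz).le (n := 3) (by norm_num)
    have e : (Complex.exp z - 1 - z) / z ^ 2 - 1 / 2 =
        (Complex.exp z - ∑ m ∈ Finset.range 3, z ^ m / (m.factorial : ℂ)) / z ^ 2 := by
      simp [Finset.sum_range_succ, Nat.factorial]
      field_simp
      ring
    rw [e, norm_div, norm_pow, div_le_iff₀ (by positivity)]
    refine hb.trans ?_
    have : 0 ≤ ‖z‖ ^ 3 := by positivity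
    norm_num [Nat.factorial]
    nlinarith
  have h3 : Tendsto (fun z : ℂ => -((Complex.exp z - 1 - z) / z ^ 2) * ((Complex.exp z - 1) / z)⁻¹)
      (𝓝[≠] 0) (𝓝 (-(1 / 2) * 1⁻¹)) := h2.neg.mul (h1.inv₀ one_ne_zero)
  have h4 : (-(1 / 2) * 1⁻¹ : ℂ) = -1 / 2 := by norm_num
  rw [h4] at h3
  refine h3.congr' ?_
  have hne : ∀ᶠ z : ℂ in 𝓝[≠] 0, (Complex.exp z - 1) / z ≠ 0 := h1.eventually_ne one_ne_zero
  filter_upwards [hne, self_mem_nhdsWithin] with z hz hz0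
  have hz0' : z ≠ 0 := hz0
  have : Complex.exp z - 1 ≠ 0 := fun h => hz (by rw [h, zero_div])
  field_simp
  ring

lemma tendsto_regKernel (q : ℂ) :
    Tendsto (regKernel q) (𝓝[≠] 0) (𝓝 (regKernelLim q)) := by
  unfold regKernel regKernelLim
  split_ifs with hq
  · exact tendsto_inv_exp_sub_one_sub_inv
  · have hc : ContinuousAt (fun z : ℂ => (q * Complex.exp z - 1)⁻¹) 0 := by
      refine ContinuousAt.inv₀ (by fun_prop) ?_
      simpa [sub_eq_zero] using hq
    have := hc.tendsto
    simp only [Complex.exp_zero, mul_one] at this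
    exact this.mono_left nhdsWithin_le_nhds

lemma norm_regKernel_le {q z : ℂ} (hq : ‖q‖ = 1) (hz : 0 < z.re) :
    ‖regKernel q z‖ ≤ 2 * z.re⁻¹ := by
  have hpos : 0 < z.re⁻¹ := inv_pos.2 hz
  unfold regKernel
  split_ifs with h
  · have h1 := norm_inv_mul_exp_sub_one_le (q := 1) norm_one hz
    rw [one_mul] at h1
    have h2 : ‖z⁻¹‖ ≤ z.re⁻¹ := by
      rw [norm_inv]
      exact inv_anti₀ hz (Complex.re_le_norm z)
    linarith [norm_sub_le (Complex.exp z - 1)⁻¹ z⁻¹]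
  · linarith [norm_inv_mul_exp_sub_one_le hq hz]

/-- `regKernel q` is bounded on sectors in the right half-plane. -/
lemma exists_norm_regKernel_le {q : ℂ} (hq : ‖q‖ = 1) (C : ℝ) :
    ∃ B, ∀ z : ℂ, 0 < z.re → ‖z‖ ≤ C * z.re → ‖regKernel q z‖ ≤ B := by
  have h := ((tendsto_regKernel q).norm).eventually_lt_const
    (show ‖regKernelLim q‖ < ‖regKernelLim q‖ + 1 by linarith)
  rw [eventually_nhdsWithin_iff, Metric.eventually_nhds_iff] at h
  obtain ⟨ε, hε, hB⟩ := h
  refine ⟨max (‖regKernelLim q‖ + 1) (2 * (C / ε)), fun z hz hzC => ?_⟩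
  rcases lt_or_ge ‖z‖ ε with hlt | hge
  · refine le_max_of_le_left (hB (by simpa using hlt) ?_).le
    rintro rfl
    simp at hz
  · refine le_max_of_le_right ((norm_regKernel_le hq hz).trans ?_)
    gcongr
    rw [inv_le_iff_one_le_mul₀ hz, div_mul_eq_mul_div, one_le_div hε]
    exact hge.trans hzC

/-- Only the finitely many values `ζ^j` with `j < N` occur, so one bound serves all terms of the
sum. -/
lemma exists_norm_regKernel_pow_le {ζ : ℂ} {N : ℕ} (hN : 0 < N) (hζ : ζ ^ N = 1) (C : ℝ) :
    ∃ B, ∀ (j : ℕ) (z : ℂ), 0 < z.re → ‖z‖ ≤ C * z.re → ‖regKernel (ζ ^ j) z‖ ≤ B := by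
  have hn : ‖ζ‖ = 1 := Complex.norm_eq_one_of_pow_eq_one hζ hN.ne'
  choose B hB using fun i : ℕ => exists_norm_regKernel_le (q := ζ ^ i)
    (by rw [norm_pow, hn, one_pow]) C
  refine ⟨∑ i ∈ Finset.range N, |B i|, fun j z hz hzC => ?_⟩
  rw [← Nat.mod_add_div j N, pow_add, pow_mul, hζ, one_pow, mul_one]
  refine (hB (j % N) z hz hzC).trans ((le_abs_self _).trans ?_)
  exact Finset.single_le_sum (f := fun i => |B i|) (fun i _ => abs_nonneg _)
    (Finset.mem_range.2 (Nat.mod_lt j hN))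

lemma re_succ_mul (j : ℕ) (w : ℂ) : (((j : ℂ) + 1) * w).re = ((j : ℝ) + 1) * w.re := by simp

lemma norm_pow_div_succ_le {x : ℂ} {r : ℝ} (hx : ‖x‖ ≤ r) (j : ℕ) :
    ‖x ^ (j + 1) / ((j : ℂ) + 1)‖ ≤ r ^ (j + 1) := by
  rw [norm_div, norm_natCast_add_one, norm_pow]
  have : (1 : ℝ) ≤ (j : ℝ) + 1 := by linarith [j.cast_nonneg (α := ℝ)]
  exact (div_le_self (by positivity) this).trans (pow_le_pow_left₀ (norm_nonneg _) hx _)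

lemma summable_pow_succ {r : ℝ} (h0 : 0 ≤ r) (h1 : r < 1) : Summable fun j : ℕ => r ^ (j + 1) :=
  (summable_nat_add_iff 1).2 (summable_geometric_of_lt_one h0 h1)

lemma norm_regSum_term_le {ζ x w : ℂ} {r : ℝ} (hζ : ‖ζ‖ = 1) (hx : ‖x‖ ≤ r) (hw : 0 < w.re)
    (j : ℕ) :
    ‖x ^ (j + 1) / ((j : ℂ) + 1) * regKernel (ζ ^ (j + 1)) (((j : ℂ) + 1) * w)‖ ≤
      r ^ (j + 1) * (2 * w.re⁻¹) := by
  have hr : 0 ≤ r := (norm_nonneg _).trans hx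
  have hre := re_succ_mul j w
  have hpos : 0 < (((j : ℂ) + 1) * w).re := by rw [hre]; positivity
  rw [norm_mul]
  refine mul_le_mul (norm_pow_div_succ_le hx j) ?_ (norm_nonneg _) (by positivity)
  refine (norm_regKernel_le (by rw [norm_pow, hζ, one_pow]) hpos).trans ?_
  rw [hre]
  gcongr
  have : (1 : ℝ) ≤ (j : ℝ) + 1 := by linarith [j.cast_nonneg (α := ℝ)]
  nlinarith

/-- The terms with `ζ^j = 1` have a simple pole at `w = 0`, with residue `x^j / j²`; the poles are
collected in `polarCoeff`. No assumption on `ζ` being a root of unity is made. -/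
lemma lambertSum_eq {x w : ℂ} (hx : ‖x‖ < 1) (hw : 0 < w.re) (θ : ℝ) :
    lambertSum x (w + Complex.I * θ) =
      polarCoeff (Complex.exp (Complex.I * θ)) x / w +
        regSum (Complex.exp (Complex.I * θ)) x w := by
  set ζ := Complex.exp (Complex.I * θ) with hζdef
  have hζ : ‖ζ‖ = 1 := by
    rw [hζdef, mul_comm]
    exact Complex.norm_exp_ofReal_mul_I θ
  have hw0 : w ≠ 0 := by
    rintro rfl
    simp at hw
  have hs2 : Summable fun j : ℕ =>
      x ^ (j + 1) / ((j : ℂ) + 1) * regKernel (ζ ^ (j + 1)) (((j : ℂ) + 1) * w) :=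
    Summable.of_norm_bounded ((summable_pow_succ (norm_nonneg _) hx).mul_right _)
      (norm_regSum_term_le hζ le_rfl hw)
  classical
  have hs1 : Summable fun j : ℕ =>
      if ζ ^ (j + 1) = 1 then x ^ (j + 1) / ((j : ℂ) + 1) ^ 2 else 0 := by
    refine Summable.of_norm_bounded (hasSum_one_div_succ_sq.summable.mul_left ‖x‖) fun j => ?_
    split_ifs
    · exact norm_dilog_term_le hx.le j
    · rw [norm_zero]; positivity
  have h := (hs1.hasSum.div_const w).add hs2.hasSum
  rw [lambertSum]
  refine (h.congr_fun ?_).tsum_eq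
  intro j
  have hE : Complex.exp (((j : ℂ) + 1) * (w + Complex.I * θ)) =
      ζ ^ (j + 1) * Complex.exp (((j : ℂ) + 1) * w) := by
    rw [hζdef, ← Complex.exp_nat_mul, ← Complex.exp_add]
    congr 1
    push_cast
    ring
  have hj : (j : ℂ) + 1 ≠ 0 := Nat.cast_add_one_ne_zero j
  simp only [regKernel, hE]
  split_ifs with h1
  · rw [h1, one_mul]
    field_simp
    ring
  · simp

/-- Along any approach to the origin with real part not too small, the regular part is negligible. -/
lemma tendsto_regSum_div {ι : Type*} {l : Filter ι} {ζ x₀ : ℂ} (hζ : ‖ζ‖ = 1) (hx₀ : ‖x₀‖ < 1)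
    {x w : ι → ℂ} {s : ι → ℝ} {c : ℝ} (hx : Tendsto x l (𝓝 x₀)) (hw : Tendsto w l (𝓝 0))
    (hs : Tendsto s l atTop) (hc : 0 < c) (hcw : ∀ᶠ i in l, c ≤ (w i).re * s i) :
    Tendsto (fun i => regSum ζ (x i) (w i) / s i) l (𝓝 0) := by
  obtain ⟨r, hr0, hr1⟩ := exists_between hx₀
  have hr : 0 ≤ r := (norm_nonneg _).trans hr0.le
  have hspos : ∀ᶠ i in l, 0 < s i := hs.eventually_gt_atTop 0
  have hwpos : ∀ᶠ i in l, 0 < (w i).re := by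
    filter_upwards [hspos, hcw] with i h1 h2
    exact pos_of_mul_pos_left (hc.trans_le h2) h1.le
  have hxr : ∀ᶠ i in l, ‖x i‖ ≤ r := by
    filter_upwards [hx.norm.eventually_lt_const hr0] with i hi using hi.le
  have hsinv : Tendsto (fun i => ((s i : ℝ) : ℂ)⁻¹) l (𝓝 0) := by
    have h1 : Tendsto (fun i => (s i)⁻¹) l (𝓝 0) := tendsto_inv_atTop_zero.comp hs
    have h2 := (Complex.continuous_ofReal.tendsto 0).comp h1
    simpa [Function.comp_def] using h2
  have key : Tendsto (fun i => ∑' j : ℕ, x i ^ (j + 1) / ((j : ℂ) + 1) *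
      regKernel (ζ ^ (j + 1)) (((j : ℂ) + 1) * w i) * ((s i : ℝ) : ℂ)⁻¹) l
      (𝓝 (∑' j : ℕ, (0 : ℂ))) := by
    refine tendsto_tsum_of_dominated_convergence (bound := fun j => r ^ (j + 1) * (2 * c⁻¹))
      ((summable_pow_succ hr hr1).mul_right _) (fun j => ?_) ?_
    · have hj : (j : ℂ) + 1 ≠ 0 := Nat.cast_add_one_ne_zero j
      have h1 : Tendsto (fun i => ((j : ℂ) + 1) * w i) l (𝓝[≠] 0) := by
        refine tendsto_nhdsWithin_iff.2 ⟨by simpa using hw.const_mul ((j : ℂ) + 1), ?_⟩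
        filter_upwards [hwpos] with i hi
        refine mul_ne_zero hj ?_
        rintro h0
        simp [h0] at hi
      have h2 := (((hx.pow (j + 1)).div_const ((j : ℂ) + 1)).mul
        ((tendsto_regKernel (ζ ^ (j + 1))).comp h1)).mul hsinv
      simpa using h2
    · filter_upwards [hxr, hwpos, hspos, hcw] with i h1 h2 h3 h4 j
      rw [norm_mul, norm_inv, Complex.norm_real, Real.norm_eq_abs, abs_of_pos h3]
      calc _ ≤ r ^ (j + 1) * (2 * (w i).re⁻¹) * (s i)⁻¹ := by
            gcongr
            exact norm_regSum_term_le hζ h1 h2 j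
        _ = r ^ (j + 1) * (2 * ((w i).re * s i)⁻¹) := by rw [mul_inv]; ring
        _ ≤ _ := by gcongr
  rw [tsum_zero] at key
  refine key.congr fun i => ?_
  rw [tsum_mul_right, regSum, div_eq_mul_inv]

/-- On a sector the kernels are bounded, so dominated convergence gives a genuine limit, needed for
the constant at a saddle. The cruder `tendsto_regSum_div` suffices elsewhere and allows arbitrary
directions. -/
lemma tendsto_regSum {ι : Type*} {l : Filter ι} {ζ x₀ : ℂ} {N : ℕ} (hN : 0 < N) (hζ : ζ ^ N = 1)
    (hx₀ : ‖x₀‖ < 1) {x w : ι → ℂ} {C : ℝ} (hx : Tendsto x l (𝓝 x₀))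
    (hw : Tendsto w l (𝓝 0)) (hwpos : ∀ᶠ i in l, 0 < (w i).re)
    (hcw : ∀ᶠ i in l, ‖w i‖ ≤ C * (w i).re) :
    Tendsto (fun i => regSum ζ (x i) (w i)) l (𝓝 (regConst ζ x₀)) := by
  obtain ⟨r, hr0, hr1⟩ := exists_between hx₀
  have hr : 0 ≤ r := (norm_nonneg _).trans hr0.le
  obtain ⟨B, hB⟩ := exists_norm_regKernel_pow_le hN hζ C
  have hxr : ∀ᶠ i in l, ‖x i‖ ≤ r := by
    filter_upwards [hx.norm.eventually_lt_const hr0] with i hi using hi.le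
  refine tendsto_tsum_of_dominated_convergence (bound := fun j => r ^ (j + 1) * B)
      ((summable_pow_succ hr hr1).mul_right _) (fun j => ?_) ?_
  · have hj : (j : ℂ) + 1 ≠ 0 := Nat.cast_add_one_ne_zero j
    have h1 : Tendsto (fun i => ((j : ℂ) + 1) * w i) l (𝓝[≠] 0) := by
      refine tendsto_nhdsWithin_iff.2 ⟨by simpa using hw.const_mul ((j : ℂ) + 1), ?_⟩
      filter_upwards [hwpos] with i hi
      refine mul_ne_zero hj ?_
      rintro h0
      simp [h0] at hi
    exact ((hx.pow (j + 1)).div_const ((j : ℂ) + 1)).mul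
      ((tendsto_regKernel (ζ ^ (j + 1))).comp h1)
  · filter_upwards [hxr, hwpos, hcw] with i h1 h2 h3 j
    rw [norm_mul]
    refine mul_le_mul (norm_pow_div_succ_le h1 j) (hB _ _ ?_ ?_) (norm_nonneg _) (by positivity)
    · rw [re_succ_mul]; positivity
    · rw [re_succ_mul, norm_mul, norm_natCast_add_one]
      nlinarith [j.cast_nonneg (α := ℝ)]

lemma exists_norm_regSum_le {ζ : ℂ} {N : ℕ} (hN : 0 < N) (hζ : ζ ^ N = 1) {r : ℝ} (hr0 : 0 ≤ r)
    (hr : r < 1) (C : ℝ) :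
    ∃ B, ∀ x w : ℂ, ‖x‖ ≤ r → 0 < w.re → ‖w‖ ≤ C * w.re → ‖regSum ζ x w‖ ≤ B := by
  obtain ⟨B, hB⟩ := exists_norm_regKernel_pow_le hN hζ C
  refine ⟨∑' j : ℕ, r ^ (j + 1) * B, fun x w hx hw hwC => ?_⟩
  refine tsum_of_norm_bounded ((summable_pow_succ hr0 hr).mul_right B).hasSum fun j => ?_
  rw [norm_mul]
  refine mul_le_mul (norm_pow_div_succ_le hx j) (hB _ _ ?_ ?_) (norm_nonneg _) (by positivity)
  · rw [re_succ_mul]; positivity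
  · rw [re_succ_mul, norm_mul, norm_natCast_add_one]
    nlinarith [j.cast_nonneg (α := ℝ)]

/-- `orderOf ζ = 0` encodes infinite order: no power of `ζ` produces a pole. -/
lemma polarCoeff_of_orderOf_eq_zero {ζ : ℂ} (h : orderOf ζ = 0) (x : ℂ) : polarCoeff ζ x = 0 := by
  rw [polarCoeff]
  convert tsum_zero with j
  rw [if_neg]
  intro hj
  exact (orderOf_eq_zero_iff'.1 h) (j + 1) (Nat.succ_pos j) hj

/-- Only exponents divisible by the order `l` contribute, and `∑ x^{li} / (li)² = Li₂(x^l) / l²`. -/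
lemma polarCoeff_eq {ζ : ℂ} (h : 0 < orderOf ζ) {x : ℂ} (hx : ‖x‖ < 1) :
    polarCoeff ζ x = rootLi (orderOf ζ) x ^ 2 := by
  set l := orderOf ζ with hl
  rw [rootLi_sq, polarCoeff]
  have hl0 : (l : ℂ) ≠ 0 := by exact_mod_cast h.ne'
  have hinj : Function.Injective fun i : ℕ => l * (i + 1) - 1 := by
    intro i j hij
    have h1 : 0 < l * (i + 1) := by positivity
    have h2 : 0 < l * (j + 1) := by positivity
    have h3 : l * (i + 1) = l * (j + 1) := by
      simp only at hij
      omega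
    simpa using Nat.eq_of_mul_eq_mul_left h h3
  have hd := (hasSum_dilog (norm_pow_le_one hx l)).div_const ((l : ℂ) ^ 2)
  classical
  have hgoal : HasSum (fun j : ℕ => if ζ ^ (j + 1) = 1 then x ^ (j + 1) / ((j : ℂ) + 1) ^ 2 else 0)
      (dilog (x ^ l) / (l : ℂ) ^ 2) := by
    rw [← hinj.hasSum_iff]
    · refine hd.congr_fun fun i => ?_
      have h1 : l * (i + 1) - 1 + 1 = l * (i + 1) :=
        Nat.sub_add_cancel (Nat.succ_le_of_lt (by positivity))
      have h2 : ((l * (i + 1) - 1 : ℕ) : ℂ) + 1 = (l : ℂ) * ((i : ℂ) + 1) := by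
        have : (((l * (i + 1) - 1 + 1 : ℕ)) : ℂ) = ((l * (i + 1) : ℕ) : ℂ) := by rw [h1]
        push_cast at this
        exact this
      simp only [Function.comp_def]
      rw [h1, h2, if_pos (by rw [pow_mul, hl, pow_orderOf_eq_one, one_pow]), ← pow_mul, mul_pow]
      field_simp
    · intro j hj
      rw [if_neg]
      intro h1
      obtain ⟨i, hi⟩ := orderOf_dvd_of_pow_eq_one h1
      rw [← hl] at hi
      refine hj ⟨i - 1, ?_⟩
      have hi0 : i ≠ 0 := by
        rintro rfl
        simp at hi
      simp only
      rw [Nat.sub_add_cancel (Nat.one_le_iff_ne_zero.2 hi0), ← hi]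
      rfl
  exact hgoal.tsum_eq

/-- For real `c = Re h / Re z` one has `h = c z + i t` with `t` real, hence `h² / z = 2 c h - c² z -
t² / z`, and the last term only lowers the real part. -/
lemma re_sq_div_le {h z : ℂ} (hz : 0 < z.re) : (h ^ 2 / z).re ≤ h.re ^ 2 / z.re := by
  set c : ℝ := h.re / z.re with hc
  have hz0 : z ≠ 0 := by
    rintro rfl
    simp at hz
  have hch : h.re = c * z.re := by rw [hc]; field_simp
  set t : ℝ := h.im - c * z.im with ht
  have hh : h = c * z + t * Complex.I := by
    apply Complex.ext
    · simp [hch]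
    · simp [ht]
  have e : h ^ 2 / z = 2 * c * h - (c : ℂ) ^ 2 * z - ((t ^ 2 : ℝ) : ℂ) * z⁻¹ := by
    field_simp
    rw [hh]
    push_cast
    linear_combination (t : ℂ) ^ 2 * Complex.I_sq
  have e2 : (h ^ 2 / z).re = 2 * c * h.re - c ^ 2 * z.re - t ^ 2 * (z⁻¹).re := by
    rw [e, Complex.sub_re, Complex.sub_re, Complex.re_ofReal_mul,
      show (2 * c * h : ℂ) = ((2 * c : ℝ) : ℂ) * h by push_cast; ring, Complex.re_ofReal_mul,
      show ((c : ℂ) ^ 2 * z) = ((c ^ 2 : ℝ) : ℂ) * z by push_cast; ring, Complex.re_ofReal_mul]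
  have hinv : 0 ≤ (z⁻¹).re := by
    rw [Complex.inv_re]
    exact div_nonneg hz.le (Complex.normSq_nonneg _)
  rw [e2, hch]
  have : (c * z.re) ^ 2 / z.re = c ^ 2 * z.re := by field_simp
  rw [this]
  nlinarith [mul_nonneg (sq_nonneg t) hinv]

/-! ### Estimates away from the dominant saddle points -/

lemma tendsto_sqrt_natCast_fst {x₀ : ℂ} :
    Tendsto (fun p : ℕ × ℂ => √(p.1 : ℝ)) (atTop ×ˢ 𝓝 x₀) atTop :=
  (Real.tendsto_sqrt_atTop.comp tendsto_natCast_atTop_atTop).comp tendsto_fst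

lemma continuousAt_f {k : ℕ} (hk : k ≠ 0) {x : ℂ} (hx : ‖x‖ < 1) : ContinuousAt (f k) x :=
  (continuousOn_f hk).continuousAt (isOpen_ball.mem_nhds (mem_ball_zero_iff.2 hx))

lemma norm_exp_I_mul (θ : ℝ) : ‖Complex.exp (Complex.I * θ)‖ = 1 := by
  rw [mul_comm]
  exact Complex.norm_exp_ofReal_mul_I θ

/-- The point `σ + i (φ - θ)`, where `σ = f k x / √n`, for `p = ((n, x), φ)`. -/
def saddlePoint (k : ℕ) (θ : ℝ) (p : (ℕ × ℂ) × ℝ) : ℂ :=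
  ((f k p.1.2 / √(p.1.1 : ℝ) : ℝ) : ℂ) + Complex.I * ((p.2 - θ : ℝ) : ℂ)

lemma saddlePoint_re (k : ℕ) (θ : ℝ) (p : (ℕ × ℂ) × ℝ) :
    (saddlePoint k θ p).re = f k p.1.2 / √(p.1.1 : ℝ) := by
  rw [saddlePoint, Complex.add_re, Complex.ofReal_re, mul_comm, Complex.re_ofReal_mul,
    Complex.I_re, mul_zero, add_zero]

lemma saddlePoint_im (k : ℕ) (θ : ℝ) (p : (ℕ × ℂ) × ℝ) :
    (saddlePoint k θ p).im = p.2 - θ := by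
  rw [saddlePoint, Complex.add_im, Complex.ofReal_im, mul_comm, Complex.im_ofReal_mul,
    Complex.I_im, mul_one, zero_add]

lemma tendsto_saddlePoint {k : ℕ} (hk : k ≠ 0) {x₀ : ℂ} (hx₀ : ‖x₀‖ < 1) (θ : ℝ) :
    Tendsto (saddlePoint k θ) ((atTop ×ˢ 𝓝 x₀) ×ˢ 𝓝 θ) (𝓝 0) := by
  have h1 : Tendsto (fun p : (ℕ × ℂ) × ℝ => f k p.1.2) ((atTop ×ˢ 𝓝 x₀) ×ˢ 𝓝 θ) (𝓝 (f k x₀)) :=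
    (continuousAt_f hk hx₀).tendsto.comp (tendsto_snd.comp tendsto_fst)
  have h2 : Tendsto (fun p : (ℕ × ℂ) × ℝ => √(p.1.1 : ℝ)) ((atTop ×ˢ 𝓝 x₀) ×ˢ 𝓝 θ) atTop :=
    tendsto_sqrt_natCast_fst.comp tendsto_fst
  have h3 := h1.div_atTop h2
  have h4 : Tendsto (fun p : (ℕ × ℂ) × ℝ => p.2 - θ) ((atTop ×ˢ 𝓝 x₀) ×ˢ 𝓝 θ) (𝓝 0) := by
    have : Tendsto (fun p : (ℕ × ℂ) × ℝ => p.2 - θ) ((atTop ×ˢ 𝓝 x₀) ×ˢ 𝓝 θ) (𝓝 (θ - θ)) :=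
      tendsto_snd.sub_const θ
    rwa [sub_self] at this
  have h5 := ((Complex.continuous_ofReal.tendsto 0).comp h3).add
    (((Complex.continuous_ofReal.tendsto 0).comp h4).const_mul Complex.I)
  unfold saddlePoint
  simpa [Function.comp_def] using h5

/-- The regular part is `o(√n)`, so a bound on the polar part suffices. The gap `f_k - g₀` is split
in three: one third for the variation of `g`, one for the regular part, one as gain. The predicate
`Q` can restrict `φ` to lie away from a saddle. -/
lemma exists_eventually_re_lambertSum_le {k : ℕ} (hk : k ≠ 0) {x₀ : ℂ} (hx₀ : ‖x₀‖ < 1)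
    (hpos : 0 < f k x₀) (θ : ℝ) {g : ℂ → ℝ} {g₀ : ℝ} (hg : Tendsto g (𝓝 x₀) (𝓝 g₀))
    (hg₀ : g₀ < f k x₀) {Q : (ℕ × ℂ) × ℝ → Prop}
    (hQ : ∀ᶠ p : (ℕ × ℂ) × ℝ in (atTop ×ˢ 𝓝 x₀) ×ˢ 𝓝 θ, Q p →
      (polarCoeff (Complex.exp (Complex.I * θ)) p.1.2 / saddlePoint k θ p).re ≤
        g p.1.2 * √(p.1.1 : ℝ)) :
    ∃ δ > 0, ∀ᶠ p : (ℕ × ℂ) × ℝ in (atTop ×ˢ 𝓝 x₀) ×ˢ 𝓝 θ, Q p →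
      (lambertSum p.1.2 (((f k p.1.2 / √(p.1.1 : ℝ) : ℝ) : ℂ) + Complex.I * p.2)).re ≤
        (f k x₀ - δ) * √(p.1.1 : ℝ) := by
  set δ := (f k x₀ - g₀) / 3 with hδ
  have hδ0 : 0 < δ := by rw [hδ]; linarith
  refine ⟨δ, hδ0, ?_⟩
  have hs : Tendsto (fun p : (ℕ × ℂ) × ℝ => √(p.1.1 : ℝ)) ((atTop ×ˢ 𝓝 x₀) ×ˢ 𝓝 θ) atTop :=
    tendsto_sqrt_natCast_fst.comp tendsto_fst
  have hx : Tendsto (fun p : (ℕ × ℂ) × ℝ => p.1.2) ((atTop ×ˢ 𝓝 x₀) ×ˢ 𝓝 θ) (𝓝 x₀) :=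
    tendsto_snd.comp tendsto_fst
  have hspos := hs.eventually_gt_atTop 0
  have hf := ((continuousAt_f hk hx₀).tendsto.comp hx).eventually_const_lt (half_lt_self hpos)
  have hgl := (hg.comp hx).eventually_lt_const (show g₀ < g₀ + δ by linarith)
  have hxl := hx.norm.eventually_lt_const hx₀
  have hreg := tendsto_regSum_div (norm_exp_I_mul θ) hx₀ hx (tendsto_saddlePoint hk hx₀ θ) hs
    (half_pos hpos) (by
      filter_upwards [hspos, hf] with p h1 h2
      rw [saddlePoint_re, div_mul_cancel₀ _ h1.ne']
      exact h2.le)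
  have hreg' := hreg.norm.eventually_lt_const (show ‖(0 : ℂ)‖ < δ by simpa using hδ0)
  filter_upwards [hspos, hf, hgl, hxl, hreg', hQ] with p h1 h2 h3 h4 h5 h6 hp
  have hw : 0 < (saddlePoint k θ p).re := by
    rw [saddlePoint_re]
    exact div_pos ((half_pos hpos).trans h2) h1
  have e : ((f k p.1.2 / √(p.1.1 : ℝ) : ℝ) : ℂ) + Complex.I * p.2 =
      saddlePoint k θ p + Complex.I * θ := by
    rw [saddlePoint]
    push_cast
    ring
  rw [e, lambertSum_eq h4 hw, Complex.add_re]
  have h7 : (regSum (Complex.exp (Complex.I * θ)) p.1.2 (saddlePoint k θ p)).re ≤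
      δ * √(p.1.1 : ℝ) := by
    refine (Complex.re_le_norm _).trans ?_
    rw [norm_div, Complex.norm_real, Real.norm_eq_abs, abs_of_pos h1, div_lt_iff₀ h1] at h5
    exact h5.le
  have h8 := h6 hp
  have h9 : g p.1.2 * √(p.1.1 : ℝ) ≤ (g₀ + δ) * √(p.1.1 : ℝ) :=
    mul_le_mul_of_nonneg_right (le_of_lt h3) h1.le
  have h10 : g₀ = f k x₀ - 3 * δ := by rw [hδ]; ring
  rw [h10] at h9
  linarith

/-- On the line `Re w = f_k / √n`, `re_sq_div_le` bounds a pole of order `l` by `(f_l² / f_k) √n`,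
which is smaller than `f_k √n` when `f_l < f_k`. -/
lemma exists_eventually_re_lambertSum_le_of_lt {k : ℕ} (hk : k ≠ 0) {x₀ : ℂ} (hx₀ : ‖x₀‖ < 1)
    (hpos : 0 < f k x₀) (θ : ℝ)
    (hθ : orderOf (Complex.exp (Complex.I * θ)) = 0 ∨
      f (orderOf (Complex.exp (Complex.I * θ))) x₀ < f k x₀) :
    ∃ δ > 0, ∀ᶠ p : (ℕ × ℂ) × ℝ in (atTop ×ˢ 𝓝 x₀) ×ˢ 𝓝 θ, True →
      (lambertSum p.1.2 (((f k p.1.2 / √(p.1.1 : ℝ) : ℝ) : ℂ) + Complex.I * p.2)).re ≤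
        (f k x₀ - δ) * √(p.1.1 : ℝ) := by
  set ζ := Complex.exp (Complex.I * θ) with hζ
  set l := orderOf ζ with hl
  have hs : Tendsto (fun p : (ℕ × ℂ) × ℝ => √(p.1.1 : ℝ)) ((atTop ×ˢ 𝓝 x₀) ×ˢ 𝓝 θ) atTop :=
    tendsto_sqrt_natCast_fst.comp tendsto_fst
  have hx : Tendsto (fun p : (ℕ × ℂ) × ℝ => p.1.2) ((atTop ×ˢ 𝓝 x₀) ×ˢ 𝓝 θ) (𝓝 x₀) :=
    tendsto_snd.comp tendsto_fst
  rcases Nat.eq_zero_or_pos l with h0 | hlpos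
  · refine exists_eventually_re_lambertSum_le hk hx₀ hpos θ (g := fun _ => 0) (g₀ := 0)
      tendsto_const_nhds hpos (Q := fun _ => True) (Eventually.of_forall fun p _ => ?_)
    rw [polarCoeff_of_orderOf_eq_zero h0]
    simp
  · have hlt : f l x₀ < f k x₀ := hθ.resolve_left hlpos.ne'
    refine exists_eventually_re_lambertSum_le hk hx₀ hpos θ
      (g := fun x => f l x ^ 2 / f k x) (g₀ := f l x₀ ^ 2 / f k x₀)
      (((continuousAt_f hlpos.ne' hx₀).tendsto.pow 2).div (continuousAt_f hk hx₀).tendsto hpos.ne')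
      ?_ (Q := fun _ => True) ?_
    · rw [div_lt_iff₀ hpos]
      nlinarith [f_nonneg l x₀]
    · filter_upwards [hs.eventually_gt_atTop 0, hx.norm.eventually_lt_const hx₀,
        ((continuousAt_f hk hx₀).tendsto.comp hx).eventually_const_lt hpos] with p h1 h2 h3 _
      have h3' : 0 < f k p.1.2 := h3
      rw [polarCoeff_eq hlpos h2]
      refine (re_sq_div_le ?_).trans (le_of_eq ?_)
      · rw [saddlePoint_re]
        exact div_pos h3' h1
      · rw [saddlePoint_re, ← f_eq_re, ← hl]
        field_simp

/-- The exponent `h² / z + z` has its saddle at `z = h`; this exact identity replaces a Taylor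
expansion there. -/
lemma sq_div_eq_of_eq_add {h z : ℂ} {t : ℝ} (hz : z = h + Complex.I * t) (hz0 : z ≠ 0) :
    h ^ 2 / z = 2 * h - z - ((t ^ 2 : ℝ) : ℂ) / z := by
  field_simp
  rw [hz]
  push_cast
  linear_combination (t : ℂ) ^ 2 * Complex.I_sq

/-- With `z = h + i t` on the line through the saddle, `Re(h² / z) = Re h (1 - t² / |z|²)`. For `|t|
≥ T` the loss is at least `(T / (‖h‖ + T))²`, even as `|t| → ∞`. -/
lemma exists_eventually_re_lambertSum_le_of_far {k : ℕ} (hk : k ≠ 0) {x₀ : ℂ} (hx₀ : ‖x₀‖ < 1)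
    (hpos : 0 < f k x₀) {θ : ℝ} (hθ : orderOf (Complex.exp (Complex.I * θ)) = k) {T : ℝ}
    (hT : 0 < T) :
    ∃ δ > 0, ∀ᶠ p : (ℕ × ℂ) × ℝ in (atTop ×ˢ 𝓝 x₀) ×ˢ 𝓝 θ,
      T ≤ |√(p.1.1 : ℝ) * (p.2 - θ) - (rootLi k p.1.2).im| →
      (lambertSum p.1.2 (((f k p.1.2 / √(p.1.1 : ℝ) : ℝ) : ℂ) + Complex.I * p.2)).re ≤
        (f k x₀ - δ) * √(p.1.1 : ℝ) := by
  have hs : Tendsto (fun p : (ℕ × ℂ) × ℝ => √(p.1.1 : ℝ)) ((atTop ×ˢ 𝓝 x₀) ×ˢ 𝓝 θ) atTop :=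
    tendsto_sqrt_natCast_fst.comp tendsto_fst
  have hx : Tendsto (fun p : (ℕ × ℂ) × ℝ => p.1.2) ((atTop ×ˢ 𝓝 x₀) ×ˢ 𝓝 θ) (𝓝 x₀) :=
    tendsto_snd.comp tendsto_fst
  have hfc := (continuousAt_f hk hx₀).tendsto
  have hhc := (differentiableAt_rootLi hk hx₀ hpos).continuousAt.tendsto
  have hne : ∀ y : ℂ, 0 < ‖rootLi k y‖ + T := fun y => by positivity
  refine exists_eventually_re_lambertSum_le hk hx₀ hpos θ
    (g := fun x => f k x * (1 - (T / (‖rootLi k x‖ + T)) ^ 2))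
    (hfc.mul (tendsto_const_nhds.sub
      ((tendsto_const_nhds.div (hhc.norm.add_const T) (hne x₀).ne').pow 2))) ?_ ?_
  · have : 0 < (T / (‖rootLi k x₀‖ + T)) ^ 2 := by
      have := hne x₀
      positivity
    nlinarith
  · filter_upwards [hs.eventually_gt_atTop 0, hx.norm.eventually_lt_const hx₀,
      (hfc.comp hx).eventually_const_lt hpos] with p h1 h2 h3 hp
    have h3' : 0 < f k p.1.2 := h3
    rw [polarCoeff_eq (by rw [hθ]; exact Nat.pos_of_ne_zero hk) h2, hθ]
    set s := √(p.1.1 : ℝ) with hsdef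
    set h := rootLi k p.1.2 with hh
    set w := saddlePoint k θ p with hw
    set t := s * (p.2 - θ) - h.im with ht
    have hfh : f k p.1.2 = h.re := f_eq_re k p.1.2
    have hz : (s : ℂ) * w = h + Complex.I * t := by
      apply Complex.ext
      · rw [Complex.re_ofReal_mul, hw, saddlePoint_re, hfh, Complex.add_re, mul_comm Complex.I,
          Complex.re_ofReal_mul, Complex.I_re, mul_zero, add_zero, ← hsdef]
        field_simp
      · rw [Complex.im_ofReal_mul, hw, saddlePoint_im, Complex.add_im, mul_comm Complex.I,
          Complex.im_ofReal_mul, Complex.I_im, mul_one, ht]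
        ring
    set z := (s : ℂ) * w with hzdef
    have hzre : z.re = h.re := by
      rw [hz, Complex.add_re, mul_comm Complex.I, Complex.re_ofReal_mul, Complex.I_re, mul_zero,
        add_zero]
    have hz0 : z ≠ 0 := by
      intro h0
      rw [h0, Complex.zero_re, ← hfh] at hzre
      linarith
    have hsC : (s : ℂ) ≠ 0 := by exact_mod_cast h1.ne'
    have e1 : h ^ 2 / w = (s : ℂ) * (h ^ 2 / z) := by
      rw [hzdef]
      have : w ≠ 0 := fun h0 => hz0 (by rw [hzdef, h0, mul_zero])
      field_simp
    rw [e1, Complex.re_ofReal_mul, mul_comm]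
    refine mul_le_mul_of_nonneg_right ?_ h1.le
    rw [sq_div_eq_of_eq_add hz hz0, Complex.sub_re, Complex.sub_re, hzre, div_eq_mul_inv,
      Complex.re_ofReal_mul, Complex.inv_re, hzre, hfh]
    have e2 : (2 * h).re = 2 * h.re := by
      rw [show (2 * h : ℂ) = ((2 : ℝ) : ℂ) * h by push_cast; rfl, Complex.re_ofReal_mul]
    rw [e2]
    have hzn : ‖z‖ ≤ ‖h‖ + |t| := by
      rw [hz]
      refine (norm_add_le _ _).trans ?_
      simp
    have hzpos : 0 < ‖z‖ := norm_pos_iff.2 hz0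
    have hratio : T / (‖h‖ + T) ≤ |t| / ‖z‖ := by
      rw [div_le_div_iff₀ (hne _) hzpos]
      calc T * ‖z‖ ≤ T * (‖h‖ + |t|) := by gcongr
        _ ≤ |t| * (‖h‖ + T) := by nlinarith [norm_nonneg h]
    have hsq : (T / (‖h‖ + T)) ^ 2 ≤ (|t| / ‖z‖) ^ 2 := by
      have : 0 ≤ T / (‖h‖ + T) := (div_pos hT (hne _)).le
      gcongr
    have e3 : (|t| / ‖z‖) ^ 2 = t ^ 2 / Complex.normSq z := by
      rw [div_pow, sq_abs, Complex.sq_norm]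
    rw [e3] at hsq
    have hhpos : 0 < h.re := by rw [← hfh]; exact h3'
    have e4 : t ^ 2 * (h.re / Complex.normSq z) = h.re * (t ^ 2 / Complex.normSq z) := by ring
    rw [e4]
    nlinarith [mul_le_mul_of_nonneg_left hsq hhpos.le]

/-- Compactness of the interval of angles turns the local estimates into one `δ`, without a
dissection into major and minor arcs depending on `n`. -/
theorem exists_eventually_forall_re_lambertSum_le {k : ℕ} (hk : k ≠ 0) {x₀ : ℂ} (hx₀ : ‖x₀‖ < 1)
    (hpos : 0 < f k x₀) {a b : ℝ} {Θ : Finset ℝ}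
    (hΘ : ∀ θ ∈ Θ, orderOf (Complex.exp (Complex.I * θ)) = k)
    (hdom : ∀ θ ∈ Set.Icc a b, θ ∉ Θ → orderOf (Complex.exp (Complex.I * θ)) = 0 ∨
      f (orderOf (Complex.exp (Complex.I * θ))) x₀ < f k x₀) {T : ℝ} (hT : 0 < T) :
    ∃ δ > 0, ∀ᶠ p : ℕ × ℂ in atTop ×ˢ 𝓝 x₀, ∀ φ ∈ Set.Icc a b,
      (∀ θ ∈ Θ, T ≤ |√(p.1 : ℝ) * (φ - θ) - (rootLi k p.2).im|) →
      (lambertSum p.2 (((f k p.2 / √(p.1 : ℝ) : ℝ) : ℂ) + Complex.I * φ)).re ≤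
        (f k x₀ - δ) * √(p.1 : ℝ) := by
  refine isCompact_Icc.induction_on (p := fun S => ∃ δ > 0,
    ∀ᶠ p : ℕ × ℂ in atTop ×ˢ 𝓝 x₀, ∀ φ ∈ S,
      (∀ θ ∈ Θ, T ≤ |√(p.1 : ℝ) * (φ - θ) - (rootLi k p.2).im|) →
      (lambertSum p.2 (((f k p.2 / √(p.1 : ℝ) : ℝ) : ℂ) + Complex.I * φ)).re ≤
        (f k x₀ - δ) * √(p.1 : ℝ)) ?_ ?_ ?_ ?_
  · exact ⟨1, one_pos, Eventually.of_forall fun p φ hφ => absurd hφ (Set.notMem_empty φ)⟩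
  · rintro s t hst ⟨δ, hδ, h⟩
    exact ⟨δ, hδ, h.mono fun p hp φ hφ => hp φ (hst hφ)⟩
  · rintro s t ⟨δ₁, hδ₁, h₁⟩ ⟨δ₂, hδ₂, h₂⟩
    refine ⟨min δ₁ δ₂, lt_min hδ₁ hδ₂, ?_⟩
    filter_upwards [h₁, h₂] with p hp₁ hp₂ φ hφ hfar
    have hs : 0 ≤ √(p.1 : ℝ) := Real.sqrt_nonneg _
    rcases hφ with hφ | hφ
    · refine (hp₁ φ hφ hfar).trans (mul_le_mul_of_nonneg_right ?_ hs)
      linarith [min_le_left δ₁ δ₂]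
    · refine (hp₂ φ hφ hfar).trans (mul_le_mul_of_nonneg_right ?_ hs)
      linarith [min_le_right δ₁ δ₂]
  · intro θ hθ
    have hloc : ∃ δ > 0, ∀ᶠ p : (ℕ × ℂ) × ℝ in (atTop ×ˢ 𝓝 x₀) ×ˢ 𝓝 θ,
        (∀ θ' ∈ Θ, T ≤ |√(p.1.1 : ℝ) * (p.2 - θ') - (rootLi k p.1.2).im|) →
        (lambertSum p.1.2 (((f k p.1.2 / √(p.1.1 : ℝ) : ℝ) : ℂ) + Complex.I * p.2)).re ≤
          (f k x₀ - δ) * √(p.1.1 : ℝ) := by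
      by_cases hmem : θ ∈ Θ
      · obtain ⟨δ, hδ, h⟩ := exists_eventually_re_lambertSum_le_of_far hk hx₀ hpos (hΘ θ hmem) hT
        exact ⟨δ, hδ, h.mono fun p hp hfar => hp (hfar θ hmem)⟩
      · obtain ⟨δ, hδ, h⟩ :=
          exists_eventually_re_lambertSum_le_of_lt hk hx₀ hpos θ (hdom θ hθ hmem)
        exact ⟨δ, hδ, h.mono fun p hp _ => hp trivial⟩
    obtain ⟨δ, hδ, h⟩ := hloc
    rw [eventually_prod_iff] at h
    obtain ⟨P, hP, S, hS, hPS⟩ := h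
    exact ⟨{φ | S φ}, mem_nhdsWithin_of_mem_nhds hS, δ, hδ,
      hP.mono fun p hp φ hφ hfar => hPS hp hφ hfar⟩

/-! ### Saddle point asymptotics -/

lemma continuous_lambertSum {x : ℂ} (hx : ‖x‖ < 1) {σ : ℝ} (hσ : 0 < σ) :
    Continuous fun φ : ℝ => lambertSum x ((σ : ℂ) + Complex.I * φ) := by
  have hre : ∀ (j : ℕ) (φ : ℝ),
      (((j : ℂ) + 1) * ((σ : ℂ) + Complex.I * φ)).re = ((j : ℝ) + 1) * σ := by
    intro j φ
    simp
  have hpos : ∀ (j : ℕ) (φ : ℝ), 0 < (((j : ℂ) + 1) * ((σ : ℂ) + Complex.I * φ)).re := by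
    intro j φ
    rw [hre]
    positivity
  refine continuous_tsum (u := fun j => ‖x‖ ^ (j + 1) * σ⁻¹) (fun j => ?_)
    ((summable_pow_succ (norm_nonneg _) hx).mul_right _) fun j φ => ?_
  · refine continuous_const.mul (Continuous.inv₀ (by fun_prop) fun φ h0 => ?_)
    have := le_norm_mul_exp_sub_one (q := 1) (z := ((j : ℂ) + 1) * ((σ : ℂ) + Complex.I * φ))
      norm_one
    rw [one_mul, h0, norm_zero] at this
    exact absurd (hpos j φ) (not_lt.2 this)
  · rw [norm_mul]
    refine mul_le_mul (norm_pow_div_succ_le le_rfl j) ?_ (norm_nonneg _) (by positivity)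
    have := norm_inv_mul_exp_sub_one_le (q := 1) norm_one (hpos j φ)
    rw [one_mul, hre] at this
    refine this.trans (inv_anti₀ hσ ?_)
    nlinarith [j.cast_nonneg (α := ℝ)]

section

variable {k : ℕ} {x : ℂ} {θ : ℝ}

lemma add_I_mul_re (h : ℂ) (t : ℝ) : (h + Complex.I * t).re = h.re := by simp

lemma add_I_mul_ne_zero {h : ℂ} (hh : 0 < h.re) (t : ℝ) : h + Complex.I * t ≠ 0 := by
  intro h0
  have := add_I_mul_re h t
  rw [h0, Complex.zero_re] at this
  linarith

/-- The exponent of the Cauchy integral in coordinates centred at the saddle point. -/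
lemma lambertSum_add_eq (hk : k ≠ 0) (hx : ‖x‖ < 1) (hpos : 0 < f k x)
    (hθ : orderOf (Complex.exp (Complex.I * θ)) = k) {n : ℕ} (hn : 1 ≤ n) (t : ℝ) :
    lambertSum x (((f k x / √(n : ℝ) : ℝ) : ℂ) +
        Complex.I * ((θ + ((rootLi k x).im + t) / √(n : ℝ) : ℝ) : ℂ)) +
      n * (((f k x / √(n : ℝ) : ℝ) : ℂ) +
        Complex.I * ((θ + ((rootLi k x).im + t) / √(n : ℝ) : ℝ) : ℂ)) =
      2 * (√(n : ℝ) : ℝ) * rootLi k x + Complex.I * (n * θ) +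
        (regSum (Complex.exp (Complex.I * θ)) x ((rootLi k x + Complex.I * t) / (√(n : ℝ) : ℝ)) -
          (√(n : ℝ) : ℝ) * ((t ^ 2 : ℝ) : ℂ) / (rootLi k x + Complex.I * t)) := by
  set s := √(n : ℝ) with hs
  have hs0 : 0 < s := Real.sqrt_pos.2 (by exact_mod_cast hn)
  have hsC : (s : ℂ) ≠ 0 := by exact_mod_cast hs0.ne'
  have hns : (n : ℂ) = (s : ℂ) ^ 2 := by
    rw [← Complex.ofReal_pow, hs, Real.sq_sqrt (Nat.cast_nonneg n), Complex.ofReal_natCast]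
  set h := rootLi k x with hh
  have hfh : f k x = h.re := f_eq_re k x
  have hhre : 0 < h.re := by rw [← hfh]; exact hpos
  set z := h + Complex.I * t with hz
  have hz0 : z ≠ 0 := add_I_mul_ne_zero hhre t
  have e1 : ((f k x / s : ℝ) : ℂ) + Complex.I * ((θ + (h.im + t) / s : ℝ) : ℂ) =
      z / s + Complex.I * θ := by
    have : h = (h.re : ℂ) + h.im * Complex.I := (Complex.re_add_im h).symm
    rw [hz, hfh]
    push_cast
    field_simp
    linear_combination -this
  have hwre : 0 < (z / (s : ℂ)).re := by
    rw [Complex.div_ofReal_re, hz, add_I_mul_re]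
    exact div_pos hhre hs0
  rw [e1, lambertSum_eq hx hwre, polarCoeff_eq (by rw [hθ]; exact Nat.pos_of_ne_zero hk) hx, hθ,
    ← hh]
  have e2 : h ^ 2 / (z / s) = s * (h ^ 2 / z) := by
    field_simp
  rw [e2, sq_div_eq_of_eq_add hz hz0, hns]
  field_simp
  ring

end

/-- The integrand of the rescaled Cauchy integral near a saddle point. -/
def saddleIntegrand (k : ℕ) (θ : ℝ) (p : ℕ × ℂ) (v : ℝ) : ℂ :=
  Complex.exp (regSum (Complex.exp (Complex.I * θ)) p.2
      ((rootLi k p.2 + Complex.I * ((v / √√(p.1 : ℝ) : ℝ) : ℂ)) / (√(p.1 : ℝ) : ℝ)) -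
    ((v ^ 2 : ℝ) : ℂ) / (rootLi k p.2 + Complex.I * ((v / √√(p.1 : ℝ) : ℝ) : ℂ)))

/-- With `s = √n`, the scale `t = v / √s` turns `s t²` into `v²`. The three factors are the growth,
the phase at the root of unity, and an integrand that converges. -/
lemma exp_lambertSum_eq {k : ℕ} (hk : k ≠ 0) {p : ℕ × ℂ} {θ : ℝ} (hx : ‖p.2‖ < 1)
    (hpos : 0 < f k p.2) (hθ : orderOf (Complex.exp (Complex.I * θ)) = k) (hn : 1 ≤ p.1) (v : ℝ) :
    Complex.exp (lambertSum p.2 (((f k p.2 / √(p.1 : ℝ) : ℝ) : ℂ) + Complex.I *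
        ((θ + ((rootLi k p.2).im + v / √√(p.1 : ℝ)) / √(p.1 : ℝ) : ℝ) : ℂ)) +
      p.1 * (((f k p.2 / √(p.1 : ℝ) : ℝ) : ℂ) + Complex.I *
        ((θ + ((rootLi k p.2).im + v / √√(p.1 : ℝ)) / √(p.1 : ℝ) : ℝ) : ℂ))) =
      Complex.exp (2 * (√(p.1 : ℝ) : ℝ) * rootLi k p.2) * Complex.exp (Complex.I * (p.1 * θ)) *
        saddleIntegrand k θ p v := by
  rw [lambertSum_add_eq hk hx hpos hθ hn, Complex.exp_add, Complex.exp_add, saddleIntegrand]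
  congr 4
  have hs : 0 ≤ √(p.1 : ℝ) := Real.sqrt_nonneg _
  have hs0 : 0 < √(p.1 : ℝ) := Real.sqrt_pos.2 (by exact_mod_cast hn)
  rw [← Complex.ofReal_mul, div_pow, Real.sq_sqrt hs]
  congr 1
  field_simp

lemma continuous_saddleIntegrand {k : ℕ} (hk : k ≠ 0) {p : ℕ × ℂ} {θ : ℝ} (hx : ‖p.2‖ < 1)
    (hpos : 0 < f k p.2) (hθ : orderOf (Complex.exp (Complex.I * θ)) = k) (hn : 1 ≤ p.1) :
    Continuous (saddleIntegrand k θ p) := by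
  have hs0 : 0 < √(p.1 : ℝ) := Real.sqrt_pos.2 (by exact_mod_cast hn)
  have hc := continuous_lambertSum hx (div_pos hpos hs0)
  have e : saddleIntegrand k θ p = fun v : ℝ =>
      (Complex.exp (2 * (√(p.1 : ℝ) : ℝ) * rootLi k p.2) *
        Complex.exp (Complex.I * (p.1 * θ)))⁻¹ *
      Complex.exp (lambertSum p.2 (((f k p.2 / √(p.1 : ℝ) : ℝ) : ℂ) + Complex.I *
        ((θ + ((rootLi k p.2).im + v / √√(p.1 : ℝ)) / √(p.1 : ℝ) : ℝ) : ℂ)) +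
      p.1 * (((f k p.2 / √(p.1 : ℝ) : ℝ) : ℂ) + Complex.I *
        ((θ + ((rootLi k p.2).im + v / √√(p.1 : ℝ)) / √(p.1 : ℝ) : ℝ) : ℂ))) := by
    funext v
    rw [exp_lambertSum_eq hk hx hpos hθ hn, inv_mul_cancel_left₀]
    exact mul_ne_zero (Complex.exp_ne_zero _) (Complex.exp_ne_zero _)
  rw [e]
  have h2 : Continuous fun v : ℝ =>
      θ + ((rootLi k p.2).im + v / √√(p.1 : ℝ)) / √(p.1 : ℝ) := by fun_prop
  have h3 := hc.comp h2
  simp only [Function.comp_def] at h3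
  exact continuous_const.mul (Complex.continuous_exp.comp (h3.add (by fun_prop)))

/-- The limit of the rescaled Cauchy integral near a saddle point. -/
def saddleConst (k : ℕ) (x : ℂ) (θ : ℝ) : ℂ :=
  Complex.exp (regConst (Complex.exp (Complex.I * θ)) x) *
    ∫ v : ℝ, Complex.exp (-((v ^ 2 : ℝ) : ℂ) / rootLi k x)

lemma norm_exp_neg_sq_div {z : ℂ} {v : ℝ} :
    ‖Complex.exp (-(((v ^ 2 : ℝ) : ℂ) / z))‖ = Real.exp (-(v ^ 2 * (z.re / ‖z‖ ^ 2))) := by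
  rw [Complex.norm_exp, Complex.neg_re, div_eq_mul_inv, Complex.re_ofReal_mul, Complex.inv_re,
    Complex.sq_norm]

/-- Dominated convergence on the whole line, with majorant `e^{B - b v²}`, jointly in `n → ∞` and `x
→ x₀`. -/
lemma tendsto_integral_saddleIntegrand {k : ℕ} (hk : k ≠ 0) {x₀ : ℂ} (hx₀ : ‖x₀‖ < 1)
    (hpos : 0 < f k x₀) {θ : ℝ} (hθ : orderOf (Complex.exp (Complex.I * θ)) = k) :
    Tendsto (fun p : ℕ × ℂ => ∫ v in (-√√(p.1 : ℝ))..√√(p.1 : ℝ), saddleIntegrand k θ p v)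
      (atTop ×ˢ 𝓝 x₀) (𝓝 (saddleConst k x₀ θ)) := by
  set l : Filter (ℕ × ℂ) := atTop ×ˢ 𝓝 x₀ with hl
  set ζ := Complex.exp (Complex.I * θ) with hζ
  set h₀ := rootLi k x₀ with hh₀
  set f₀ := f k x₀ with hf₀
  have hζk : ζ ^ k = 1 := by rw [← hθ]; exact pow_orderOf_eq_one ζ
  have hkpos : 0 < k := Nat.pos_of_ne_zero hk
  obtain ⟨r, hr0, hr1⟩ := exists_between hx₀
  have hr : 0 ≤ r := (norm_nonneg _).trans hr0.le
  set H := ‖h₀‖ + 1 + 1 with hH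
  have hHpos : 0 < H := by positivity
  obtain ⟨B, hB⟩ := exists_norm_regSum_le hkpos hζk hr hr1 (H / (f₀ / 2))
  have hs : Tendsto (fun p : ℕ × ℂ => √(p.1 : ℝ)) l atTop := tendsto_sqrt_natCast_fst
  have hss : Tendsto (fun p : ℕ × ℂ => √√(p.1 : ℝ)) l atTop := Real.tendsto_sqrt_atTop.comp hs
  have hx : Tendsto (fun p : ℕ × ℂ => p.2) l (𝓝 x₀) := tendsto_snd
  have hf : Tendsto (fun p : ℕ × ℂ => f k p.2) l (𝓝 f₀) :=
    (continuousAt_f hk hx₀).tendsto.comp hx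
  have hh : Tendsto (fun p : ℕ × ℂ => rootLi k p.2) l (𝓝 h₀) :=
    (differentiableAt_rootLi hk hx₀ hpos).continuousAt.tendsto.comp hx
  have hn1 : ∀ᶠ p : ℕ × ℂ in l, 1 ≤ p.1 := tendsto_fst.eventually (eventually_ge_atTop 1)
  have hxr : ∀ᶠ p : ℕ × ℂ in l, ‖p.2‖ < r := hx.norm.eventually_lt_const hr0
  have hfl : ∀ᶠ p : ℕ × ℂ in l, f₀ / 2 < f k p.2 := hf.eventually_const_lt (half_lt_self hpos)
  have hhl : ∀ᶠ p : ℕ × ℂ in l, ‖rootLi k p.2‖ < ‖h₀‖ + 1 :=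
    hh.norm.eventually_lt_const (by linarith)
  -- On the arc, `z = h + i t` satisfies `‖z‖ ≤ H` and `Re z ≥ f₀ / 2`. It lies in a fixed sector,
  -- which bounds the regular part and gives the Gaussian decay rate `b`.
  have hbound : ∀ᶠ p : ℕ × ℂ in l, ∀ t : ℝ, |t| ≤ 1 →
      0 < ((rootLi k p.2 + Complex.I * t) / (√(p.1 : ℝ) : ℝ)).re ∧
      ‖(rootLi k p.2 + Complex.I * t) / (√(p.1 : ℝ) : ℝ)‖ ≤
        H / (f₀ / 2) * ((rootLi k p.2 + Complex.I * t) / (√(p.1 : ℝ) : ℝ)).re ∧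
      ‖rootLi k p.2 + Complex.I * t‖ ≤ H := by
    filter_upwards [hn1, hfl, hhl] with p h1 h2 h3 t ht
    have hs0 : 0 < √(p.1 : ℝ) := Real.sqrt_pos.2 (by exact_mod_cast h1)
    have hre : (rootLi k p.2 + Complex.I * t).re = f k p.2 := by rw [add_I_mul_re, f_eq_re]
    have hnH : ‖rootLi k p.2 + Complex.I * t‖ ≤ H := by
      refine (norm_add_le _ _).trans ?_
      have : ‖Complex.I * (t : ℂ)‖ = |t| := by simp
      rw [this]
      linarith
    rw [Complex.div_ofReal_re, hre, norm_div, Complex.norm_real, Real.norm_eq_abs, abs_of_pos hs0]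
    refine ⟨div_pos ((half_pos hpos).trans h2) hs0, ?_, hnH⟩
    rw [← mul_div_assoc]
    gcongr
    refine hnH.trans ?_
    rw [div_mul_eq_mul_div, le_div_iff₀ (half_pos hpos)]
    gcongr
  set b := (f₀ / 2) / H ^ 2 with hb
  have hbpos : 0 < b := by positivity
  have hgoal : Tendsto (fun p : ℕ × ℂ => ∫ v, Set.indicator (Set.Ioc (-√√(p.1 : ℝ)) √√(p.1 : ℝ))
      (saddleIntegrand k θ p) v) l
      (𝓝 (∫ v : ℝ, Complex.exp (regConst ζ x₀) * Complex.exp (-((v ^ 2 : ℝ) : ℂ) / h₀))) := by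
    refine MeasureTheory.tendsto_integral_filter_of_dominated_convergence
      (fun v => Real.exp B * Real.exp (-b * v ^ 2)) ?_ ?_ ?_ ?_
    · filter_upwards [hn1, hxr, hfl] with p h1 h2 h3
      exact (continuous_saddleIntegrand hk (h2.trans hr1) ((half_pos hpos).trans h3) hθ
        h1).aestronglyMeasurable.indicator measurableSet_Ioc
    · filter_upwards [hn1, hxr, hfl, hbound] with p h1 h2 h3 h4
      refine Eventually.of_forall fun v => ?_
      by_cases hv : v ∈ Set.Ioc (-√√(p.1 : ℝ)) √√(p.1 : ℝ)
      · rw [Set.indicator_of_mem hv]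
        have hs0 : 0 < √√(p.1 : ℝ) :=
          Real.sqrt_pos.2 (Real.sqrt_pos.2 (by exact_mod_cast h1))
        have ht : |v / √√(p.1 : ℝ)| ≤ 1 := by
          rw [abs_div, abs_of_pos hs0, div_le_one hs0]
          exact abs_le.2 ⟨hv.1.le, hv.2⟩
        obtain ⟨g1, g2, g3⟩ := h4 _ ht
        rw [saddleIntegrand, sub_eq_add_neg, Complex.exp_add, norm_mul]
        refine mul_le_mul ?_ ?_ (norm_nonneg _) (Real.exp_pos _).le
        · rw [Complex.norm_exp]
          exact Real.exp_le_exp.2 ((Complex.re_le_norm _).trans (hB _ _ h2.le g1 g2))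
        · rw [norm_exp_neg_sq_div]
          refine Real.exp_le_exp.2 ?_
          rw [neg_mul, neg_le_neg_iff, mul_comm]
          refine mul_le_mul_of_nonneg_left ?_ (sq_nonneg v)
          have hz0 : 0 < ‖rootLi k p.2 + Complex.I * ((v / √√(p.1 : ℝ) : ℝ) : ℂ)‖ := by
            refine norm_pos_iff.2 (add_I_mul_ne_zero ?_ _)
            rw [← f_eq_re]
            exact (half_pos hpos).trans h3
          rw [add_I_mul_re, ← f_eq_re, hb]
          have := f_nonneg k p.2
          gcongr
      · rw [Set.indicator_of_notMem hv, norm_zero]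
        positivity
    · exact (integrable_exp_neg_mul_sq hbpos).const_mul _
    · refine Eventually.of_forall fun v => ?_
      have hvs : Tendsto (fun p : ℕ × ℂ => v / √√(p.1 : ℝ)) l (𝓝 0) :=
        tendsto_const_nhds.div_atTop hss
      have hz : Tendsto (fun p : ℕ × ℂ => rootLi k p.2 +
          Complex.I * ((v / √√(p.1 : ℝ) : ℝ) : ℂ)) l (𝓝 h₀) := by
        have := hh.add (((Complex.continuous_ofReal.tendsto 0).comp hvs).const_mul Complex.I)
        simpa [Function.comp_def] using this
      have hsinv : Tendsto (fun p : ℕ × ℂ => (((√(p.1 : ℝ))⁻¹ : ℝ) : ℂ)) l (𝓝 0) := by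
        have := (Complex.continuous_ofReal.tendsto 0).comp (tendsto_inv_atTop_zero.comp hs)
        simpa only [Function.comp_def, Complex.ofReal_zero] using this
      have hw : Tendsto (fun p : ℕ × ℂ => (rootLi k p.2 +
          Complex.I * ((v / √√(p.1 : ℝ) : ℝ) : ℂ)) / (√(p.1 : ℝ) : ℝ)) l (𝓝 0) := by
        have := hz.mul hsinv
        rw [mul_zero] at this
        refine this.congr fun p => ?_
        rw [Complex.ofReal_inv, ← div_eq_mul_inv]
      have hsm : ∀ᶠ p : ℕ × ℂ in l, |v / √√(p.1 : ℝ)| ≤ 1 := by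
        have := hvs.abs.eventually_lt_const (show |(0 : ℝ)| < 1 by simp)
        exact this.mono fun p hp => le_of_lt hp
      have hreg := tendsto_regSum hkpos hζk hx₀ (C := H / (f₀ / 2)) hx hw
        (by filter_upwards [hbound, hsm] with p h1 h2 using (h1 _ h2).1)
        (by filter_upwards [hbound, hsm] with p h1 h2 using (h1 _ h2).2.1)
      have h₀ne : h₀ ≠ 0 := by
        intro h0
        have : f₀ = h₀.re := f_eq_re k x₀
        rw [h0, Complex.zero_re] at this
        linarith
      have hE := (Complex.continuous_exp.tendsto _).comp
        (hreg.sub (tendsto_const_nhds (x := ((v ^ 2 : ℝ) : ℂ)).div hz h₀ne))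
      rw [sub_eq_add_neg, Complex.exp_add, ← neg_div] at hE
      refine hE.congr' ?_
      filter_upwards [hss.eventually_gt_atTop |v|] with p hp
      rw [Set.indicator_of_mem]
      · rfl
      · exact ⟨(abs_lt.1 hp).1, (abs_lt.1 hp).2.le⟩
  rw [saddleConst, ← MeasureTheory.integral_const_mul]
  refine hgoal.congr fun p => ?_
  rw [MeasureTheory.integral_indicator measurableSet_Ioc, intervalIntegral.integral_of_le]
  have := Real.sqrt_nonneg √(p.1 : ℝ)
  linarith

/-- The integral is a Gaussian with parameter `1 / h`, whose real part is positive, so it is a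
square root of `π h`. -/
lemma saddleConst_ne_zero {k : ℕ} {x : ℂ} (hpos : 0 < f k x) (θ : ℝ) : saddleConst k x θ ≠ 0 := by
  rw [saddleConst]
  refine mul_ne_zero (Complex.exp_ne_zero _) ?_
  have hre : 0 < (rootLi k x).re := by rw [← f_eq_re]; exact hpos
  have hne : rootLi k x ≠ 0 := by
    intro h0
    simp [h0] at hre
  have hb : 0 < ((rootLi k x)⁻¹).re := by
    rw [Complex.inv_re]
    exact div_pos hre (Complex.normSq_pos.2 hne)
  have h := integral_gaussian_complex hb
  have e : (fun v : ℝ => Complex.exp (-((v ^ 2 : ℝ) : ℂ) / rootLi k x)) =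
      fun v : ℝ => Complex.exp (-(rootLi k x)⁻¹ * (v : ℂ) ^ 2) := by
    funext v
    congr 1
    push_cast
    field_simp
  rw [e, h]
  have : (Real.pi : ℂ) / (rootLi k x)⁻¹ ≠ 0 :=
    div_ne_zero (by exact_mod_cast Real.pi_ne_zero) (inv_ne_zero hne)
  intro h0
  exact this ((Complex.cpow_eq_zero_iff _ _).1 h0).1

/-- The integrand of the Cauchy integral on the circle through the saddle point. -/
def cauchyIntegrand (k : ℕ) (p : ℕ × ℂ) (φ : ℝ) : ℂ :=
  Complex.exp (lambertSum p.2 (((f k p.2 / √(p.1 : ℝ) : ℝ) : ℂ) + Complex.I * φ) +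
    p.1 * (((f k p.2 / √(p.1 : ℝ) : ℝ) : ℂ) + Complex.I * φ))

/-- The centre of the arc around the saddle point near `θ`. -/
def arcCenter (k : ℕ) (p : ℕ × ℂ) (θ : ℝ) : ℝ := θ + (rootLi k p.2).im / √(p.1 : ℝ)

/-- The substitution `φ = θ + (Im h + v / √s) / s` with `s = √n` has Jacobian `1 / (s √s)`, which
explains the power in the normalizing factor. -/
lemma integral_arc {k : ℕ} (hk : k ≠ 0) {p : ℕ × ℂ} {θ : ℝ} (hx : ‖p.2‖ < 1)
    (hpos : 0 < f k p.2) (hθ : orderOf (Complex.exp (Complex.I * θ)) = k) (hn : 1 ≤ p.1) :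
    ((√(p.1 : ℝ) * √√(p.1 : ℝ) : ℝ) : ℂ) * Complex.exp (-(2 * (√(p.1 : ℝ) : ℝ) * rootLi k p.2)) *
      ∫ φ in (arcCenter k p θ - 1 / √(p.1 : ℝ))..(arcCenter k p θ + 1 / √(p.1 : ℝ)),
        cauchyIntegrand k p φ =
    Complex.exp (Complex.I * (p.1 * θ)) *
      ∫ v in (-√√(p.1 : ℝ))..√√(p.1 : ℝ), saddleIntegrand k θ p v := by
  have hs0 : 0 < √(p.1 : ℝ) := Real.sqrt_pos.2 (by exact_mod_cast hn)
  have hss0 : 0 < √√(p.1 : ℝ) := Real.sqrt_pos.2 hs0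
  set s := √(p.1 : ℝ) with hs
  set c := (s * √s)⁻¹ with hc
  have hc0 : c ≠ 0 := by positivity
  have h1 := intervalIntegral.integral_comp_mul_add (a := -√s) (b := √s) (cauchyIntegrand k p) hc0
    (arcCenter k p θ)
  have e1 : c * -√s + arcCenter k p θ = arcCenter k p θ - 1 / s := by
    rw [hc]; field_simp; ring
  have e2 : c * √s + arcCenter k p θ = arcCenter k p θ + 1 / s := by
    rw [hc]; field_simp; ring
  rw [e1, e2, hc, inv_inv, Complex.real_smul] at h1
  rw [mul_right_comm, ← h1, mul_comm, ← intervalIntegral.integral_const_mul,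
    ← intervalIntegral.integral_const_mul]
  refine intervalIntegral.integral_congr fun v _ => ?_
  have e3 : (s * √s)⁻¹ * v + arcCenter k p θ = θ + ((rootLi k p.2).im + v / √s) / s := by
    rw [arcCenter, ← hs]; field_simp; ring
  simp only [cauchyIntegrand]
  rw [e3, exp_lambertSum_eq hk hx hpos hθ hn, Complex.exp_neg, ← hs]
  field_simp

lemma continuous_cauchyIntegrand {k : ℕ} {p : ℕ × ℂ} (hx : ‖p.2‖ < 1) (hpos : 0 < f k p.2)
    (hn : 1 ≤ p.1) : Continuous (cauchyIntegrand k p) := by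
  have hs0 : 0 < √(p.1 : ℝ) := Real.sqrt_pos.2 (by exact_mod_cast hn)
  exact Complex.continuous_exp.comp
    ((continuous_lambertSum hx (div_pos hpos hs0)).add (by fun_prop))

/-- The arc around the saddle point near `θ`. -/
def arc (k : ℕ) (p : ℕ × ℂ) (θ : ℝ) : Set ℝ :=
  Set.Ioc (arcCenter k p θ - 1 / √(p.1 : ℝ)) (arcCenter k p θ + 1 / √(p.1 : ℝ))

lemma one_le_abs_of_notMem_arc {k : ℕ} {p : ℕ × ℂ} (hn : 1 ≤ p.1) {θ φ : ℝ}
    (h : φ ∉ arc k p θ) : 1 ≤ |√(p.1 : ℝ) * (φ - θ) - (rootLi k p.2).im| := by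
  have hs0 : 0 < √(p.1 : ℝ) := Real.sqrt_pos.2 (by exact_mod_cast hn)
  rw [arc, arcCenter, Set.mem_Ioc, not_and_or, not_lt, not_le] at h
  set s := √(p.1 : ℝ)
  rw [le_abs]
  rcases h with h | h
  · right
    have := mul_le_mul_of_nonneg_left h hs0.le
    have e : s * (θ + (rootLi k p.2).im / s - 1 / s) = s * θ + (rootLi k p.2).im - 1 := by
      field_simp
    rw [e] at this
    linarith
  · left
    have := mul_le_mul_of_nonneg_left h.le hs0.le
    have e : s * (θ + (rootLi k p.2).im / s + 1 / s) = s * θ + (rootLi k p.2).im + 1 := by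
      field_simp
    rw [e] at this
    linarith

/-- The factor that normalizes the size of the partition polynomials. -/
def normalizer (k : ℕ) (p : ℕ × ℂ) : ℂ :=
  ((√(p.1 : ℝ) * √√(p.1 : ℝ) : ℝ) : ℂ) * Complex.exp (-(2 * (√(p.1 : ℝ) : ℝ) * rootLi k p.2))

lemma norm_normalizer (k : ℕ) (p : ℕ × ℂ) : ‖normalizer k p‖ =
    √(p.1 : ℝ) * √√(p.1 : ℝ) * Real.exp (-(2 * √(p.1 : ℝ) * f k p.2)) := by
  rw [normalizer, norm_mul, Complex.norm_real, Real.norm_eq_abs, abs_of_nonneg (by positivity),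
    Complex.norm_exp, Complex.neg_re, f_eq_re,
    show (2 * ((√(p.1 : ℝ) : ℝ) : ℂ) * rootLi k p.2) =
      ((2 * √(p.1 : ℝ) : ℝ) : ℂ) * rootLi k p.2 by push_cast; ring, Complex.re_ofReal_mul]

/-- The circle is cut into disjoint arcs around the saddles of order `k`, each giving one term of
the sum, and a remainder that is exponentially small after normalization. The product filter makes
the asymptotics uniform near `x₀`. -/
theorem tendsto_normalizer_mul_partitionPoly {k : ℕ} (hk : k ≠ 0) {x₀ : ℂ} (hx₀ : ‖x₀‖ < 1)
    (hpos : 0 < f k x₀) {a : ℝ} {Θ : Finset ℝ}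
    (hΘ : ∀ θ ∈ Θ, orderOf (Complex.exp (Complex.I * θ)) = k)
    (hΘ' : ∀ θ ∈ Θ, θ ∈ Set.Ioo a (a + 2 * Real.pi))
    (hdom : ∀ θ ∈ Set.Icc a (a + 2 * Real.pi), θ ∉ Θ →
      orderOf (Complex.exp (Complex.I * θ)) = 0 ∨
      f (orderOf (Complex.exp (Complex.I * θ))) x₀ < f k x₀) :
    Tendsto (fun p : ℕ × ℂ => normalizer k p * (2 * Real.pi * (partitionPoly p.1).eval p.2) -
      ∑ θ ∈ Θ, Complex.exp (Complex.I * (p.1 * θ)) * saddleConst k x₀ θ)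
      (atTop ×ˢ 𝓝 x₀) (𝓝 0) := by
  set l : Filter (ℕ × ℂ) := atTop ×ˢ 𝓝 x₀ with hl
  have hs : Tendsto (fun p : ℕ × ℂ => √(p.1 : ℝ)) l atTop := tendsto_sqrt_natCast_fst
  have hx : Tendsto (fun p : ℕ × ℂ => p.2) l (𝓝 x₀) := tendsto_snd
  have hf : Tendsto (fun p : ℕ × ℂ => f k p.2) l (𝓝 (f k x₀)) :=
    (continuousAt_f hk hx₀).tendsto.comp hx
  have hh : Tendsto (fun p : ℕ × ℂ => rootLi k p.2) l (𝓝 (rootLi k x₀)) :=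
    (differentiableAt_rootLi hk hx₀ hpos).continuousAt.tendsto.comp hx
  have hn1 : ∀ᶠ p : ℕ × ℂ in l, 1 ≤ p.1 := tendsto_fst.eventually (eventually_ge_atTop 1)
  have hx1 : ∀ᶠ p : ℕ × ℂ in l, ‖p.2‖ < 1 := hx.norm.eventually_lt_const hx₀
  have hfpos : ∀ᶠ p : ℕ × ℂ in l, 0 < f k p.2 := hf.eventually_const_lt hpos
  obtain ⟨δ, hδ, hminor⟩ :=
    exists_eventually_forall_re_lambertSum_le hk hx₀ hpos hΘ hdom one_pos
  have hfδ : ∀ᶠ p : ℕ × ℂ in l, f k x₀ - δ / 2 < f k p.2 :=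
    hf.eventually_const_lt (by linarith)
  have hinv : Tendsto (fun p : ℕ × ℂ => 1 / √(p.1 : ℝ)) l (𝓝 0) :=
    tendsto_const_nhds.div_atTop hs
  have hcen : ∀ θ : ℝ, Tendsto (fun p : ℕ × ℂ => arcCenter k p θ) l (𝓝 θ) := by
    intro θ
    have h1 : Tendsto (fun p : ℕ × ℂ => (rootLi k p.2).im / √(p.1 : ℝ)) l (𝓝 0) :=
      ((Complex.continuous_im.tendsto _).comp hh).div_atTop hs
    simpa [arcCenter] using h1.const_add θ
  have hsub : ∀ᶠ p : ℕ × ℂ in l, ∀ θ ∈ Θ, arc k p θ ⊆ Set.Ioc a (a + 2 * Real.pi) := by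
    rw [Filter.eventually_all_finset]
    intro θ hθ
    have h1 := ((hcen θ).sub hinv).eventually_const_lt (show a < θ - 0 by linarith [(hΘ' θ hθ).1])
    have h2 := ((hcen θ).add hinv).eventually_lt_const
      (show θ + 0 < a + 2 * Real.pi by linarith [(hΘ' θ hθ).2])
    filter_upwards [h1, h2] with p g1 g2
    exact Set.Ioc_subset_Ioc g1.le g2.le
  have hdisj : ∀ᶠ p : ℕ × ℂ in l, ∀ θ ∈ Θ, ∀ θ' ∈ Θ, θ ≠ θ' →
      Disjoint (arc k p θ) (arc k p θ') := by
    rw [Filter.eventually_all_finset]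
    intro θ _
    rw [Filter.eventually_all_finset]
    intro θ' _
    rcases eq_or_ne θ θ' with h | h
    · exact Eventually.of_forall fun p hne => absurd h hne
    rcases lt_or_gt_of_ne h with hlt | hlt
    · have h1 := (((hcen θ).add hinv).sub ((hcen θ').sub hinv)).eventually_lt_const
        (show θ + 0 - (θ' - 0) < 0 by linarith)
      filter_upwards [h1] with p hp _
      refine Set.disjoint_left.2 fun φ g1 g2 => ?_
      linarith [g1.2, g2.1]
    · have h1 := (((hcen θ').add hinv).sub ((hcen θ).sub hinv)).eventually_lt_const
        (show θ' + 0 - (θ - 0) < 0 by linarith)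
      filter_upwards [h1] with p hp _
      refine Set.disjoint_left.2 fun φ g1 g2 => ?_
      linarith [g1.1, g2.2]
  set U : ℕ × ℂ → Set ℝ := fun p => ⋃ θ ∈ Θ, arc k p θ with hU
  set R : ℕ × ℂ → ℂ := fun p =>
    ∫ φ in Set.Ioc a (a + 2 * Real.pi) \ U p, cauchyIntegrand k p φ with hR
  set J : ℝ → ℕ × ℂ → ℂ := fun θ p =>
    ∫ v in (-√√(p.1 : ℝ))..√√(p.1 : ℝ), saddleIntegrand k θ p v with hJ
  have hsplit : ∀ᶠ p : ℕ × ℂ in l,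
      (∑ θ ∈ Θ, Complex.exp (Complex.I * (p.1 * θ)) * (J θ p - saddleConst k x₀ θ)) +
        normalizer k p * R p =
      normalizer k p * (2 * Real.pi * (partitionPoly p.1).eval p.2) -
        ∑ θ ∈ Θ, Complex.exp (Complex.I * (p.1 * θ)) * saddleConst k x₀ θ := by
    filter_upwards [hn1, hx1, hfpos, hsub, hdisj] with p h1 h2 h3 h4 h5
    have hs0 : 0 < √(p.1 : ℝ) := Real.sqrt_pos.2 (by exact_mod_cast h1)
    have hcont := continuous_cauchyIntegrand h2 h3 h1
    have hint : ∀ c d : ℝ, MeasureTheory.IntegrableOn (cauchyIntegrand k p) (Set.Ioc c d) :=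
      fun c d => (hcont.integrableOn_Icc).mono_set Set.Ioc_subset_Icc_self
    have hUm : MeasurableSet (U p) := Finset.measurableSet_biUnion _ fun θ _ => measurableSet_Ioc
    have hUs : U p ⊆ Set.Ioc a (a + 2 * Real.pi) := Set.iUnion₂_subset h4
    have hF : 2 * Real.pi * (partitionPoly p.1).eval p.2 =
        ∑ θ ∈ Θ, (∫ φ in arc k p θ, cauchyIntegrand k p φ) + R p := by
      rw [partitionPoly_eval_eq_integral h2 h1 (div_pos h3 hs0) a,
        intervalIntegral.integral_of_le (by linarith [Real.pi_pos])]
      have e1 := MeasureTheory.setIntegral_sdiff hUm (hint a (a + 2 * Real.pi)) hUs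
      have e2 := MeasureTheory.integral_biUnion_finset (μ := MeasureTheory.volume)
        (f := cauchyIntegrand k p) Θ (s := fun θ => arc k p θ) (fun θ _ => measurableSet_Ioc)
        (fun θ hθ θ' hθ' hne => h5 θ hθ θ' hθ' hne) (fun θ _ => hint _ _)
      rw [← e2]
      simp only [hR]
      rw [e1]
      change ∫ φ in Set.Ioc a (a + 2 * Real.pi), cauchyIntegrand k p φ = _
      ring
    have hA : ∀ θ ∈ Θ, normalizer k p * ∫ φ in arc k p θ, cauchyIntegrand k p φ =
        Complex.exp (Complex.I * (p.1 * θ)) * J θ p := by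
      intro θ hθ
      have := integral_arc hk h2 h3 (hΘ θ hθ) h1
      rw [intervalIntegral.integral_of_le (by
        have : 0 < 1 / √(p.1 : ℝ) := by positivity
        linarith)] at this
      exact this
    rw [hF, mul_add, Finset.mul_sum, Finset.sum_congr rfl hA]
    simp only [mul_sub, Finset.sum_sub_distrib]
    ring
  refine Tendsto.congr' hsplit ?_
  have hmaj : Tendsto (fun p : ℕ × ℂ =>
      ∑ θ ∈ Θ, Complex.exp (Complex.I * (p.1 * θ)) * (J θ p - saddleConst k x₀ θ)) l (𝓝 0) := by
    rw [← Finset.sum_const_zero (s := Θ)]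
    refine tendsto_finsetSum _ fun θ hθ => ?_
    have h1 := tendsto_integral_saddleIntegrand hk hx₀ hpos (hΘ θ hθ)
    rw [tendsto_iff_norm_sub_tendsto_zero] at h1
    refine squeeze_zero_norm (fun p => ?_) h1
    rw [norm_mul]
    have : ‖Complex.exp (Complex.I * (p.1 * θ))‖ = 1 := by
      have := norm_exp_I_mul (p.1 * θ)
      push_cast at this
      exact this
    rw [this, one_mul]
  have hmin : Tendsto (fun p : ℕ × ℂ => normalizer k p * R p) l (𝓝 0) := by
    have hlim : Tendsto (fun p : ℕ × ℂ => 2 * Real.pi *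
        ((√(p.1 : ℝ)) ^ (2 : ℝ) * Real.exp (-(δ / 2) * √(p.1 : ℝ)))) l (𝓝 0) := by
      have := ((tendsto_rpow_mul_exp_neg_mul_atTop_nhds_zero 2 (δ / 2) (half_pos hδ)).comp
        hs).const_mul (2 * Real.pi)
      simpa [Function.comp_def] using this
    refine squeeze_zero_norm' ?_ hlim
    filter_upwards [hn1, hfδ, hminor] with p h1 h3 h4
    have hs1 : 1 ≤ √(p.1 : ℝ) := Real.one_le_sqrt.2 (by exact_mod_cast h1)
    set s := √(p.1 : ℝ) with hsdef
    have hs0 : 0 < s := by linarith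
    have hRb : ‖R p‖ ≤ Real.exp ((f k x₀ - δ) * s + f k p.2 * s) * (2 * Real.pi) := by
      have hvol : (MeasureTheory.volume (Set.Ioc a (a + 2 * Real.pi) \ U p)).toReal ≤
          2 * Real.pi := by
        have h5 := MeasureTheory.measure_mono (μ := MeasureTheory.volume)
          (Set.sdiff_subset (s := Set.Ioc a (a + 2 * Real.pi)) (t := U p))
        rw [Real.volume_Ioc] at h5
        have := ENNReal.toReal_mono ENNReal.ofReal_ne_top h5
        rwa [ENNReal.toReal_ofReal (by linarith [Real.pi_pos]), add_sub_cancel_left] at this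
      have hfin : MeasureTheory.volume (Set.Ioc a (a + 2 * Real.pi) \ U p) < ⊤ :=
        (MeasureTheory.measure_mono Set.sdiff_subset).trans_lt
          (by rw [Real.volume_Ioc]; exact ENNReal.ofReal_lt_top)
      refine (MeasureTheory.norm_setIntegral_le_of_norm_le_const hfin fun φ hφ => ?_).trans
        (mul_le_mul_of_nonneg_left hvol (Real.exp_pos _).le)
      rw [cauchyIntegrand, Complex.norm_exp, Complex.add_re]
      refine Real.exp_le_exp.2 (add_le_add (h4 φ ⟨hφ.1.1.le, hφ.1.2⟩ fun θ hθ => ?_) (le_of_eq ?_))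
      · exact one_le_abs_of_notMem_arc h1 fun hmem => hφ.2 (Set.mem_iUnion₂.2 ⟨θ, hθ, hmem⟩)
      · rw [← Complex.ofReal_natCast, Complex.re_ofReal_mul, Complex.add_re, Complex.ofReal_re,
          mul_comm Complex.I, Complex.re_ofReal_mul, Complex.I_re, mul_zero, add_zero]
        have : (p.1 : ℝ) = s ^ 2 := (Real.sq_sqrt (Nat.cast_nonneg _)).symm
        rw [this, Real.sqrt_sq hs0.le]
        field_simp
    rw [norm_mul, norm_normalizer, ← hsdef]
    have hss : √s ≤ s := Real.sqrt_le_self_iff.2 (Or.inr hs1)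
    calc s * √s * Real.exp (-(2 * s * f k p.2)) * ‖R p‖
        ≤ s * s * Real.exp (-(2 * s * f k p.2)) *
          (Real.exp ((f k x₀ - δ) * s + f k p.2 * s) * (2 * Real.pi)) := by gcongr
      _ = 2 * Real.pi * (s ^ (2 : ℝ) *
          Real.exp (-(2 * s * f k p.2) + ((f k x₀ - δ) * s + f k p.2 * s))) := by
          rw [Real.exp_add (-(2 * s * f k p.2)), Real.rpow_two]
          ring
      _ ≤ _ := by
          -- After normalization the exponent is `(f_k(x₀) - δ - f_k(x)) √n ≤ -(δ / 2) √n`, by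
          -- continuity of `f_k`.
          gcongr
          nlinarith
  simpa using hmaj.add hmin

/-! ### Harmonic functions: Harnack's inequality, limits and mean values. -/

open InnerProductSpace

/-- A form of Harnack's inequality for nonnegative harmonic functions on a disk. -/
lemma abs_sub_le_of_harmonicOnNhd_of_nonneg {v : ℂ → ℝ} {c : ℂ} {R : ℝ}
    (hv : HarmonicOnNhd v (ball c R)) (h0 : ∀ x ∈ ball c R, 0 ≤ v x) {z : ℂ} (hz : z ∈ ball c R) :
    |v z - v c| ≤ 2 * v c * ‖z - c‖ / (R - ‖z - c‖) := by
  have hR : 0 < R := pos_of_mem_ball hz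
  have hz' : ‖z - c‖ < R := by rwa [← dist_eq_norm]
  obtain ⟨V, hV, hVre⟩ := hv.exists_analyticOnNhd_ball_re_eq
  have hmem : ∀ w ∈ ball (0 : ℂ) R, c + w ∈ ball c R := fun w hw => by
    simpa [dist_eq_norm] using hw
  have hdiff : DifferentiableOn ℂ (fun w => V c - V (c + w)) (ball 0 R) := by
    refine (differentiableOn_const _).sub ?_
    exact hV.differentiableOn.comp (by fun_prop) hmem
  have hcre : (V c).re = v c := hVre (mem_ball_self hR)
  -- Borel–Carathéodory is applied to `V(c) - V(c + w)`, which vanishes at `0` and has real part at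
  -- most `v c`. It needs a positive bound, and `v c` may be zero, hence the `η`.
  have key : ∀ η > 0, |v z - v c| ≤ 2 * (v c + η) * ‖z - c‖ / (R - ‖z - c‖) := by
    intro η hη
    have hM : 0 < v c + η := add_pos_of_nonneg_of_pos (h0 c (mem_ball_self hR)) hη
    have hmap : Set.MapsTo (fun w => V c - V (c + w)) (ball 0 R) {z | z.re ≤ v c + η} := by
      intro w hw
      have h1 : (V (c + w)).re = v (c + w) := hVre (hmem w hw)
      have h2 := h0 _ (hmem w hw)
      simp only [Set.mem_ofPred_eq, Complex.sub_re, h1, hcre]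
      linarith
    have h := Complex.borelCaratheodory_zero hM hdiff hmap hR
      (z := z - c) (by simpa using hz') (by simp)
    refine le_trans ?_ h
    have h1 : (V z).re = v z := hVre hz
    simp only [add_sub_cancel]
    rw [abs_sub_comm, ← hcre, ← h1, ← Complex.sub_re]
    exact Complex.abs_re_le_norm _
  have hlim : Tendsto (fun η : ℝ => 2 * (v c + η) * ‖z - c‖ / (R - ‖z - c‖)) (𝓝[>] 0)
      (𝓝 (2 * (v c + 0) * ‖z - c‖ / (R - ‖z - c‖))) := by
    refine Tendsto.mono_left (Continuous.tendsto ?_ _) nhdsWithin_le_nhds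
    fun_prop
  rw [add_zero] at hlim
  exact ge_of_tendsto hlim (eventually_mem_nhdsWithin.mono key)

/-- Harnack bounds the oscillation between `y` and a nearby `w` by a multiple of `‖y - w‖`,
uniformly in `n`. So convergence at points `w` arbitrarily close to `y` forces convergence at `y`.
-/
lemma tendsto_of_harmonicOnNhd_of_nonneg {l : Filter ℕ} {v : ℕ → ℂ → ℝ} {m : ℂ → ℝ} {x₀ : ℂ}
    {ρ : ℝ} (hv : ∀ᶠ n in l, HarmonicOnNhd (v n) (ball x₀ ρ))
    (h0 : ∀ᶠ n in l, ∀ x ∈ ball x₀ ρ, 0 ≤ v n x) (hm : ContinuousOn m (ball x₀ ρ))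
    (hd : ∀ y ∈ ball x₀ ρ, ∃ᶠ w in 𝓝 y, Tendsto (fun n => v n w) l (𝓝 (m w)))
    {y : ℂ} (hy : y ∈ ball x₀ ρ) : Tendsto (fun n => v n y) l (𝓝 (m y)) := by
  obtain ⟨R, hR, hRsub⟩ := Metric.isOpen_iff.1 isOpen_ball y hy
  have hmy : ContinuousAt m y := hm.continuousAt (isOpen_ball.mem_nhds hy)
  rw [Metric.tendsto_nhds]
  intro ε hε
  have hsmall : Tendsto (fun w => 2 * (m w + 1) * ‖y - w‖ / (R / 2 - ‖y - w‖)) (𝓝 y)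
      (𝓝 (2 * (m y + 1) * ‖y - y‖ / (R / 2 - ‖y - y‖))) := by
    have h1 : Tendsto (fun w => ‖y - w‖) (𝓝 y) (𝓝 ‖y - y‖) :=
      (tendsto_const_nhds.sub tendsto_id).norm
    refine (((hmy.tendsto.add_const 1).const_mul 2).mul h1).div (h1.const_sub _) ?_
    simpa using hR.ne'
  rw [sub_self, norm_zero, mul_zero, zero_div] at hsmall
  obtain ⟨w, hw, hw1, hw2, hw3⟩ := ((hd y hy).and_eventually
    ((hsmall.eventually_lt_const (show (0 : ℝ) < ε / 3 by positivity)).and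
      ((Metric.tendsto_nhds.1 hmy.tendsto (ε / 3) (by positivity)).and
        (ball_mem_nhds y (half_pos hR))))).exists
  have hwR : ball w (R / 2) ⊆ ball x₀ ρ := fun z hz => hRsub <| by
    change dist w y < R / 2 at hw3
    rw [mem_ball] at hz ⊢
    linarith [dist_triangle z w y]
  have hyw : y ∈ ball w (R / 2) := by rwa [mem_ball_comm]
  filter_upwards [hv, h0, Metric.tendsto_nhds.1 hw (ε / 3) (by positivity),
    hw.eventually_lt_const (lt_add_one (m w))] with n h1 h2 h3 h4
  have h5 := abs_sub_le_of_harmonicOnNhd_of_nonneg (h1.mono hwR) (fun x hx => h2 x (hwR hx)) hyw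
  have hden : 0 < R / 2 - ‖y - w‖ := by
    rw [mem_ball, dist_eq_norm] at hyw
    linarith
  have h6 : 2 * v n w * ‖y - w‖ / (R / 2 - ‖y - w‖) ≤
      2 * (m w + 1) * ‖y - w‖ / (R / 2 - ‖y - w‖) := by gcongr
  rw [Real.dist_eq] at h3 hw2 ⊢
  calc |v n y - m y| = |(v n y - v n w) + (v n w - m w) + (m w - m y)| := by congr 1; ring
    _ ≤ |v n y - v n w| + |v n w - m w| + |m w - m y| := abs_add_three _ _ _
    _ < ε := by linarith

/-- The functions `C - u_n` are nonnegative and harmonic, so they converge everywhere and Harnack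
bounds them on the circle by their value at the centre. The mean value property then survives by
dominated convergence. -/
theorem circleAverage_eq_of_tendsto {l : Filter ℕ} [l.NeBot] [l.IsCountablyGenerated]
    {u : ℕ → ℂ → ℝ} {m : ℂ → ℝ} {x₀ : ℂ} {ρ C : ℝ}
    (hu : ∀ᶠ n in l, HarmonicOnNhd (u n) (ball x₀ ρ))
    (hC : ∀ᶠ n in l, ∀ x ∈ ball x₀ ρ, u n x ≤ C) (hm : ContinuousOn m (ball x₀ ρ))
    (hd : ∀ y ∈ ball x₀ ρ, ∃ᶠ w in 𝓝 y, Tendsto (fun n => u n w) l (𝓝 (m w)))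
    {r : ℝ} (hr : 0 < r) (hrρ : r < ρ) : Real.circleAverage m x₀ r = m x₀ := by
  have hx₀ : x₀ ∈ ball x₀ ρ := mem_ball_self (hr.trans hrρ)
  have hv : ∀ᶠ n in l, HarmonicOnNhd (fun x => C - u n x) (ball x₀ ρ) := by
    filter_upwards [hu] with n hn x hx
    exact (harmonicAt_const C).sub (hn x hx)
  have h0 : ∀ᶠ n in l, ∀ x ∈ ball x₀ ρ, 0 ≤ C - u n x := by
    filter_upwards [hC] with n hn x hx
    exact sub_nonneg.2 (hn x hx)
  have hlimv : ∀ y ∈ ball x₀ ρ, Tendsto (fun n => C - u n y) l (𝓝 (C - m y)) := fun y hy =>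
    tendsto_of_harmonicOnNhd_of_nonneg (m := fun x => C - m x) hv h0
      (continuousOn_const.sub hm) (fun y hy => (hd y hy).mono fun w hw => hw.const_sub C) hy
  have hsph : ∀ θ : ℝ, circleMap x₀ r θ ∈ ball x₀ ρ := fun θ => by
    rw [mem_ball, dist_eq_norm, circleMap_sub_center]
    simpa [abs_of_pos hr] using hrρ
  have hcl : closedBall x₀ |r| ⊆ ball x₀ ρ := by
    rw [abs_of_pos hr]
    exact closedBall_subset_ball hrρ
  set B := (C - m x₀ + 1) + 2 * (C - m x₀ + 1) * r / (ρ - r) with hB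
  have hdom : Tendsto (fun n => ∫ θ in (0 : ℝ)..2 * Real.pi, (C - u n (circleMap x₀ r θ))) l
      (𝓝 (∫ θ in (0 : ℝ)..2 * Real.pi, (C - m (circleMap x₀ r θ)))) := by
    refine intervalIntegral.tendsto_integral_filter_of_dominated_convergence (fun _ => B) ?_ ?_
      intervalIntegrable_const (Eventually.of_forall fun θ _ => hlimv _ (hsph θ))
    · filter_upwards [hv] with n hn
      refine Continuous.aestronglyMeasurable ?_
      refine continuous_iff_continuousAt.2 fun θ => ?_
      exact ContinuousAt.comp (f := circleMap x₀ r) (g := fun x => C - u n x)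
        (hn _ (hsph θ)).1.continuousAt (continuous_circleMap _ _).continuousAt
    · filter_upwards [hv, h0, (hlimv x₀ hx₀).eventually_lt_const (lt_add_one (C - m x₀))]
        with n h1 h2 h3
      refine Eventually.of_forall fun θ _ => ?_
      have h5 := abs_sub_le_of_harmonicOnNhd_of_nonneg h1 h2 (hsph θ)
      have e : ‖circleMap x₀ r θ - x₀‖ = r := by
        rw [circleMap_sub_center]; simp [abs_of_pos hr]
      rw [e] at h5
      have h6 : 2 * (C - u n x₀) * r / (ρ - r) ≤ 2 * (C - m x₀ + 1) * r / (ρ - r) := by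
        have : 0 < ρ - r := by linarith
        gcongr
      rw [Real.norm_eq_abs, abs_of_nonneg (h2 _ (hsph θ))]
      have := (abs_le.1 h5).2
      linarith
  have havg : ∀ᶠ n in l, (2 * Real.pi)⁻¹ •
      ∫ θ in (0 : ℝ)..2 * Real.pi, (C - u n (circleMap x₀ r θ)) = C - u n x₀ := by
    filter_upwards [hv] with n hn
    exact InnerProductSpace.HarmonicOnNhd.circleAverage_eq (hn.mono hcl)
  have h1 : Real.circleAverage (fun x => C - m x) x₀ r = C - m x₀ :=
    tendsto_nhds_unique (hdom.const_smul (2 * Real.pi)⁻¹) ((hlimv x₀ hx₀).congr' (havg.mono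
      fun n hn => hn.symm))
  have hci : CircleIntegrable m x₀ r :=
    (hm.mono (sphere_subset_closedBall.trans hcl)).circleIntegrable'
  have h2 := Real.circleAverage_fun_sub (circleIntegrable_const C x₀ r) hci
  rw [h1, Real.circleAverage_const] at h2
  linarith

/-- A nonnegative continuous function with mean value zero on all small circles vanishes
near the centre. -/
lemma eq_zero_of_circleAverage_eq_zero {g : ℂ → ℝ} {x₀ : ℂ} {ρ : ℝ}
    (hg : ContinuousOn g (ball x₀ ρ)) (h0 : ∀ x ∈ ball x₀ ρ, 0 ≤ g x)
    (hx₀ : g x₀ = 0)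
    (h : ∀ r, 0 < r → r < ρ → Real.circleAverage g x₀ r = 0) {x : ℂ} (hx : x ∈ ball x₀ ρ) :
    g x = 0 := by
  rcases eq_or_ne x x₀ with rfl | hne
  · exact hx₀
  set r := dist x x₀ with hr
  have hr0 : 0 < r := dist_pos.2 hne
  have hrρ : r < ρ := hx
  have hsph : ∀ θ : ℝ, circleMap x₀ r θ ∈ ball x₀ ρ := fun θ => by
    rw [mem_ball, dist_eq_norm, circleMap_sub_center]
    simpa [abs_of_pos hr0] using hrρ
  have hcont : Continuous fun θ => g (circleMap x₀ r θ) :=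
    hg.comp_continuous (continuous_circleMap _ _) hsph
  obtain ⟨θ, hθ, hθx⟩ : ∃ θ ∈ Set.Icc (0 : ℝ) (2 * Real.pi), circleMap x₀ r θ = x := by
    have hmem : x ∈ sphere x₀ |r| := by rw [abs_of_pos hr0]; exact hr.symm
    rw [← image_circleMap_Ioc] at hmem
    obtain ⟨θ, hθ, e⟩ := hmem
    exact ⟨θ, ⟨hθ.1.le, hθ.2⟩, e⟩
  by_contra hgx
  have hpos : 0 < g x := lt_of_le_of_ne (h0 x hx) (Ne.symm hgx)
  have hint : 0 < ∫ θ in (0 : ℝ)..2 * Real.pi, g (circleMap x₀ r θ) :=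
    intervalIntegral.integral_pos Real.two_pi_pos hcont.continuousOn
      (fun t _ => h0 _ (hsph t)) ⟨θ, hθ, by rwa [hθx]⟩
  have h1 := h r hr0 hrρ
  rw [Real.circleAverage_def, smul_eq_mul] at h1
  have : 0 < (2 * Real.pi)⁻¹ := by positivity
  exact absurd h1 (mul_pos this hint).ne'

/-! ### Roots of unity of order at most three and strict dominance. -/

/-- The arguments in `(-π/3, 5π/3)` of the primitive `k`-th roots of unity, for `k = 1, 2, 3`. -/
def angles (k : ℕ) : Finset ℝ :=
  if k = 1 then {0} else if k = 2 then {Real.pi} else {2 * Real.pi / 3, 4 * Real.pi / 3}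

lemma exp_I_mul_eq_one_iff {θ : ℝ} :
    Complex.exp (Complex.I * θ) = 1 ↔ ∃ n : ℤ, θ = n * (2 * Real.pi) := by
  rw [Complex.exp_eq_one_iff]
  refine exists_congr fun n => ?_
  rw [show (n : ℂ) * (2 * Real.pi * Complex.I) = Complex.I * ((n * (2 * Real.pi) : ℝ) : ℂ) by
    push_cast; ring, mul_right_inj' Complex.I_ne_zero, Complex.ofReal_inj]

lemma exp_I_mul_pow (θ : ℝ) (k : ℕ) :
    Complex.exp (Complex.I * θ) ^ k = Complex.exp (Complex.I * ((k * θ : ℝ) : ℂ)) := by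
  rw [← Complex.exp_nat_mul]
  push_cast
  ring_nf

lemma orderOf_exp_third {θ : ℝ} {m : ℤ} (hθ : 3 * θ = m * (2 * Real.pi)) (hm : ¬ (3 : ℤ) ∣ m) :
    orderOf (Complex.exp (Complex.I * θ)) = 3 := by
  have : Fact (Nat.Prime 3) := ⟨Nat.prime_three⟩
  refine orderOf_eq_prime ?_ ?_
  · rw [exp_I_mul_pow, exp_I_mul_eq_one_iff]
    exact ⟨m, by push_cast; exact hθ⟩
  · rw [Ne, exp_I_mul_eq_one_iff]
    rintro ⟨n, hn⟩
    refine hm ⟨n, ?_⟩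
    have h2 : (2 * Real.pi) ≠ 0 := by positivity
    have : (m : ℝ) = ((3 * n : ℤ) : ℝ) := by
      apply mul_right_cancel₀ h2
      rw [← hθ, hn]
      push_cast
      ring
    exact_mod_cast this

lemma orderOf_of_mem_angles {k : ℕ} (hk : k ∈ Finset.Icc 1 3) {θ : ℝ} (hθ : θ ∈ angles k) :
    orderOf (Complex.exp (Complex.I * θ)) = k := by
  rw [Finset.mem_Icc] at hk
  obtain ⟨h1, h3⟩ := hk
  interval_cases k
  · simp only [angles, if_true, Finset.mem_singleton] at hθ
    simp [hθ]
  · simp only [angles, OfNat.ofNat_ne_one, if_false, if_true, Finset.mem_singleton] at hθ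
    rw [hθ, mul_comm, Complex.exp_pi_mul_I]
    have : Fact (Nat.Prime 2) := ⟨Nat.prime_two⟩
    exact orderOf_eq_prime (by norm_num) (by norm_num)
  · simp only [angles, OfNat.ofNat_ne_one, Nat.succ_ne_self, if_false,
      Finset.mem_insert, Finset.mem_singleton] at hθ
    rcases hθ with rfl | rfl
    · exact orderOf_exp_third (m := 1) (by push_cast; ring) (by norm_num)
    · exact orderOf_exp_third (m := 2) (by push_cast; ring) (by norm_num)

lemma mem_angles_of_orderOf {k : ℕ} (hk : k ∈ Finset.Icc 1 3) {θ : ℝ}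
    (hmem : θ ∈ Set.Icc (-Real.pi / 3) (-Real.pi / 3 + 2 * Real.pi))
    (hθ : orderOf (Complex.exp (Complex.I * θ)) = k) : θ ∈ angles k := by
  rw [Finset.mem_Icc] at hk
  obtain ⟨h1, h3⟩ := hk
  have hpi := Real.pi_pos
  obtain ⟨n, hn⟩ : ∃ n : ℤ, (k * θ : ℝ) = n * (2 * Real.pi) := by
    rw [← exp_I_mul_eq_one_iff, ← exp_I_mul_pow, ← hθ, pow_orderOf_eq_one]
  have hne : θ = 0 → k = 1 := by
    rintro rfl
    rw [← hθ]
    simp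
  have hlo : -(k : ℝ) / 6 ≤ n := by
    have h := mul_le_mul_of_nonneg_left hmem.1 (Nat.cast_nonneg (α := ℝ) k)
    rw [hn] at h
    refine le_of_mul_le_mul_right ?_ hpi
    linarith
  have hhi : (n : ℝ) ≤ 5 * k / 6 := by
    have h := mul_le_mul_of_nonneg_left hmem.2 (Nat.cast_nonneg (α := ℝ) k)
    rw [hn] at h
    refine le_of_mul_le_mul_right ?_ hpi
    linarith
  have hn0 : 0 ≤ n := by
    by_contra hlt
    have : (n : ℝ) ≤ -1 := by exact_mod_cast (by omega : n ≤ -1)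
    have : (k : ℝ) ≤ 3 := by exact_mod_cast h3
    linarith
  have hn2 : n < k := by
    have : (n : ℝ) < k := by
      have : (1 : ℝ) ≤ k := by exact_mod_cast h1
      linarith
    exact_mod_cast this
  interval_cases k
  · obtain rfl : n = 0 := by omega
    simp only [angles, if_true, Finset.mem_singleton]
    simpa using hn
  · have : n ≠ 0 := by
      rintro rfl
      simp at hn
      exact absurd (hne hn) (by norm_num)
    obtain rfl : n = 1 := by omega
    simp only [angles, OfNat.ofNat_ne_one, if_false, if_true, Finset.mem_singleton]
    push_cast at hn
    linarith
  · have : n ≠ 0 := by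
      rintro rfl
      simp at hn
      exact absurd (hne hn) (by norm_num)
    have h12 : n = 1 ∨ n = 2 := by omega
    have e : angles 3 = {2 * Real.pi / 3, 4 * Real.pi / 3} := by norm_num [angles]
    rw [e, Finset.mem_insert, Finset.mem_singleton]
    push_cast at hn
    rcases h12 with rfl | rfl
    · left
      push_cast at hn
      linarith
    · right
      push_cast at hn
      linarith

/-- The period starts at `-π/3`, where the exponential has order six, so no saddle sits at an
endpoint. -/
lemma angles_mem_Ioo {k : ℕ} {θ : ℝ} (hθ : θ ∈ angles k) :
    θ ∈ Set.Ioo (-Real.pi / 3) (-Real.pi / 3 + 2 * Real.pi) := by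
  have hpi := Real.pi_pos
  rw [angles] at hθ
  split_ifs at hθ <;> simp only [Finset.mem_insert, Finset.mem_singleton] at hθ
  · subst hθ
    constructor <;> linarith
  · subst hθ
    constructor <;> linarith
  · rcases hθ with rfl | rfl <;> constructor <;> linarith

/-- `f k` strictly dominates at `x` among the three functions `f 1, f 2, f 3`. -/
def Dominates (k : ℕ) (x : ℂ) : Prop := ∀ j ∈ Finset.Icc 1 3, j ≠ k → f j x < f k x

lemma Dominates.pos {k : ℕ} {x : ℂ} (h : Dominates k x) : 0 < f k x := by
  rcases eq_or_ne k 1 with rfl | hk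
  · exact (f_nonneg 2 x).trans_lt (h 2 (by simp) (by norm_num))
  · exact (f_nonneg 1 x).trans_lt (h 1 (by simp) hk.symm)

lemma f_zero_right {k : ℕ} (hk : k ≠ 0) : f k 0 = 0 := by
  simp [f, hk, dilog_zero]

/-- Dominance over the orders up to three implies dominance over all orders, by `f_lt_max`. -/
lemma Dominates.f_lt {k : ℕ} {x : ℂ} (hk : k ∈ Finset.Icc 1 3) (h : Dominates k x) (hx : ‖x‖ < 1)
    {l : ℕ} (hl : l ≠ 0) (hlk : l ≠ k) : f l x < f k x := by
  rcases le_or_gt l 3 with h3 | h3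
  · exact h l (Finset.mem_Icc.2 ⟨Nat.pos_of_ne_zero hl, h3⟩) hlk
  have hk0 : k ≠ 0 := by
    rw [Finset.mem_Icc] at hk
    omega
  have hx0 : x ≠ 0 := by
    rintro rfl
    have := h.pos
    rw [f_zero_right hk0] at this
    exact this.false
  refine (f_lt_max hx hx0 h3).trans_le (max_le ?_ ?_)
  · rcases eq_or_ne k 1 with rfl | hne
    · exact le_rfl
    · exact (h 1 (by simp) hne.symm).le
  · rcases eq_or_ne k 2 with rfl | hne
    · exact le_rfl
    · exact (h 2 (by simp) hne.symm).le

lemma Dominates.tendsto {k : ℕ} {x₀ : ℂ} (hk : k ∈ Finset.Icc 1 3) (h : Dominates k x₀)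
    (hx₀ : ‖x₀‖ < 1) :
    Tendsto (fun p : ℕ × ℂ => normalizer k p * (2 * Real.pi * (partitionPoly p.1).eval p.2) -
      ∑ θ ∈ angles k, Complex.exp (Complex.I * (p.1 * θ)) * saddleConst k x₀ θ)
      (atTop ×ˢ 𝓝 x₀) (𝓝 0) := by
  refine tendsto_normalizer_mul_partitionPoly (a := -Real.pi / 3) ?_ hx₀ h.pos
    (fun θ hθ => orderOf_of_mem_angles hk hθ) (fun θ hθ => angles_mem_Ioo hθ) fun θ hθ hn => ?_
  · rw [Finset.mem_Icc] at hk
    omega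
  · by_cases h0 : orderOf (Complex.exp (Complex.I * θ)) = 0
    · exact Or.inl h0
    · exact Or.inr (h.f_lt hk hx₀ h0 fun e => hn (mem_angles_of_orderOf hk hθ e))

/-! ### Nonvanishing of the leading term. -/

lemma regKernelLim_eq {q : ℂ} (hq : q ^ 3 = 1) : regKernelLim q = -1 / 2 + (q ^ 2 - q) / 6 := by
  rw [regKernelLim]
  split_ifs with h
  · rw [h]
    ring
  · have h1 : q - 1 ≠ 0 := sub_ne_zero.2 h
    have h2 : q ^ 2 + q + 1 = 0 := by
      apply mul_left_cancel₀ h1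
      linear_combination hq
    exact inv_eq_of_mul_eq_one_right (by linear_combination (q - 3) / 6 * h2)

lemma hasSum_neg_log_one_sub {z : ℂ} (hz : ‖z‖ < 1) :
    HasSum (fun j : ℕ => z ^ (j + 1) / ((j : ℂ) + 1)) (-Complex.log (1 - z)) := by
  have h := (hasSum_nat_add_iff' 1).2 (Complex.hasSum_taylorSeries_neg_log hz)
  simpa using h

lemma regConst_eq {ζ x : ℂ} (hζ : ζ ^ 3 = 1) (hx : ‖x‖ < 1) :
    regConst ζ x = 1 / 2 * Complex.log (1 - x) +
      1 / 6 * (Complex.log (1 - ζ * x) - Complex.log (1 - ζ ^ 2 * x)) := by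
  have hζn : ‖ζ‖ = 1 := Complex.norm_eq_one_of_pow_eq_one hζ (by norm_num)
  have h1 := hasSum_neg_log_one_sub hx
  have h2 := hasSum_neg_log_one_sub (z := ζ * x) (by simpa [hζn] using hx)
  have h3 := hasSum_neg_log_one_sub (z := ζ ^ 2 * x) (by simpa [hζn] using hx)
  have h := (h1.mul_left (-1 / 2)).add ((h3.sub h2).mul_left (1 / 6))
  rw [regConst]
  convert h.tsum_eq using 1
  · refine tsum_congr fun j => ?_
    rw [regKernelLim_eq (by rw [← pow_mul, mul_comm, pow_mul, hζ, one_pow]), mul_pow, mul_pow,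
      ← pow_mul, ← pow_mul, mul_comm 2 (j + 1)]
    ring
  · ring

lemma one_sub_ne_zero_of_norm_lt {z : ℂ} (hz : ‖z‖ < 1) : 1 - z ≠ 0 := fun h => by
  rw [← sub_eq_zero.1 h] at hz
  simp at hz

/-- By `regConst_eq` the quotient of the two exponentials is `(1 - ζ x) / (1 - ζ² x)`. It equals
`-1` only if `2 = (ζ + ζ²) x = -x`, which is impossible in the disk. -/
lemma exp_three_regConst_add_ne_zero {ζ x : ℂ} (hζ : ζ ^ 3 = 1) (hζ1 : ζ ≠ 1) (hx : ‖x‖ < 1) :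
    Complex.exp (3 * regConst ζ x) + Complex.exp (3 * regConst (ζ ^ 2) x) ≠ 0 := by
  have hζn : ‖ζ‖ = 1 := Complex.norm_eq_one_of_pow_eq_one hζ (by norm_num)
  have hζ4 : (ζ ^ 2) ^ 2 = ζ := by linear_combination ζ * hζ
  have hz1 : 1 - ζ * x ≠ 0 := one_sub_ne_zero_of_norm_lt (by simpa [hζn] using hx)
  have hz2 : 1 - ζ ^ 2 * x ≠ 0 := one_sub_ne_zero_of_norm_lt (by simpa [hζn] using hx)
  have hsum : ζ ^ 2 + ζ + 1 = 0 := by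
    apply mul_left_cancel₀ (sub_ne_zero.2 hζ1)
    linear_combination hζ
  have e : 3 * regConst ζ x = 3 * regConst (ζ ^ 2) x +
      (Complex.log (1 - ζ * x) - Complex.log (1 - ζ ^ 2 * x)) := by
    rw [regConst_eq hζ hx, regConst_eq (by rw [← pow_mul, mul_comm, pow_mul, hζ, one_pow]) hx, hζ4]
    ring
  rw [e, Complex.exp_add, Complex.exp_sub, Complex.exp_log hz1, Complex.exp_log hz2]
  intro h
  have h1 : (1 - ζ * x) / (1 - ζ ^ 2 * x) + 1 = 0 := by
    apply mul_left_cancel₀ (Complex.exp_ne_zero (3 * regConst (ζ ^ 2) x))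
    rw [mul_zero, mul_add, mul_one, h]
  rw [div_add_one hz2, div_eq_zero_iff] at h1
  have h2 : x = -2 := by
    have := h1.resolve_right hz2
    linear_combination this + x * hsum
  rw [h2] at hx
  norm_num at hx

lemma div_le_norm_add {a b : ℂ} {A B : ℝ} (ha : ‖a‖ = A) (hb : ‖b‖ = B) (hA : 0 < A) :
    ‖a ^ 3 + b ^ 3‖ / (A ^ 2 + A * B + B ^ 2) ≤ ‖a + b‖ := by
  have hB : 0 ≤ B := hb ▸ norm_nonneg b
  rw [div_le_iff₀ (by positivity), show a ^ 3 + b ^ 3 = (a + b) * (a ^ 2 - a * b + b ^ 2) by ring,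
    norm_mul]
  gcongr
  calc ‖a ^ 2 - a * b + b ^ 2‖ ≤ ‖a ^ 2 - a * b‖ + ‖b ^ 2‖ := norm_add_le _ _
    _ ≤ ‖a ^ 2‖ + ‖a * b‖ + ‖b ^ 2‖ := by gcongr; exact norm_sub_le _ _
    _ = A ^ 2 + A * B + B ^ 2 := by rw [norm_pow, norm_pow, norm_mul, ha, hb]

lemma mul_mul_add_mul_mul (a b c d g : ℂ) : a * (b * g) + c * (d * g) = (a * b + c * d) * g := by
  ring

/-- A single saddle cannot cancel. For `k = 3` the phases `e^{inθ}` are cube roots of unity, so the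
sum `a³ + b³` of the cubes of the two terms (without the common Gaussian factor) does not depend on
`n`; as `a + b` divides it, `|a + b|` is bounded below uniformly in `n`. -/
lemma exists_le_norm_sum_angles {k : ℕ} {x : ℂ} (hx : ‖x‖ < 1)
    (hpos : 0 < f k x) : ∃ c > 0, ∀ n : ℕ,
      c ≤ ‖∑ θ ∈ angles k, Complex.exp (Complex.I * (n * θ)) * saddleConst k x θ‖ := by
  have hunit : ∀ (n : ℕ) (θ : ℝ), ‖Complex.exp (Complex.I * (n * θ))‖ = 1 := by
    intro n θ
    have := norm_exp_I_mul (n * θ)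
    push_cast at this
    exact this
  have hsingle : ∀ θ : ℝ, ∃ c > 0, ∀ n : ℕ,
      c ≤ ‖∑ θ ∈ ({θ} : Finset ℝ), Complex.exp (Complex.I * (n * θ)) * saddleConst k x θ‖ := by
    intro θ
    refine ⟨‖saddleConst k x θ‖, norm_pos_iff.2 (saddleConst_ne_zero hpos θ), fun n => ?_⟩
    rw [Finset.sum_singleton, norm_mul, hunit, one_mul]
  rw [angles]
  split_ifs with h1 h2
  · exact hsingle _
  · exact hsingle _
  have hne : 2 * Real.pi / 3 ≠ 4 * Real.pi / 3 := by
    have := Real.pi_pos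
    intro h
    linarith
  set ζ := Complex.exp (Complex.I * ((2 * Real.pi / 3 : ℝ) : ℂ)) with hζdef
  have hord : orderOf ζ = 3 := orderOf_exp_third (m := 1) (by push_cast; ring) (by norm_num)
  have hζ3 : ζ ^ 3 = 1 := by rw [← hord, pow_orderOf_eq_one]
  have hζ1 : ζ ≠ 1 := fun h => by rw [h, orderOf_one] at hord; norm_num at hord
  have hζ2 : Complex.exp (Complex.I * ((4 * Real.pi / 3 : ℝ) : ℂ)) = ζ ^ 2 := by
    rw [hζdef, exp_I_mul_pow]
    congr 3
    push_cast
    ring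
  set Gi := ∫ v : ℝ, Complex.exp (-((v ^ 2 : ℝ) : ℂ) / rootLi k x) with hGi
  have hG : Gi ≠ 0 := right_ne_zero_of_mul (saddleConst_ne_zero hpos 0)
  set A := ‖Complex.exp (regConst ζ x)‖ with hA
  set B := ‖Complex.exp (regConst (ζ ^ 2) x)‖ with hB
  have hA0 : 0 < A := norm_pos_iff.2 (Complex.exp_ne_zero _)
  have hB0 : 0 < B := norm_pos_iff.2 (Complex.exp_ne_zero _)
  set D := ‖Complex.exp (3 * regConst ζ x) + Complex.exp (3 * regConst (ζ ^ 2) x)‖ with hD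
  have hD0 : 0 < D := norm_pos_iff.2 (exp_three_regConst_add_ne_zero hζ3 hζ1 hx)
  refine ⟨D / (A ^ 2 + A * B + B ^ 2) * ‖Gi‖, by have := norm_pos_iff.2 hG; positivity, fun n => ?_⟩
  rw [Finset.sum_pair hne, saddleConst, saddleConst, hζ2, ← hζdef, ← hGi,
    mul_mul_add_mul_mul, norm_mul]
  gcongr
  have hcube : ∀ (θ : ℝ) (z R : ℂ), Complex.exp (Complex.I * θ) = z → z ^ 3 = 1 →
      (Complex.exp (Complex.I * (n * θ)) * Complex.exp R) ^ 3 = Complex.exp (3 * R) := by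
    intro θ z R h1 h2
    rw [mul_pow, ← Complex.exp_nat_mul R, show Complex.I * (n * θ) = n * (Complex.I * θ) by ring,
      Complex.exp_nat_mul, h1, ← pow_mul, mul_comm n, pow_mul, h2, one_pow, one_mul]
    norm_num
  have hkey := div_le_norm_add (A := A) (B := B)
    (a := Complex.exp (Complex.I * (n * ((2 * Real.pi / 3 : ℝ) : ℂ))) * Complex.exp (regConst ζ x))
    (b := Complex.exp (Complex.I * (n * ((4 * Real.pi / 3 : ℝ) : ℂ))) *
      Complex.exp (regConst (ζ ^ 2) x))
    (by rw [norm_mul, hunit, one_mul]) (by rw [norm_mul, hunit, one_mul]) hA0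
  rwa [hcube _ ζ _ rfl hζ3, hcube _ (ζ ^ 2) _ hζ2 (by rw [← pow_mul, mul_comm, pow_mul, hζ3,
    one_pow])] at hkey

/-! ### Nonvanishing and logarithmic growth where one order dominates. -/

theorem Dominates.exists_bounds {k : ℕ} {x₀ : ℂ} (hk : k ∈ Finset.Icc 1 3) (h : Dominates k x₀)
    (hx₀ : ‖x₀‖ < 1) : ∃ c > 0, ∃ C, ∀ᶠ p : ℕ × ℂ in atTop ×ˢ 𝓝 x₀,
      c ≤ ‖normalizer k p * (partitionPoly p.1).eval p.2‖ ∧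
      ‖normalizer k p * (partitionPoly p.1).eval p.2‖ ≤ C := by
  obtain ⟨c, hc, hlow⟩ := exists_le_norm_sum_angles hx₀ h.pos
  have hpi := Real.pi_pos
  refine ⟨c / 2 / (2 * Real.pi), by positivity,
    (c / 2 + ∑ θ ∈ angles k, ‖saddleConst k x₀ θ‖) / (2 * Real.pi), ?_⟩
  filter_upwards [(h.tendsto hk hx₀).norm.eventually_lt_const
    (show ‖(0 : ℂ)‖ < c / 2 by simpa using hc)] with p hp
  set S := ∑ θ ∈ angles k, Complex.exp (Complex.I * (p.1 * θ)) * saddleConst k x₀ θ with hS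
  have hup : ‖S‖ ≤ ∑ θ ∈ angles k, ‖saddleConst k x₀ θ‖ := by
    refine (norm_sum_le _ _).trans (Finset.sum_le_sum fun θ _ => ?_)
    have := norm_exp_I_mul (p.1 * θ)
    push_cast at this
    rw [norm_mul, this, one_mul]
  have e : ‖normalizer k p * (2 * Real.pi * (partitionPoly p.1).eval p.2)‖ =
      ‖normalizer k p * (partitionPoly p.1).eval p.2‖ * (2 * Real.pi) := by
    simp only [norm_mul, Complex.norm_real, Complex.norm_ofNat, Real.norm_eq_abs, abs_of_pos hpi]
    ring
  have h1 := abs_le.1 ((abs_norm_sub_norm_le _ _).trans hp.le)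
  have h2 := hlow p.1
  rw [e] at h1
  constructor
  · rw [div_le_iff₀ (by positivity)]
    linarith [h1.1]
  · rw [le_div_iff₀ (by positivity)]
    linarith [h1.2]

theorem Dominates.eventually_ne_zero {k : ℕ} {x₀ : ℂ} (hk : k ∈ Finset.Icc 1 3)
    (h : Dominates k x₀) (hx₀ : ‖x₀‖ < 1) :
    ∀ᶠ p : ℕ × ℂ in atTop ×ˢ 𝓝 x₀, (partitionPoly p.1).eval p.2 ≠ 0 := by
  obtain ⟨c, hc, C, hb⟩ := h.exists_bounds hk hx₀
  filter_upwards [hb] with p hp h0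
  have := hp.1
  rw [h0, mul_zero, norm_zero] at this
  linarith

theorem Dominates.tendsto_log {k : ℕ} {x₀ : ℂ} (hk : k ∈ Finset.Icc 1 3) (h : Dominates k x₀)
    (hx₀ : ‖x₀‖ < 1) :
    Tendsto (fun n : ℕ => Real.log ‖(partitionPoly n).eval x₀‖ / √(n : ℝ)) atTop
      (𝓝 (2 * f k x₀)) := by
  obtain ⟨c, hc, C, hb⟩ := h.exists_bounds hk hx₀
  have hpair : Tendsto (fun n : ℕ => (n, x₀)) atTop (atTop ×ˢ 𝓝 x₀) :=
    tendsto_id.prodMk tendsto_const_nhds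
  have hb' := hpair.eventually hb
  have hs : Tendsto (fun n : ℕ => √(n : ℝ)) atTop atTop :=
    Real.tendsto_sqrt_atTop.comp tendsto_natCast_atTop_atTop
  set M := max |Real.log c| |Real.log C| with hM
  have h1 : Tendsto (fun n : ℕ => Real.log ‖normalizer k (n, x₀) * (partitionPoly n).eval x₀‖ /
      √(n : ℝ)) atTop (𝓝 0) := by
    have h2 : Tendsto (fun n : ℕ => M / √(n : ℝ)) atTop (𝓝 0) := tendsto_const_nhds.div_atTop hs
    refine squeeze_zero_norm' ?_ h2
    filter_upwards [hb'] with n hn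
    rw [norm_div, Real.norm_eq_abs, Real.norm_eq_abs, abs_of_nonneg (Real.sqrt_nonneg _)]
    gcongr
    exact abs_le_max_abs_abs (Real.log_le_log hc hn.1) (Real.log_le_log (hc.trans_le hn.1) hn.2)
  have h2 : Tendsto (fun n : ℕ => 3 / 2 * (Real.log √(n : ℝ) / √(n : ℝ))) atTop (𝓝 0) := by
    have h3 : Tendsto (fun y : ℝ => Real.log y / y) atTop (𝓝 0) :=
      Real.isLittleO_log_id_atTop.tendsto_div_nhds_zero
    simpa [Function.comp_def] using (h3.comp hs).const_mul (3 / 2)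
  have h3 := (h1.sub h2).add_const (2 * f k x₀)
  rw [sub_zero, zero_add] at h3
  refine h3.congr' ?_
  filter_upwards [hb', eventually_ge_atTop 1] with n hn hn1
  have hs0 : 0 < √(n : ℝ) := Real.sqrt_pos.2 (by exact_mod_cast hn1)
  have hF : (partitionPoly n).eval x₀ ≠ 0 := fun h0 => by
    have := hn.1
    rw [h0, mul_zero, norm_zero] at this
    linarith
  rw [norm_mul, norm_normalizer]
  simp only
  set s := √(n : ℝ)
  have hss : 0 < √s := Real.sqrt_pos.2 hs0
  rw [Real.log_mul (by positivity) (norm_ne_zero_iff.2 hF), Real.log_mul (by positivity)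
    (Real.exp_pos _).ne', Real.log_mul hs0.ne' hss.ne', Real.log_exp, Real.log_sqrt hs0.le]
  field_simp
  ring

/-! ### Values on the real axis -/

lemma dilog_im_of_real {t : ℝ} (ht : |t| < 1) : (dilog t).im = 0 := by
  rw [dilog_im_eq_integral (by simpa using ht), Complex.ofReal_im, zero_mul]

lemma hasSum_dilog_re {t : ℝ} (ht : |t| < 1) :
    HasSum (fun n : ℕ => t ^ (n + 1) / ((n : ℝ) + 1) ^ 2) (dilog t).re := by
  have h := Complex.hasSum_re (hasSum_dilog (z := t) (by simpa using ht.le))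
  convert h using 2 with n
  rw [← Complex.ofReal_re (t ^ (n + 1) / ((n : ℝ) + 1) ^ 2)]
  push_cast
  rfl

lemma dilog_re_mono {s t : ℝ} (hs : 0 ≤ s) (hst : s ≤ t) (ht : t < 1) :
    (dilog s).re ≤ (dilog t).re := by
  refine hasSum_le (fun n => ?_) (hasSum_dilog_re (t := s) (abs_lt.2 ⟨by linarith, by linarith⟩))
    (hasSum_dilog_re (t := t) (abs_lt.2 ⟨by linarith, by linarith⟩))
  gcongr

lemma dilog_re_pos {t : ℝ} (ht0 : 0 < t) (ht : t < 1) : 0 < (dilog t).re := by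
  have h := hasSum_dilog_re (t := t) (abs_lt.2 ⟨by linarith, by linarith⟩)
  have := le_hasSum h 0 fun n _ => by positivity
  simp only [zero_add, pow_one, Nat.cast_zero, one_pow, div_one] at this
  linarith

lemma f_sq_of_pos {t : ℝ} (ht0 : 0 < t) (ht : t < 1) {k : ℕ} (hk : k ≠ 0) :
    f k t ^ 2 = (dilog ((t ^ k : ℝ) : ℂ)).re / (k : ℝ) ^ 2 := by
  have h0 : 0 < t ^ k := by positivity
  have h1 : t ^ k < 1 := pow_lt_one₀ ht0.le ht hk
  have him := dilog_im_of_real (t := t ^ k) (by rwa [abs_of_pos h0])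
  have hre := dilog_re_pos h0 h1
  rw [f_sq, ← Complex.ofReal_pow]
  set w := dilog ((t ^ k : ℝ) : ℂ)
  have hw : w = ((w.re : ℝ) : ℂ) := Complex.ext (by simp) (by simp [him])
  have hn : ‖w‖ = w.re := by
    rw [hw, Complex.norm_real, Real.norm_eq_abs, Complex.ofReal_re, abs_of_pos hre]
  rw [hn]
  field_simp
  ring

lemma f_lt_f_of_pos {t : ℝ} (ht0 : 0 < t) (ht : t < 1) {j k : ℕ} (hj : j ≠ 0) (hjk : j < k) :
    f k t < f j t := by
  refine f_lt_of_sq_lt ?_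
  rw [f_sq_of_pos ht0 ht hj, f_sq_of_pos ht0 ht (by omega)]
  have h1 : t ^ j < 1 := pow_lt_one₀ ht0.le ht hj
  have hle : (dilog ((t ^ k : ℝ) : ℂ)).re ≤ (dilog ((t ^ j : ℝ) : ℂ)).re :=
    dilog_re_mono (by positivity) (pow_le_pow_of_le_one ht0.le ht.le hjk.le) h1
  have hpos := dilog_re_pos (by positivity) h1
  have hjp : (0 : ℝ) < j := by exact_mod_cast Nat.pos_of_ne_zero hj
  have hjk' : (j : ℝ) < k := by exact_mod_cast hjk
  calc (dilog ((t ^ k : ℝ) : ℂ)).re / (k : ℝ) ^ 2 ≤ (dilog ((t ^ j : ℝ) : ℂ)).re / (k : ℝ) ^ 2 := by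
        gcongr
    _ < (dilog ((t ^ j : ℝ) : ℂ)).re / (j : ℝ) ^ 2 := by gcongr

/-- On the negative axis `Li₂ ≤ 0`, so `f_1 = 0`, while `max(f_1, f_2) > 0`. Together with
`f_lt_f_of_pos` this shows that no region contains a neighbourhood of the origin. -/
lemma f_one_lt_f_two_of_neg {t : ℝ} (ht0 : t < 0) (ht : -1 < t) : f 1 t < f 2 t := by
  have habs : |t| < 1 := abs_lt.2 ⟨ht, by linarith⟩
  have hn : ‖(t : ℂ)‖ < 1 := by simpa using habs
  have him := dilog_im_of_real habs
  have hre := dilog_re_nonpos hn (by simpa using ht0.le)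
  have h1 : f 1 (t : ℂ) ^ 2 = 0 := by
    rw [f_sq, pow_one]
    set w := dilog (t : ℂ)
    have hw : w = ((w.re : ℝ) : ℂ) := Complex.ext (by simp) (by simp [him])
    have : ‖w‖ = -w.re := by
      rw [hw, Complex.norm_real, Real.norm_eq_abs, Complex.ofReal_re, abs_of_nonpos hre]
    rw [this]
    simp
  have h2 : f 1 (t : ℂ) = 0 := pow_eq_zero_iff two_ne_zero |>.1 h1
  have h3 := max_f_pos hn (by exact_mod_cast ht0.ne)
  rw [h2] at h3 ⊢
  rcases lt_max_iff.1 h3 with h | h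
  · exact absurd h (lt_irrefl _)
  · exact h

/-! ### Ties -/

lemma differentiableOn_dilog_pow {k : ℕ} (hk : k ≠ 0) :
    DifferentiableOn ℂ (fun x => dilog (x ^ k) / (k : ℂ) ^ 2) (ball (0 : ℂ) 1) := by
  refine DifferentiableOn.div_const ?_ _
  exact differentiableOn_dilog.comp (by fun_prop) fun x hx => by
    rw [mem_ball_zero_iff] at hx ⊢
    exact norm_pow_lt_one hx hk

lemma exists_ball_f_pos {k : ℕ} (hk : k ≠ 0) {x₀ : ℂ} (hx₀ : ‖x₀‖ < 1) (hpos : 0 < f k x₀) :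
    ∀ᶠ x in 𝓝 x₀, ‖x‖ < 1 ∧ 0 < f k x :=
  (continuous_norm.continuousAt.eventually_lt_const hx₀).and
    ((continuousAt_f hk hx₀).eventually_const_lt hpos)

lemma analyticAt_rootLi {k : ℕ} (hk : k ≠ 0) {x : ℂ} (hx : ‖x‖ < 1) (h : 0 < f k x) :
    AnalyticAt ℂ (rootLi k) x := by
  rw [Complex.analyticAt_iff_eventually_differentiableAt]
  filter_upwards [exists_ball_f_pos hk hx h] with y hy
  exact differentiableAt_rootLi hk hy.1 hy.2

lemma harmonicAt_f {k : ℕ} (hk : k ≠ 0) {x : ℂ} (hx : ‖x‖ < 1) (h : 0 < f k x) :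
    InnerProductSpace.HarmonicAt (f k) x := by
  rw [show f k = fun y => (rootLi k y).re from funext (f_eq_re k)]
  exact (analyticAt_rootLi hk hx h).harmonicAt_re

/-- A local tie makes `h_j - h_k` a constant `c`. Eliminating the roots gives `(A - B - c²)² = 4 c²
B` for `A = h_j²`, `B = h_k²`, an identity between functions analytic on the whole disk, where the
roots need not be. At `0` it yields `c = 0`, so `A = B` throughout, contradicting `f_k < f_j` at
`1/2`. -/
theorem not_eventually_f_eq {j k : ℕ} (hj : j ≠ 0) (hjk : j < k) {x₀ : ℂ} (hx₀ : ‖x₀‖ < 1)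
    (hpos : 0 < f k x₀) : ¬ ∀ᶠ x in 𝓝 x₀, f j x = f k x := by
  intro hev
  have hk : k ≠ 0 := by omega
  obtain ⟨ε, hε, hball⟩ := Metric.eventually_nhds_iff_ball.1 (hev.and (exists_ball_f_pos hk hx₀ hpos))
  have han : AnalyticOnNhd ℂ (fun x => rootLi j x - rootLi k x) (ball x₀ ε) := by
    intro x hx
    obtain ⟨h1, h2, h3⟩ := hball x hx
    exact (analyticAt_rootLi hj h2 (h1 ▸ h3)).sub (analyticAt_rootLi hk h2 h3)
  obtain ⟨c, hc⟩ := han.eq_const_of_re_eq_const (c₀ := 0) (fun x hx => by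
    obtain ⟨h1, -⟩ := hball x hx
    simp [Complex.sub_re, ← f_eq_re, h1]) isOpen_ball
    ((convex_ball x₀ ε).isConnected ⟨x₀, mem_ball_self hε⟩)
  set A : ℂ → ℂ := fun x => dilog (x ^ j) / (j : ℂ) ^ 2 with hA
  set B : ℂ → ℂ := fun x => dilog (x ^ k) / (k : ℂ) ^ 2 with hB
  have hAd : DifferentiableOn ℂ A (ball 0 1) := differentiableOn_dilog_pow hj
  have hBd : DifferentiableOn ℂ B (ball 0 1) := differentiableOn_dilog_pow hk
  have hEan : AnalyticOnNhd ℂ (fun x => (A x - B x - c ^ 2) ^ 2 - 4 * c ^ 2 * B x) (ball 0 1) :=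
    DifferentiableOn.analyticOnNhd (by fun_prop) isOpen_ball
  have hx₀' : x₀ ∈ ball (0 : ℂ) 1 := mem_ball_zero_iff.2 hx₀
  have hE := hEan.eqOn_zero_of_preconnected_of_eventuallyEq_zero
    (convex_ball (0 : ℂ) 1).isPreconnected hx₀' (by
      filter_upwards [ball_mem_nhds x₀ hε] with x hx
      have h1 : rootLi j x - rootLi k x = c := hc x hx
      have h2 : rootLi j x = rootLi k x + c := by rw [← h1]; ring
      have h3 : A x = rootLi j x ^ 2 := (rootLi_sq j x).symm
      have h4 : B x = rootLi k x ^ 2 := (rootLi_sq k x).symm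
      simp only [h3, h4, h2, Pi.zero_apply]
      ring)
  have hc0 : c = 0 := by
    have h0 := hE (mem_ball_self one_pos)
    simp only [hA, hB, zero_pow hj, zero_pow hk, dilog_zero, Pi.zero_apply] at h0
    simpa using h0
  have hAB : ∀ x ∈ ball (0 : ℂ) 1, A x = B x := by
    intro x hx
    have h1 := hE hx
    rw [hc0] at h1
    simp only [Pi.zero_apply] at h1
    refine sub_eq_zero.1 (pow_eq_zero_iff two_ne_zero |>.1 ?_)
    linear_combination h1
  have hhalf : ‖(((1 / 2 : ℝ)) : ℂ)‖ < 1 := by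
    rw [Complex.norm_real]
    norm_num
  have h1 : rootLi j ((1 / 2 : ℝ) : ℂ) ^ 2 = rootLi k ((1 / 2 : ℝ) : ℂ) ^ 2 := by
    rw [rootLi_sq, rootLi_sq]
    exact hAB _ (mem_ball_zero_iff.2 hhalf)
  have h2 : f j ((1 / 2 : ℝ) : ℂ) ^ 2 = f k ((1 / 2 : ℝ) : ℂ) ^ 2 := by
    have e1 := two_mul_re_sq (rootLi j ((1 / 2 : ℝ) : ℂ))
    have e2 := two_mul_re_sq (rootLi k ((1 / 2 : ℝ) : ℂ))
    rw [h1, ← e2, ← f_eq_re, ← f_eq_re] at e1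
    linarith
  have h3 := f_lt_f_of_pos (t := 1 / 2) (by norm_num) (by norm_num) hj hjk
  have h4 := pow_lt_pow_left₀ h3 (f_nonneg _ _) two_ne_zero
  exact h4.ne h2.symm

/-! ### The regions -/

/-- The largest of `f 1, f 2, f 3`. -/
def topF (x : ℂ) : ℝ := max (f 1 x) (max (f 2 x) (f 3 x))

lemma f_le_topF {k : ℕ} (hk : k ∈ Finset.Icc 1 3) (x : ℂ) : f k x ≤ topF x := by
  rw [Finset.mem_Icc] at hk
  obtain ⟨h1, h3⟩ := hk
  interval_cases k
  · exact le_max_left _ _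
  · exact (le_max_left _ _).trans (le_max_right _ _)
  · exact (le_max_right _ _).trans (le_max_right _ _)

lemma exists_f_eq_topF (x : ℂ) : ∃ k ∈ Finset.Icc 1 3, f k x = topF x := by
  rcases max_choice (f 1 x) (max (f 2 x) (f 3 x)) with h | h
  · exact ⟨1, by simp, h.symm⟩
  · rcases max_choice (f 2 x) (f 3 x) with h' | h'
    · exact ⟨2, by simp, by rw [topF, h, h']⟩
    · exact ⟨3, by simp, by rw [topF, h, h']⟩

lemma continuousOn_topF : ContinuousOn topF (ball (0 : ℂ) 1) :=
  ContinuousOn.sup (continuousOn_f one_ne_zero)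
    (ContinuousOn.sup (continuousOn_f two_ne_zero) (continuousOn_f three_ne_zero))

lemma topF_pos {x : ℂ} (hx : ‖x‖ < 1) (hx0 : x ≠ 0) : 0 < topF x :=
  (max_f_pos hx hx0).trans_le (max_le (f_le_topF (by simp) x) (f_le_topF (by simp) x))

lemma mem_region_iff {k : ℕ} {x : ℂ} : x ∈ region k ↔ x ∈ ball (0 : ℂ) 1 ∧ topF x ≤ f k x := by
  simp only [region, topF, max_le_iff, Set.mem_ofPred_eq]

lemma ne_zero_of_mem_Icc {k : ℕ} (hk : k ∈ Finset.Icc 1 3) : k ≠ 0 := by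
  rw [Finset.mem_Icc] at hk
  omega

lemma isOpen_ball_diff_region {k : ℕ} (hk : k ≠ 0) : IsOpen (ball (0 : ℂ) 1 \ region k) := by
  have h := ((continuousOn_topF).sub (continuousOn_f hk)).isOpen_inter_preimage isOpen_ball
    (isOpen_Ioi (a := 0))
  convert h using 1
  ext x
  simp only [Set.mem_sdiff, mem_region_iff, Set.mem_inter_iff, Set.mem_preimage, Set.mem_Ioi,
    Pi.sub_apply, sub_pos]
  grind

lemma Dominates.mem_interior_region {k : ℕ} (hk : k ∈ Finset.Icc 1 3) {x : ℂ} (hx : ‖x‖ < 1)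
    (h : Dominates k x) : x ∈ interior (region k) := by
  rw [mem_interior_iff_mem_nhds]
  have h1 : ∀ j ∈ Finset.Icc 1 3, ∀ᶠ y in 𝓝 x, f j y ≤ f k y := by
    intro j hj
    rcases eq_or_ne j k with rfl | hne
    · exact Eventually.of_forall fun _ => le_rfl
    · have := (continuousAt_f (ne_zero_of_mem_Icc hj) hx).tendsto.eventually_lt
        (continuousAt_f (ne_zero_of_mem_Icc hk) hx).tendsto (h j hj hne)
      exact this.mono fun _ hy => hy.le
  filter_upwards [h1 1 (by simp), h1 2 (by simp), h1 3 (by simp),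
    continuous_norm.continuousAt.eventually_lt_const hx] with y e1 e2 e3 e4
  exact ⟨mem_ball_zero_iff.2 e4, e1, e2, e3⟩

/-- At an interior tie the harmonic function `f_k - f_j ≥ 0` attains its minimum zero, so it
vanishes nearby by the mean value property, against `not_eventually_f_eq`. -/
theorem dominates_of_mem_interior_region {k : ℕ} (hk : k ∈ Finset.Icc 1 3) {x : ℂ} (hx : ‖x‖ < 1)
    (h : x ∈ interior (region k)) : Dominates k x := by
  intro j hj hjk
  have hk0 := ne_zero_of_mem_Icc hk
  have hj0 := ne_zero_of_mem_Icc hj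
  have hle : f j x ≤ f k x :=
    (f_le_topF hj x).trans (mem_region_iff.1 (interior_subset h)).2
  refine lt_of_le_of_ne hle fun heq => ?_
  have hnhds : region k ∈ 𝓝 x := mem_interior_iff_mem_nhds.1 h
  -- At the origin all `f_k` vanish and are not known to be harmonic, so the comparison on the real
  -- axis is used instead.
  rcases eq_or_ne x 0 with rfl | hx0
  · have hreal : ∀ᶠ t : ℝ in 𝓝 0, (t : ℂ) ∈ region k := by
      have : ContinuousAt (fun t : ℝ => (t : ℂ)) 0 := Complex.continuous_ofReal.continuousAt
      exact this.eventually (by simpa using hnhds)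
    rcases eq_or_ne k 1 with rfl | hk1
    · obtain ⟨t, ht, ht1, ht2⟩ := ((hreal.filter_mono nhdsWithin_le_nhds).and
        (Ioo_mem_nhdsLT (show (-1 : ℝ) < 0 by norm_num))).exists
      exact absurd ht.2.2.1 (not_le.2 (f_one_lt_f_two_of_neg ht2 ht1))
    · obtain ⟨t, ht, ht1, ht2⟩ := ((hreal.filter_mono nhdsWithin_le_nhds).and
        (Ioo_mem_nhdsGT (show (0 : ℝ) < 1 by norm_num))).exists
      exact absurd ht.2.1 (not_le.2 (f_lt_f_of_pos ht1 ht2 one_ne_zero (by omega)))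
  have hkpos : 0 < f k x := (topF_pos hx hx0).trans_le (mem_region_iff.1 (interior_subset h)).2
  have hjpos : 0 < f j x := heq ▸ hkpos
  obtain ⟨ε, hε, hball⟩ := Metric.eventually_nhds_iff_ball.1 (((exists_ball_f_pos hk0 hx hkpos).and
    (exists_ball_f_pos hj0 hx hjpos)).and hnhds)
  have hharm : InnerProductSpace.HarmonicOnNhd (fun y => f k y - f j y) (ball x ε) := by
    intro y hy
    obtain ⟨⟨⟨h1, h2⟩, -, h3⟩, -⟩ := hball y hy
    exact (harmonicAt_f hk0 h1 h2).sub (harmonicAt_f hj0 h1 h3)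
  have hzero : ∀ y ∈ ball x ε, f k y - f j y = 0 := fun y hy =>
    eq_zero_of_circleAverage_eq_zero (g := fun y => f k y - f j y) hharm.continuousOn
      (fun y hy => sub_nonneg.2 ((f_le_topF hj y).trans (mem_region_iff.1 (hball y hy).2).2))
      (sub_eq_zero.2 heq.symm) (fun r hr hrε => by
        rw [InnerProductSpace.HarmonicOnNhd.circleAverage_eq (hharm.mono (by
          rw [abs_of_pos hr]
          exact closedBall_subset_ball hrε)), heq, sub_self]) hy
  have hev : ∀ᶠ y in 𝓝 x, f j y = f k y := by
    filter_upwards [ball_mem_nhds x hε] with y hy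
    exact (sub_eq_zero.1 (hzero y hy)).symm
  rcases lt_or_gt_of_ne hjk with hlt | hlt
  · exact not_eventually_f_eq hj0 hlt hx hkpos hev
  · exact not_eventually_f_eq hk0 hlt hx hjpos (hev.mono fun _ h => h.symm)

lemma mem_frontier_region_iff {k : ℕ} (hk : k ∈ Finset.Icc 1 3) {x : ℂ} (hx : ‖x‖ < 1) :
    x ∈ frontier (region k) ↔ x ∈ region k ∧ ¬ Dominates k x := by
  rw [frontier, Set.mem_sdiff]
  have hcl : x ∈ closure (region k) ↔ x ∈ region k := by
    refine ⟨fun h => ?_, fun h => subset_closure h⟩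
    by_contra hn
    have hmem : ball (0 : ℂ) 1 \ region k ∈ 𝓝 x :=
      (isOpen_ball_diff_region (ne_zero_of_mem_Icc hk)).mem_nhds ⟨mem_ball_zero_iff.2 hx, hn⟩
    obtain ⟨y, hy, hy'⟩ := mem_closure_iff_nhds.1 h _ hmem
    exact hy.2 hy'
  rw [hcl, not_congr ⟨dominates_of_mem_interior_region hk hx,
    fun h => h.mem_interior_region hk hx⟩]

lemma not_dominates_iff {k : ℕ} {x : ℂ} (h : x ∈ region k) :
    ¬ Dominates k x ↔ ∃ j ∈ Finset.Icc 1 3, j ≠ k ∧ f j x = f k x := by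
  have hle : ∀ j ∈ Finset.Icc 1 3, f j x ≤ f k x := fun j hj =>
    (f_le_topF hj x).trans (mem_region_iff.1 h).2
  simp only [Dominates]
  push Not
  constructor
  · rintro ⟨j, hj, h1, h2⟩
    exact ⟨j, hj, h1, le_antisymm (hle j hj) h2⟩
  · rintro ⟨j, hj, h1, h2⟩
    exact ⟨j, hj, h1, h2.ge⟩

lemma frontier_region_inter_ball {k a b : ℕ} (hk : k ∈ Finset.Icc 1 3)
    (hab : ∀ j, j ∈ Finset.Icc 1 3 ∧ j ≠ k ↔ j = a ∨ j = b) :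
    frontier (region k) ∩ ball (0 : ℂ) 1 =
      region k ∩ {x | x ∈ ball (0 : ℂ) 1 ∧ (f a x = f k x ∨ f b x = f k x)} := by
  ext x
  constructor
  · rintro ⟨h1, h2⟩
    rw [mem_frontier_region_iff hk (mem_ball_zero_iff.1 h2)] at h1
    obtain ⟨j, hj, hjk, e⟩ := (not_dominates_iff h1.1).1 h1.2
    refine ⟨h1.1, h2, ?_⟩
    rcases (hab j).1 ⟨hj, hjk⟩ with rfl | rfl
    · exact Or.inl e
    · exact Or.inr e
  · rintro ⟨h1, h2, h3⟩
    refine ⟨(mem_frontier_region_iff hk (mem_ball_zero_iff.1 h2)).2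
      ⟨h1, (not_dominates_iff h1).2 ?_⟩, h2⟩
    rcases h3 with e | e
    · obtain ⟨g1, g2⟩ := (hab a).2 (Or.inl rfl)
      exact ⟨a, g1, g2, e⟩
    · obtain ⟨g1, g2⟩ := (hab b).2 (Or.inr rfl)
      exact ⟨b, g1, g2, e⟩

theorem frontier_region_one : frontier (region 1) ∩ ball (0 : ℂ) 1 =
    region 1 ∩ (sqrtLiCurve 1 2 ∪ sqrtLiCurve 1 3) := by
  rw [frontier_region_inter_ball (a := 2) (b := 3) (by simp) (by simp; omega)]
  ext x
  simp only [sqrtLiCurve, Set.mem_inter_iff, Set.mem_union, Set.mem_ofPred_eq]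
  grind

theorem frontier_region_two : frontier (region 2) ∩ ball (0 : ℂ) 1 =
    region 2 ∩ (sqrtLiCurve 1 2 ∪ sqrtLiCurve 2 3) := by
  rw [frontier_region_inter_ball (a := 1) (b := 3) (by simp) (by simp; omega)]
  ext x
  simp only [sqrtLiCurve, Set.mem_inter_iff, Set.mem_union, Set.mem_ofPred_eq]
  grind

theorem frontier_region_three : frontier (region 3) ∩ ball (0 : ℂ) 1 =
    region 3 ∩ (sqrtLiCurve 1 3 ∪ sqrtLiCurve 2 3) := by
  rw [frontier_region_inter_ball (a := 1) (b := 2) (by simp) (by simp; omega)]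
  ext x
  simp only [sqrtLiCurve, Set.mem_inter_iff, Set.mem_union, Set.mem_ofPred_eq]
  grind

lemma Dominates.topF_eq {k : ℕ} (hk : k ∈ Finset.Icc 1 3) {x : ℂ} (h : Dominates k x) :
    topF x = f k x := by
  refine le_antisymm ?_ (f_le_topF hk x)
  obtain ⟨j, hj, e⟩ := exists_f_eq_topF x
  rw [← e]
  rcases eq_or_ne j k with rfl | hne
  · exact le_rfl
  · exact (h j hj hne).le

/-- Strict dominance is dense in the disk. -/
theorem frequently_dominates {y : ℂ} (hy : ‖y‖ < 1) :
    ∃ᶠ w in 𝓝 y, ‖w‖ < 1 ∧ ∃ k ∈ Finset.Icc 1 3, Dominates k w := by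
  rw [frequently_iff]
  intro U hU
  obtain ⟨V, hVU, hVo, hyV⟩ := _root_.mem_nhds_iff.1 hU
  suffices H : ∃ w ∈ V ∩ ball (0 : ℂ) 1, ∃ k ∈ Finset.Icc 1 3, w ∈ interior (region k) by
    obtain ⟨w, hw, k, hk, hwk⟩ := H
    have hw1 := mem_ball_zero_iff.1 hw.2
    exact ⟨w, hVU hw.1, hw1, k, hk, dominates_of_mem_interior_region hk hw1 hwk⟩
  have hWo : IsOpen (V ∩ ball (0 : ℂ) 1) := hVo.inter isOpen_ball
  have hyW : y ∈ V ∩ ball (0 : ℂ) 1 := ⟨hyV, mem_ball_zero_iff.2 hy⟩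
  set W := V ∩ ball (0 : ℂ) 1 with hW
  -- A finite Baire argument: three relatively closed sets cover the open set `W`, so one of them
  -- has interior in `W`.
  by_cases h1 : W ⊆ region 1
  · exact ⟨y, hyW, 1, by simp, mem_interior.2 ⟨W, h1, hWo, hyW⟩⟩
  obtain ⟨a, haW, ha⟩ := Set.not_subset.1 h1
  have hW1o : IsOpen (W ∩ (ball (0 : ℂ) 1 \ region 1)) :=
    hWo.inter (isOpen_ball_diff_region one_ne_zero)
  by_cases h2 : W ∩ (ball (0 : ℂ) 1 \ region 1) ⊆ region 2
  · exact ⟨a, haW, 2, by simp, mem_interior.2 ⟨_, h2, hW1o, haW, haW.2, ha⟩⟩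
  obtain ⟨b, hbW, hb⟩ := Set.not_subset.1 h2
  have hW2o : IsOpen (W ∩ (ball (0 : ℂ) 1 \ region 1) ∩ (ball (0 : ℂ) 1 \ region 2)) :=
    hW1o.inter (isOpen_ball_diff_region two_ne_zero)
  refine ⟨b, hbW.1, 3, by simp, mem_interior.2 ⟨_, ?_, hW2o, hbW, hbW.1.2, hb⟩⟩
  rintro w ⟨⟨hw, hw1⟩, hw2⟩
  obtain ⟨k, hk, e⟩ := exists_f_eq_topF w
  have hwk : w ∈ region k := mem_region_iff.2 ⟨hw1.1, e.ge⟩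
  rw [Finset.mem_Icc] at hk
  obtain ⟨g1, g3⟩ := hk
  interval_cases k
  · exact absurd hwk hw1.2
  · exact absurd hwk hw2.2
  · exact hwk

/-- The limit set of the zeros. -/
def attractor : Set ℂ :=
  sphere (0 : ℂ) 1 ∪
    (frontier (region 1) ∪ frontier (region 2) ∪ frontier (region 3)) ∩ ball (0 : ℂ) 1

/-- The working form of the attractor: the closed unit disk without the points of strict dominance.
-/
lemma mem_attractor_iff {x : ℂ} : x ∈ attractor ↔
    ‖x‖ ≤ 1 ∧ ∀ k ∈ Finset.Icc 1 3, ‖x‖ < 1 → ¬ Dominates k x := by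
  constructor
  · rintro (h | ⟨h, hx⟩)
    · rw [mem_sphere_zero_iff_norm] at h
      exact ⟨h.le, fun k _ hlt => absurd h hlt.ne⟩
    · rw [mem_ball_zero_iff] at hx
      have key : ∀ k ∈ Finset.Icc 1 3, x ∈ frontier (region k) →
          ∀ j ∈ Finset.Icc 1 3, ‖x‖ < 1 → ¬ Dominates j x := by
        intro k hk hf j hj _ hd
        obtain ⟨h1, h2⟩ := (mem_frontier_region_iff hk hx).1 hf
        rcases eq_or_ne k j with rfl | hne
        · exact h2 hd
        · exact absurd ((f_le_topF hj x).trans (mem_region_iff.1 h1).2) (not_le.2 (hd k hk hne))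
      refine ⟨hx.le, ?_⟩
      rcases h with (h | h) | h
      · exact key 1 (by simp) h
      · exact key 2 (by simp) h
      · exact key 3 (by simp) h
  · rintro ⟨h1, h2⟩
    rcases h1.eq_or_lt with h | h
    · exact Or.inl (mem_sphere_zero_iff_norm.2 h)
    · refine Or.inr ⟨?_, mem_ball_zero_iff.2 h⟩
      obtain ⟨k, hk, e⟩ := exists_f_eq_topF x
      have hf : x ∈ frontier (region k) := (mem_frontier_region_iff hk h).2
        ⟨mem_region_iff.2 ⟨mem_ball_zero_iff.2 h, e.ge⟩, h2 k hk h⟩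
      rw [Finset.mem_Icc] at hk
      obtain ⟨g1, g3⟩ := hk
      interval_cases k
      · exact Or.inl (Or.inl hf)
      · exact Or.inl (Or.inr hf)
      · exact Or.inr hf

lemma exists_dominates_of_notMem_attractor {x : ℂ} (hx : ‖x‖ ≤ 1) (h : x ∉ attractor) :
    ∃ k ∈ Finset.Icc 1 3, ‖x‖ < 1 ∧ Dominates k x := by
  rw [mem_attractor_iff] at h
  push Not at h
  exact h hx

lemma isCompact_attractor : IsCompact attractor := by
  have hopen : ∀ k ∈ Finset.Icc 1 3, IsOpen (ball (0 : ℂ) 1 ∩ interior (region k)) := fun k _ =>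
    isOpen_ball.inter isOpen_interior
  have e : attractor = closedBall (0 : ℂ) 1 \
      ⋃ k ∈ Finset.Icc 1 3, ball (0 : ℂ) 1 ∩ interior (region k) := by
    ext x
    rw [mem_attractor_iff, Set.mem_sdiff, mem_closedBall_zero_iff, Set.mem_iUnion₂]
    refine and_congr_right fun _ => ?_
    push Not
    refine forall₂_congr fun k hk => ?_
    rw [Set.mem_inter_iff, mem_ball_zero_iff, not_and]
    refine forall_congr' fun hx => not_congr ?_
    exact ⟨fun h => h.mem_interior_region hk hx, dominates_of_mem_interior_region hk hx⟩
  rw [e]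
  exact (isCompact_closedBall _ _).diff (isOpen_biUnion hopen)

/-! ### Zeros accumulate only at the attractor -/

/-- Inside the disk, local nonvanishing is made uniform by compactness; outside, zeros have modulus
below `1 + ε` and are moved radially onto the circle. -/
lemma eventually_forall_zero_near {ε : ℝ} (hε : 0 < ε) :
    ∀ᶠ n in atTop, ∀ z, (partitionPoly n).eval z = 0 → ∃ y ∈ attractor, dist z y ≤ ε := by
  have hρ : 0 < (1 + ε)⁻¹ := by positivity
  obtain ⟨c, hc, hext⟩ := exists_le_norm_partitionPoly_eval hρ (inv_lt_one_of_one_lt₀ (by linarith))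
  rw [inv_inv] at hext
  set K := closedBall (0 : ℂ) 1 \ thickening ε attractor with hK
  have hKc : IsCompact K := (isCompact_closedBall _ _).diff isOpen_thickening
  have hin : ∀ᶠ n in atTop, ∀ z ∈ K, (partitionPoly n).eval z ≠ 0 := by
    refine hKc.induction_on (p := fun s => ∀ᶠ n in atTop, ∀ z ∈ s, (partitionPoly n).eval z ≠ 0)
      (by simp) (fun s t hst ht => ht.mono fun n hn z hz => hn z (hst hz))
      (fun s t hs ht => ?_) fun z hz => ?_
    · filter_upwards [hs, ht] with n h1 h2 z hz
      exact hz.elim (h1 z) (h2 z)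
    · have hzA : z ∉ attractor := fun h => hz.2 (self_subset_thickening hε _ h)
      obtain ⟨k, hk, hz1, hd⟩ :=
        exists_dominates_of_notMem_attractor (mem_closedBall_zero_iff.1 hz.1) hzA
      have h := hd.eventually_ne_zero hk hz1
      obtain ⟨pa, ha, pb, hb, hab⟩ := eventually_prod_iff.1 h
      exact ⟨{x | pb x}, mem_nhdsWithin_of_mem_nhds hb, ha.mono fun n hn x hx => hab hn hx⟩
  filter_upwards [hext, hin] with n h1 h2 z hz
  rcases le_or_gt ‖z‖ 1 with hz1 | hz1
  · have : z ∈ thickening ε attractor := by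
      by_contra hn
      exact h2 z ⟨mem_closedBall_zero_iff.2 hz1, hn⟩ hz
    obtain ⟨y, hy, hd⟩ := mem_thickening_iff.1 this
    exact ⟨y, hy, hd.le⟩
  · have hz0 : ‖z‖ ≠ 0 := by positivity
    have hlt : ‖z‖ < 1 + ε := by
      by_contra hge
      have := h1 z (not_lt.1 hge)
      rw [hz, norm_zero] at this
      have : 0 < c * ‖z‖ ^ n := by positivity
      linarith
    have hn : ‖((‖z‖⁻¹ : ℝ) : ℂ) * z‖ = 1 := by
      rw [norm_mul, Complex.norm_real, norm_inv, norm_norm, inv_mul_cancel₀ hz0]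
    refine ⟨((‖z‖⁻¹ : ℝ) : ℂ) * z, Or.inl (mem_sphere_zero_iff_norm.2 hn), ?_⟩
    have e : z - ((‖z‖⁻¹ : ℝ) : ℂ) * z = ((1 - ‖z‖⁻¹ : ℝ) : ℂ) * z := by
      push_cast
      ring
    have hinv : ‖z‖⁻¹ ≤ 1 := inv_le_one_of_one_le₀ hz1.le
    rw [dist_eq_norm, e, norm_mul, Complex.norm_real, Real.norm_eq_abs,
      abs_of_nonneg (by linarith), sub_mul, one_mul, inv_mul_cancel₀ hz0]
    linarith

/-! ### Every point of the attractor is a limit of zeros -/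

lemma eval_zero_partitionPoly (n : ℕ) : (partitionPoly n).eval 0 = 0 := by
  rw [partitionPoly, eval_finsetSum]
  refine Finset.sum_eq_zero fun k hk => ?_
  have : k ≠ 0 := by
    rw [Finset.mem_Icc] at hk
    omega
  simp [this]

lemma harmonicOnNhd_log_norm_div {n : ℕ} {s : Set ℂ} (a : ℝ)
    (h : ∀ z ∈ s, (partitionPoly n).eval z ≠ 0) :
    InnerProductSpace.HarmonicOnNhd
      (fun x => Real.log ‖(partitionPoly n).eval x‖ / a) s := by
  intro z hz
  have h1 : AnalyticAt ℂ (fun x => (partitionPoly n).eval x) z :=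
    (partitionPoly n).differentiable.analyticAt z
  have h2 := (h1.harmonicAt_log_norm (h z hz)).const_smul (c := a⁻¹)
  convert h2 using 1
  funext x
  simp [div_eq_inv_mul]

lemma log_norm_partitionPoly_le {n : ℕ} (hn : 1 ≤ n) (x : ℂ) :
    Real.log ‖(partitionPoly n).eval x‖ ≤ 3 * √(n : ℝ) + n * Real.posLog ‖x‖ := by
  rcases eq_or_ne ((partitionPoly n).eval x) 0 with h | h
  · rw [h, norm_zero, Real.log_zero]
    have := Real.posLog_nonneg (x := ‖x‖)
    positivity
  have h1 := Real.log_le_log (norm_pos_iff.2 h) (norm_partitionPoly_eval_le x hn)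
  have hm : 0 < max 1 ‖x‖ := lt_max_of_lt_left one_pos
  rwa [Real.log_mul (Real.exp_pos _).ne' (pow_pos hm n).ne', Real.log_exp, Real.log_pow,
    ← Real.posLog_eq_log_max_one (norm_nonneg x)] at h1

lemma tendsto_log_norm_div_sqrt {w : ℂ} (hw : ‖w‖ < 1) (h : ∃ k ∈ Finset.Icc 1 3, Dominates k w) :
    Tendsto (fun n : ℕ => Real.log ‖(partitionPoly n).eval w‖ / √(n : ℝ)) atTop
      (𝓝 (2 * topF w)) := by
  obtain ⟨k, hk, hd⟩ := h
  rw [hd.topF_eq hk]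
  exact hd.tendsto_log hk hw

/-- Without zeros near `a` along a subsequence, `2 topF` inherits the mean value property. If `f_k`
attains the maximum at `a`, then `topF - f_k ≥ 0` has mean zero around `a`, so `f_k = topF` nearby
and `a` is interior to `region k`, hence a point of strict dominance. -/
lemma eventually_exists_zero_of_mem_ball {a : ℂ} (ha : a ∈ attractor) (ha1 : ‖a‖ < 1) {ρ : ℝ}
    (hρ : 0 < ρ) : ∀ᶠ n in atTop, ∃ z ∈ ball a ρ, (partitionPoly n).eval z = 0 := by
  rcases eq_or_ne a 0 with rfl | ha0
  · exact Eventually.of_forall fun n => ⟨0, mem_ball_self hρ, eval_zero_partitionPoly n⟩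
  by_contra hcon
  rw [not_eventually] at hcon
  obtain ⟨k, hk, e⟩ := exists_f_eq_topF a
  have hk0 := ne_zero_of_mem_Icc hk
  have hpos : 0 < f k a := e ▸ topF_pos ha1 ha0
  obtain ⟨ε, hε, hball⟩ := Metric.eventually_nhds_iff_ball.1
    ((exists_ball_f_pos hk0 ha1 hpos).and (ball_mem_nhds a hρ))
  set S : Set ℕ := {n | ¬ ∃ z ∈ ball a ρ, (partitionPoly n).eval z = 0} with hS
  -- The filter plays the role of a subsequence of indices whose polynomials have no zero in the
  -- ball.
  set l : Filter ℕ := atTop ⊓ 𝓟 S with hl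
  have hne : l.NeBot := frequently_mem_iff_neBot.1 hcon
  have hlS : ∀ᶠ n in l, n ∈ S := mem_inf_of_right (mem_principal_self S)
  have hl1 : ∀ᶠ n in l, 1 ≤ n := (eventually_ge_atTop 1).filter_mono inf_le_left
  have hsub : ball a ε ⊆ ball (0 : ℂ) 1 := fun x hx => mem_ball_zero_iff.2 (hball x hx).1.1
  have hmean : ∀ r, 0 < r → r < ε → Real.circleAverage (fun x => 2 * topF x) a r = 2 * topF a := by
    intro r hr hrε
    refine circleAverage_eq_of_tendsto (l := l) (C := 3)
      (u := fun n x => Real.log ‖(partitionPoly n).eval x‖ / √(n : ℝ)) ?_ ?_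
      (continuousOn_const.mul (continuousOn_topF.mono hsub)) ?_ hr hrε
    · filter_upwards [hlS] with n hn
      exact harmonicOnNhd_log_norm_div _ fun z hz h0 => hn ⟨z, (hball z hz).2, h0⟩
    · filter_upwards [hl1] with n hn x hx
      have h1 := log_norm_partitionPoly_le hn x
      have h2 : Real.posLog ‖x‖ = 0 := by
        rw [Real.posLog_eq_zero_iff, abs_norm]
        exact (hball x hx).1.1.le
      rw [h2, mul_zero, add_zero] at h1
      exact (div_le_iff₀ (Real.sqrt_pos.2 (by exact_mod_cast hn))).2 h1
    · intro y hy
      refine (frequently_dominates (hball y hy).1.1).mono fun w hw => ?_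
      exact (tendsto_log_norm_div_sqrt hw.1 hw.2).mono_left inf_le_left
  have hharm : InnerProductSpace.HarmonicOnNhd (f k) (ball a ε) := fun y hy =>
    harmonicAt_f hk0 (hball y hy).1.1 (hball y hy).1.2
  have hzero : ∀ y ∈ ball a ε, 2 * topF y - 2 * f k y = 0 := by
    intro y hy
    have hc1 : ContinuousOn (fun x => 2 * topF x) (ball a ε) :=
      continuousOn_const.mul (continuousOn_topF.mono hsub)
    have hh2 : InnerProductSpace.HarmonicOnNhd (fun x => 2 * f k x) (ball a ε) := fun y hy => by
      simpa [Pi.smul_def] using (hharm y hy).const_smul (c := (2 : ℝ))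
    refine eq_zero_of_circleAverage_eq_zero (g := fun y => 2 * topF y - 2 * f k y)
      (hc1.sub hh2.continuousOn) (fun y _ => by linarith [f_le_topF hk y]) (by rw [e, sub_self])
      (fun r hr hrε => ?_) hy
    have hcl : closedBall a |r| ⊆ ball a ε := by
      rw [abs_of_pos hr]
      exact closedBall_subset_ball hrε
    have hi1 : CircleIntegrable (fun x => 2 * topF x) a r :=
      (hc1.mono (sphere_subset_closedBall.trans hcl)).circleIntegrable'
    have hi2 : CircleIntegrable (fun x => 2 * f k x) a r :=
      (hh2.continuousOn.mono (sphere_subset_closedBall.trans hcl)).circleIntegrable'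
    rw [Real.circleAverage_fun_sub hi1 hi2, hmean r hr hrε,
      InnerProductSpace.HarmonicOnNhd.circleAverage_eq (hh2.mono hcl), e, sub_self]
  have hint : a ∈ interior (region k) := by
    rw [mem_interior_iff_mem_nhds]
    filter_upwards [ball_mem_nhds a hε] with y hy
    exact mem_region_iff.2 ⟨hsub hy, by linarith [hzero y hy]⟩
  exact (mem_attractor_iff.1 ha).2 k hk ha1 (dominates_of_mem_interior_region hk ha1 hint)

lemma tendsto_sqrt_div_self : Tendsto (fun n : ℕ => 3 * √(n : ℝ) / n) atTop (𝓝 0) := by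
  have hs : Tendsto (fun n : ℕ => √(n : ℝ)) atTop atTop :=
    Real.tendsto_sqrt_atTop.comp tendsto_natCast_atTop_atTop
  have h : Tendsto (fun n : ℕ => 3 / √(n : ℝ)) atTop (𝓝 0) := tendsto_const_nhds.div_atTop hs
  refine h.congr fun n => ?_
  rw [mul_div_assoc, Real.sqrt_div_self', mul_one_div]

lemma tendsto_log_norm_div_of_dominates {w : ℂ} (hw : ‖w‖ < 1)
    (h : ∃ k ∈ Finset.Icc 1 3, Dominates k w) :
    Tendsto (fun n : ℕ => Real.log ‖(partitionPoly n).eval w‖ / (n : ℝ)) atTop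
      (𝓝 (Real.posLog ‖w‖)) := by
  have hp : Real.posLog ‖w‖ = 0 := by
    rw [Real.posLog_eq_zero_iff, abs_norm]
    exact hw.le
  have hs : Tendsto (fun n : ℕ => √(n : ℝ)) atTop atTop :=
    Real.tendsto_sqrt_atTop.comp tendsto_natCast_atTop_atTop
  rw [hp]
  refine ((tendsto_log_norm_div_sqrt hw h).div_atTop hs).congr fun n => ?_
  rw [div_div, Real.mul_self_sqrt (Nat.cast_nonneg n)]

lemma tendsto_log_norm_div_of_one_lt {w : ℂ} (hw : 1 < ‖w‖) :
    Tendsto (fun n : ℕ => Real.log ‖(partitionPoly n).eval w‖ / (n : ℝ)) atTop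
      (𝓝 (Real.posLog ‖w‖)) := by
  have hp : Real.posLog ‖w‖ = Real.log ‖w‖ := Real.posLog_eq_log (by rw [abs_norm]; exact hw.le)
  have hw0 : 0 < ‖w‖ := by linarith
  obtain ⟨c, hc, hext⟩ := exists_le_norm_partitionPoly_eval (inv_pos.2 hw0)
    (inv_lt_one_of_one_lt₀ hw)
  rw [inv_inv] at hext
  have hlow : Tendsto (fun n : ℕ => Real.log c / (n : ℝ) + Real.posLog ‖w‖) atTop
      (𝓝 (Real.posLog ‖w‖)) := by
    simpa using (tendsto_const_div_atTop_nhds_zero_nat (Real.log c)).add_const (Real.posLog ‖w‖)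
  have hup : Tendsto (fun n : ℕ => 3 * √(n : ℝ) / n + Real.posLog ‖w‖) atTop
      (𝓝 (Real.posLog ‖w‖)) := by
    simpa using tendsto_sqrt_div_self.add_const (Real.posLog ‖w‖)
  refine tendsto_of_tendsto_of_tendsto_of_le_of_le' hlow hup ?_ ?_
  · filter_upwards [hext, eventually_ge_atTop 1] with n h1 hn
    have hn0 : (0 : ℝ) < n := by exact_mod_cast hn
    have h2 := Real.log_le_log (by positivity) (h1 w le_rfl)
    rw [Real.log_mul hc.ne' (by positivity), Real.log_pow, ← hp] at h2
    rw [le_div_iff₀ hn0, add_mul, div_mul_cancel₀ _ hn0.ne']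
    linarith
  · filter_upwards [eventually_ge_atTop 1] with n hn
    have hn0 : (0 : ℝ) < n := by exact_mod_cast hn
    have h2 := log_norm_partitionPoly_le hn w
    rw [div_le_iff₀ hn0, add_mul, div_mul_cancel₀ _ hn0.ne']
    linarith

lemma frequently_one_lt_norm {y : ℂ} (hy : 1 ≤ ‖y‖) : ∃ᶠ w in 𝓝 y, 1 < ‖w‖ := by
  have h : Tendsto (fun t : ℝ => ((1 + t : ℝ) : ℂ) * y) (𝓝[>] 0) (𝓝 y) := by
    have : Continuous fun t : ℝ => ((1 + t : ℝ) : ℂ) * y := by fun_prop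
    have h1 := this.tendsto 0
    simp only [add_zero, Complex.ofReal_one, one_mul] at h1
    exact h1.mono_left nhdsWithin_le_nhds
  refine h.frequently (Eventually.frequently ?_)
  filter_upwards [self_mem_nhdsWithin] with t ht
  have ht0 : 0 < t := ht
  rw [norm_mul, Complex.norm_real, Real.norm_eq_abs, abs_of_pos (by linarith)]
  nlinarith

/-- With the coarser scale `n` in place of `√n`, the limit is `log⁺ |x|` on a dense set of points.
It vanishes at `a`, so the mean value property would force it to vanish near `a`, although it is
positive outside the disk. -/
lemma eventually_exists_zero_of_mem_sphere {a : ℂ} (ha : ‖a‖ = 1) {ρ : ℝ} (hρ : 0 < ρ) :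
    ∀ᶠ n in atTop, ∃ z ∈ ball a ρ, (partitionPoly n).eval z = 0 := by
  by_contra hcon
  rw [not_eventually] at hcon
  set S : Set ℕ := {n | ¬ ∃ z ∈ ball a ρ, (partitionPoly n).eval z = 0} with hS
  set l : Filter ℕ := atTop ⊓ 𝓟 S with hl
  have hne : l.NeBot := frequently_mem_iff_neBot.1 hcon
  have hlS : ∀ᶠ n in l, n ∈ S := mem_inf_of_right (mem_principal_self S)
  have hl1 : ∀ᶠ n in l, 1 ≤ n := (eventually_ge_atTop 1).filter_mono inf_le_left
  have hcont : Continuous fun x : ℂ => Real.posLog ‖x‖ := Real.continuous_posLog.comp continuous_norm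
  have hpa : Real.posLog ‖a‖ = 0 := by
    rw [Real.posLog_eq_zero_iff, abs_norm]
    exact ha.le
  have hmean : ∀ r, 0 < r → r < ρ → Real.circleAverage (fun x => Real.posLog ‖x‖) a r = 0 := by
    intro r hr hrρ
    rw [← hpa]
    refine circleAverage_eq_of_tendsto (l := l) (C := 3 + Real.posLog (1 + ρ))
      (m := fun x => Real.posLog ‖x‖)
      (u := fun n x => Real.log ‖(partitionPoly n).eval x‖ / (n : ℝ)) ?_ ?_
      hcont.continuousOn ?_ hr hrρ
    · filter_upwards [hlS] with n hn
      exact harmonicOnNhd_log_norm_div _ fun z hz h0 => hn ⟨z, hz, h0⟩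
    · filter_upwards [hl1] with n hn x hx
      have hn1 : (1 : ℝ) ≤ n := by exact_mod_cast hn
      have h1 := log_norm_partitionPoly_le hn x
      have h2 : Real.posLog ‖x‖ ≤ Real.posLog (1 + ρ) := by
        refine Real.posLog_le_posLog (norm_nonneg _) ?_
        rw [mem_ball, dist_eq_norm] at hx
        have := norm_le_norm_add_norm_sub a x
        rw [norm_sub_rev] at this
        linarith
      have h3 : √(n : ℝ) ≤ n := Real.sqrt_le_self_iff.2 (Or.inr hn1)
      rw [div_le_iff₀ (by linarith)]
      nlinarith
    · intro y _
      rcases lt_or_ge ‖y‖ 1 with hy | hy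
      · exact (frequently_dominates hy).mono fun w hw =>
          (tendsto_log_norm_div_of_dominates hw.1 hw.2).mono_left inf_le_left
      · exact (frequently_one_lt_norm hy).mono fun w hw =>
          (tendsto_log_norm_div_of_one_lt hw).mono_left inf_le_left
  obtain ⟨w, hw1, hw2⟩ := ((frequently_one_lt_norm ha.ge).and_eventually
    (ball_mem_nhds a hρ)).exists
  have h0 := eq_zero_of_circleAverage_eq_zero (g := fun x => Real.posLog ‖x‖) hcont.continuousOn
    (fun _ _ => Real.posLog_nonneg) hpa hmean hw2
  rw [Real.posLog_eq_zero_iff, abs_norm] at h0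
  linarith

/-- Compactness of the attractor makes the pointwise existence of nearby zeros uniform, at the cost
of halving the radius. -/
lemma eventually_forall_attractor_near {ε : ℝ} (hε : 0 < ε) :
    ∀ᶠ n in atTop, ∀ a ∈ attractor, ∃ z, (partitionPoly n).eval z = 0 ∧ dist a z ≤ ε := by
  refine isCompact_attractor.induction_on
    (p := fun s => ∀ᶠ n in atTop, ∀ a ∈ s, ∃ z, (partitionPoly n).eval z = 0 ∧ dist a z ≤ ε)
    (by simp) (fun s t hst ht => ht.mono fun n hn z hz => hn z (hst hz))
    (fun s t hs ht => ?_) fun a ha => ?_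
  · filter_upwards [hs, ht] with n h1 h2 z hz
    exact hz.elim (h1 z) (h2 z)
  · refine ⟨ball a (ε / 2), mem_nhdsWithin_of_mem_nhds (ball_mem_nhds a (half_pos hε)), ?_⟩
    have h : ∀ᶠ n in atTop, ∃ z ∈ ball a (ε / 2), (partitionPoly n).eval z = 0 := by
      rcases (mem_attractor_iff.1 ha).1.eq_or_lt with h | h
      · exact eventually_exists_zero_of_mem_sphere h (half_pos hε)
      · exact eventually_exists_zero_of_mem_ball ha h (half_pos hε)
    filter_upwards [h] with n hn b hb
    obtain ⟨z, hz, h0⟩ := hn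
    refine ⟨z, h0, ?_⟩
    rw [mem_ball] at hz hb
    linarith [dist_triangle_right b z a]

/-! ### Convergence in the Hausdorff distance. -/

theorem isZeroAttractor_attractor : IsZeroAttractor partitionPoly attractor := by
  refine ⟨isCompact_attractor, ⟨1, Or.inl (by simp)⟩, ?_⟩
  rw [ENNReal.tendsto_nhds_zero]
  intro ε hε
  obtain ⟨δ, hδ, hδε⟩ := ENNReal.lt_iff_exists_nnreal_btwn.1 hε
  have hδ0 : (0 : ℝ) < δ := by exact_mod_cast hδ
  filter_upwards [eventually_forall_zero_near hδ0, eventually_forall_attractor_near hδ0]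
    with n h1 h2
  refine (hausdorffEDist_le_of_mem_edist (fun z hz => ?_) fun a ha => ?_).trans hδε.le
  · obtain ⟨y, hy, hd⟩ := h1 z hz
    exact ⟨y, hy, by rw [edist_nndist]; exact_mod_cast hd⟩
  · obtain ⟨z, hz, hd⟩ := h2 a ha
    exact ⟨z, hz, by rw [edist_nndist]; exact_mod_cast hd⟩

end PartitionZeros

end

open PartitionZeros in
theorem mainTheorem1 :
    IsZeroAttractor partitionPoly
      (sphere (0 : ℂ) 1 ∪
        (frontier (region 1) ∪ frontier (region 2) ∪ frontier (region 3)) ∩ ball (0 : ℂ) 1) ∧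
    frontier (region 1) ∩ ball (0 : ℂ) 1 = region 1 ∩ (sqrtLiCurve 1 2 ∪ sqrtLiCurve 1 3) ∧
    frontier (region 2) ∩ ball (0 : ℂ) 1 = region 2 ∩ (sqrtLiCurve 1 2 ∪ sqrtLiCurve 2 3) ∧
    frontier (region 3) ∩ ball (0 : ℂ) 1 = region 3 ∩ (sqrtLiCurve 1 3 ∪ sqrtLiCurve 2 3) := by
  exact ⟨isZeroAttractor_attractor, frontier_region_one, frontier_region_two,
    frontier_region_three⟩
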